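/- **Corollary (Reconstruction in $\mathbb R^2$).** *Setting.* Let $K$ be an unknown finite geometric simplicial complex embedded in $\mathbb R^2$ whose vertices are in general position: no three are collinear and no two have the same second coordinate. Let $n$ be the number of vertices of $K$. For a direction $s\in\mathbb S^1$, the lower-star filtration gives each simplex the height $\max\{s\cdot v : v \text{ a vertex of the simplex}\}$. The augmented persistence diagram of $K$ in direction $s$ consists, in every homological dimension, of the pairs (birth height, death height) of all persistence pairs (homology over $\mathbb Z/2$) obtained by adding the simplices one at a time in order of height, each after its faces; pairs with equal heights are kept, and the death height is $\infty$ for classes that never die. The complex is accessible only through an oracle. A query with a direction $s$ takes $\Pi=\Pi(n)$ time and returns the augmented persistence diagram in direction $s$, stored in every dimension as an array sorted by birth and an array sorted by death. The model of computation is a real RAM (natural-number and real memory cells with indirect addressing; unit-cost comparisons, addition, subtraction and halving of natural numbers; unit-cost comparisons, $+,-,\cdot,/,\sqrt{\ },\sin,\cos,\arctan$ on real numbers) extended by these queries. Write $d=2$ for the ambient dimension. *Statement.* There are a program $E$ and a constant $C$ such that the following holds for every class $\mathcal K$ of complexes as above, every $\Pi:\mathbb N\to\mathbb N$, and all functions $T_V,D_V:\mathbb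 N\to\mathbb R$. Let $P$ be a vertex-reconstruction method for $\mathcal K$, that is, a program which on every $K\in\mathcal K$ computes the list of all vertices of $K$ using at most $T_V(n)$ time (including oracle time) and at most $D_V(n)$ diagrams. Then running $P$ and afterwards $E$ reconstructs, for every $K\in\mathcal K$, the one-skeleton of $K$ (the list of its vertices and the list of its edges), using at most $$C\,\bigl(D_V(n)+n\log n\bigr)\ \text{ diagrams and at most }\ C\,\bigl(T_V(n)+n^2+n\log n\,(d+\Pi(n))\bigr)\ \text{ time.}$$ -/

import Mathlib

noncomputable section

/-- The Euclidean plane `ℝ²`; `x 0`, `x 1` are the coordinates with respect to `e₁`, `e₂`. -/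
abbrev Plane := EuclideanSpace ℝ (Fin 2)

/-! ### Plane complexes in general position -/

/-- General position of a point set in `ℝ²`. For `d = 2` the projection onto the
`(e₁, e₂)`-plane is the identity, so "every `d + 1` points are affinely independent" and "no three
points are collinear after projection" are both the first field. -/
structure GeneralPosition (V : Set Plane) : Prop where
  affineIndependent : ∀ a ∈ V, ∀ b ∈ V, ∀ c ∈ V, a ≠ b → a ≠ c → b ≠ c →
    AffineIndependent ℝ ![a, b, c]
  unique_height : ∀ a ∈ V, ∀ b ∈ V, a 1 = b 1 → a = b

/-- A finite (geometric) simplicial complex embedded in `ℝ²`, with vertices in general position. -/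
structure PlaneComplex extends Geometry.SimplicialComplex ℝ Plane where
  finite_faces : faces.Finite
  generalPosition : GeneralPosition toSimplicialComplex.vertices

namespace PlaneComplex

/-- The vertex set. -/
def verts (K : PlaneComplex) : Set Plane := K.toSimplicialComplex.vertices

/-- The number `n` of vertices. -/
def numVerts (K : PlaneComplex) : ℕ := K.verts.ncard

/-- The edges, as two-element sets of vertices. -/
def edges (K : PlaneComplex) : Set (Finset Plane) := {σ | σ ∈ K.faces ∧ σ.card = 2}

end PlaneComplex

/-! ### Simplicial homology over `ℤ/2` and persistence -/

/-- Formal `ℤ/2`-linear combinations of finite point sets. -/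
abbrev Chain := Finset Plane →₀ ZMod 2

open Classical in
/-- The simplicial boundary operator mod 2: a simplex is sent to the sum of its facets, a vertex
to `0`. -/
def boundaryMap : Chain →ₗ[ZMod 2] Chain :=
  Finsupp.linearCombination (ZMod 2) fun σ : Finset Plane =>
    if σ.card ≤ 1 then (0 : Chain) else ∑ v ∈ σ, Finsupp.single (σ.erase v) 1

/-- The `p`-chains of a family `L` of simplices. -/
def chainSpace (L : Set (Finset Plane)) (p : ℕ) : Submodule (ZMod 2) Chain :=
  Finsupp.supported (ZMod 2) (ZMod 2) {σ | σ ∈ L ∧ σ.card = p + 1}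

/-- The `p`-cycles `Z_p(L)`. -/
def cycleSpace (L : Set (Finset Plane)) (p : ℕ) : Submodule (ZMod 2) Chain :=
  chainSpace L p ⊓ LinearMap.ker boundaryMap

/-- The `p`-boundaries `B_p(L)`. -/
def boundarySpace (L : Set (Finset Plane)) (p : ℕ) : Submodule (ZMod 2) Chain :=
  (chainSpace L (p + 1)).map boundaryMap

/-- The persistent Betti number: for finite families `L ⊆ M`, the rank of `H_p(L) → H_p(M)`, that is
the dimension of `Z_p(L) / (Z_p(L) ∩ B_p(M))`. -/
def persistentBetti (L M : Set (Finset Plane)) (p : ℕ) : ℕ :=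
  Module.finrank (ZMod 2) (cycleSpace L p) -
    Module.finrank (ZMod 2) ↥(cycleSpace L p ⊓ boundarySpace M p)

/-- The lower-star filter function in direction `s`: the height of a simplex is the maximum of
`s · v` over its vertices `v`. -/
def height (s : Plane) (σ : Finset Plane) : ℝ := sSup ((fun v => inner ℝ s v) '' (σ : Set Plane))

/-- `L` lists all simplices of `K`, without repetition, each simplex after its faces and in order of
weakly increasing height in direction `s`. Adding the simplices one at a time in this order refines
the lower-star filtration. -/
structure IsCompatibleOrder (K : PlaneComplex) (s : Plane) (L : List (Finset Plane)) : Prop where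
  mem_iff : ∀ σ, σ ∈ L ↔ σ ∈ K.faces
  ordered : L.Pairwise fun σ τ => height s σ ≤ height s τ ∧ ¬ τ ⊆ σ

/-- The subcomplex formed by the first `j` simplices of the list. -/
def stage (L : List (Finset Plane)) (j : ℕ) : Set (Finset Plane) := {σ | σ ∈ L.take j}

/-- The number (`0` or `1`) of `p`-dimensional classes that are born with the entry of the simplex
`L[a]` and die with the entry of the simplex `L[b]`, `a < b`. -/
def pairMultiplicity (L : List (Finset Plane)) (p a b : ℕ) : ℕ :=
  (((persistentBetti (stage L (a + 1)) (stage L b) p : ℤ) -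
      persistentBetti (stage L (a + 1)) (stage L (b + 1)) p) -
    ((persistentBetti (stage L a) (stage L b) p : ℤ) -
      persistentBetti (stage L a) (stage L (b + 1)) p)).toNat

/-- The number (`0` or `1`) of `p`-dimensional classes that are born with the entry of the simplex
`L[a]` and never die. -/
def essentialMultiplicity (L : List (Finset Plane)) (p a : ℕ) : ℕ :=
  ((persistentBetti (stage L (a + 1)) (stage L L.length) p : ℤ) -
    persistentBetti (stage L a) (stage L L.length) p).toNat

/-- A point `(b, d)` of a diagram: birth height and death height, `⊤` for a class that never dies. -/
abbrev DgmPoint := ℝ × WithTop ℝ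

/-- The `p`-dimensional augmented persistence diagram in direction `s`, computed from the compatible
order `L`: every birth-death pair of simplices contributes the pair of their heights, also when
the two heights are equal. -/
def augmentedDiagram (s : Plane) (L : List (Finset Plane)) (p : ℕ) : Multiset DgmPoint :=
  ∑ a ∈ Finset.range L.length,
    (Multiset.replicate (essentialMultiplicity L p a) (height s (L.getD a ∅), (⊤ : WithTop ℝ)) +
      ∑ b ∈ Finset.Ico (a + 1) L.length,
        Multiset.replicate (pairMultiplicity L p a b)
          (height s (L.getD a ∅), ((height s (L.getD b ∅) : ℝ) : WithTop ℝ)))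

/-! ### The oracle -/

/-- The data structure holding a diagram: for every dimension, the array of its points sorted by
birth and the array of its points sorted by death. -/
structure DgmData where
  byBirth : ℕ → List DgmPoint
  byDeath : ℕ → List DgmPoint

/-- `D` stores the augmented persistence diagram of `K` in direction `s`. -/
def StoresDiagram (K : PlaneComplex) (s : Plane) (D : DgmData) : Prop :=
  ∃ L, IsCompatibleOrder K s L ∧ ∀ p,
    (D.byBirth p : Multiset DgmPoint) = augmentedDiagram s L p ∧
    (D.byBirth p).Pairwise (fun x y => x.1 ≤ y.1) ∧
    (D.byDeath p : Multiset DgmPoint) = augmentedDiagram s L p ∧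
    (D.byDeath p).Pairwise (fun x y => x.2 ≤ y.2)

/-- `O` answers every query for a direction on the unit circle with the diagram of `K` in this
direction. -/
def IsOracleFor (K : PlaneComplex) (O : Plane → DgmData) : Prop :=
  ∀ s : Plane, ‖s‖ = 1 → StoresDiagram K s (O s)

/-! ### The machine: a real RAM with oracle access -/

namespace RealRAM

/-- A configuration: a memory of natural numbers (used for indices and counters), a memory of real
numbers, and the diagrams obtained so far, numbered `0, …, queries - 1`. -/
structure State where
  nats : ℕ → ℕ
  reals : ℕ → ℝ
  dgms : ℕ → DgmData
  queries : ℕ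

/-- The initial configuration: nothing is known about the unknown complex. -/
def init : State := ⟨fun _ => 0, fun _ => 0, fun _ => ⟨fun _ => [], fun _ => []⟩, 0⟩

/-- Natural-number expressions: constants, (indirect) memory access, addition, truncated
subtraction, halving rounded down, the number of diagrams obtained so far, and the number of points
of dimension `p` in the diagram number `h`. -/
inductive NExpr
  | const (k : ℕ)
  | mem (a : NExpr)
  | add (a b : NExpr)
  | sub (a b : NExpr)
  | half (a : NExpr)
  | numDgms
  | dgmSize (h p : NExpr)

/-- Which of the two sorted arrays of a diagram is accessed. -/
inductive SortKey
  | birth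
  | death

/-- Real expressions: rational constants, (indirect) memory access, conversion of a natural number,
arithmetic, the functions `√`, `sin`, `cos`, `arctan`, and the birth and death values of the `i`-th
point of dimension `p` in one of the two sorted arrays of the diagram number `h`. -/
inductive RExpr
  | const (q : ℚ)
  | mem (a : NExpr)
  | ofNat (a : NExpr)
  | add (x y : RExpr)
  | sub (x y : RExpr)
  | mul (x y : RExpr)
  | div (x y : RExpr)
  | sqrt (x : RExpr)
  | sin (x : RExpr)
  | cos (x : RExpr)
  | arctan (x : RExpr)
  | birthOf (key : SortKey) (h p i : NExpr)
  | deathOf (key : SortKey) (h p i : NExpr)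

/-- Tests: comparison of natural numbers and of real numbers, whether a point of a diagram has
infinite death value, negation. -/
inductive Test
  | natLt (a b : NExpr)
  | realLt (x y : RExpr)
  | deathInf (key : SortKey) (h p i : NExpr)
  | not (t : Test)

/-- Programs. `query x y` asks the oracle for the diagram in direction `(x, y)`. -/
inductive Prog
  | skip
  | setNat (a v : NExpr)
  | setReal (a : NExpr) (v : RExpr)
  | query (x y : RExpr)
  | seq (P Q : Prog)
  | ite (t : Test) (P Q : Prog)
  | loop (t : Test) (P : Prog)

/-- The sorted array of the points of dimension `p`. -/
def pts (D : DgmData) : SortKey → ℕ → List DgmPoint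
  | .birth, p => D.byBirth p
  | .death, p => D.byDeath p

/-- The `i`-th entry of a sorted array (`(0, 0)` beyond its end). -/
def pt (D : DgmData) (key : SortKey) (p i : ℕ) : DgmPoint := (pts D key p).getD i (0, 0)

/-- Value of a natural-number expression. -/
def NExpr.eval (st : State) : NExpr → ℕ
  | .const k => k
  | .mem a => st.nats (a.eval st)
  | .add a b => a.eval st + b.eval st
  | .sub a b => a.eval st - b.eval st
  | .half a => a.eval st / 2
  | .numDgms => st.queries
  | .dgmSize h p => ((st.dgms (h.eval st)).byBirth (p.eval st)).length

/-- Value of a real expression (an infinite death value reads as `0`). -/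
def RExpr.eval (st : State) : RExpr → ℝ
  | .const q => (q : ℝ)
  | .mem a => st.reals (a.eval st)
  | .ofNat a => (a.eval st : ℝ)
  | .add x y => x.eval st + y.eval st
  | .sub x y => x.eval st - y.eval st
  | .mul x y => x.eval st * y.eval st
  | .div x y => x.eval st / y.eval st
  | .sqrt x => Real.sqrt (x.eval st)
  | .sin x => Real.sin (x.eval st)
  | .cos x => Real.cos (x.eval st)
  | .arctan x => Real.arctan (x.eval st)
  | .birthOf key h p i => (pt (st.dgms (h.eval st)) key (p.eval st) (i.eval st)).1
  | .deathOf key h p i => (pt (st.dgms (h.eval st)) key (p.eval st) (i.eval st)).2.untopD 0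

/-- Truth of a test. -/
def Test.eval (st : State) : Test → Prop
  | .natLt a b => a.eval st < b.eval st
  | .realLt x y => x.eval st < y.eval st
  | .deathInf key h p i => (pt (st.dgms (h.eval st)) key (p.eval st) (i.eval st)).2 = ⊤
  | .not t => ¬ t.eval st

/-- Number of operations in a natural-number expression. -/
def NExpr.cost : NExpr → ℕ
  | .const _ => 1
  | .mem a => a.cost + 1
  | .add a b => a.cost + b.cost + 1
  | .sub a b => a.cost + b.cost + 1
  | .half a => a.cost + 1
  | .numDgms => 1
  | .dgmSize h p => h.cost + p.cost + 1

/-- Number of operations in a real expression. -/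
def RExpr.cost : RExpr → ℕ
  | .const _ => 1
  | .mem a => a.cost + 1
  | .ofNat a => a.cost + 1
  | .add x y => x.cost + y.cost + 1
  | .sub x y => x.cost + y.cost + 1
  | .mul x y => x.cost + y.cost + 1
  | .div x y => x.cost + y.cost + 1
  | .sqrt x => x.cost + 1
  | .sin x => x.cost + 1
  | .cos x => x.cost + 1
  | .arctan x => x.cost + 1
  | .birthOf _ h p i => h.cost + p.cost + i.cost + 1
  | .deathOf _ h p i => h.cost + p.cost + i.cost + 1

/-- Number of operations in a test. -/
def Test.cost : Test → ℕ
  | .natLt a b => a.cost + b.cost + 1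
  | .realLt x y => x.cost + y.cost + 1
  | .deathInf _ h p i => h.cost + p.cost + i.cost + 1
  | .not t => t.cost + 1

/-- `Exec O q P st st' t`: with oracle `O` and `q` time steps per oracle query, the program `P`
started in `st` halts in `st'` after `t` time steps. A query is only possible for a unit vector. -/
inductive Exec (O : Plane → DgmData) (q : ℕ) : Prog → State → State → ℕ → Prop
  | skip (st : State) : Exec O q .skip st st 1
  | setNat (a v : NExpr) (st : State) :
      Exec O q (.setNat a v) st
        { st with nats := Function.update st.nats (a.eval st) (v.eval st) }
        (a.cost + v.cost + 1)
  | setReal (a : NExpr) (v : RExpr) (st : State) :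
      Exec O q (.setReal a v) st
        { st with reals := Function.update st.reals (a.eval st) (v.eval st) }
        (a.cost + v.cost + 1)
  | query (x y : RExpr) (st : State) (hunit : ‖(!₂[x.eval st, y.eval st] : Plane)‖ = 1) :
      Exec O q (.query x y) st
        { st with
          dgms := Function.update st.dgms st.queries (O !₂[x.eval st, y.eval st])
          queries := st.queries + 1 }
        (x.cost + y.cost + 1 + q)
  | seq {P Q : Prog} {st₁ st₂ st₃ : State} {t₁ t₂ : ℕ} :
      Exec O q P st₁ st₂ t₁ → Exec O q Q st₂ st₃ t₂ → Exec O q (.seq P Q) st₁ st₃ (t₁ + t₂)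
  | ite_true {c : Test} {P Q : Prog} {st st' : State} {t : ℕ} :
      c.eval st → Exec O q P st st' t → Exec O q (.ite c P Q) st st' (c.cost + t)
  | ite_false {c : Test} {P Q : Prog} {st st' : State} {t : ℕ} :
      ¬ c.eval st → Exec O q Q st st' t → Exec O q (.ite c P Q) st st' (c.cost + t)
  | loop_done {c : Test} {P : Prog} {st : State} :
      ¬ c.eval st → Exec O q (.loop c P) st st c.cost
  | loop_step {c : Test} {P : Prog} {st₁ st₂ st₃ : State} {t₁ t₂ : ℕ} :
      c.eval st₁ → Exec O q P st₁ st₂ t₁ → Exec O q (.loop c P) st₂ st₃ t₂ →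
      Exec O q (.loop c P) st₁ st₃ (c.cost + t₁ + t₂)

/-! ### Reconstruction -/

/-- The point number `i` in real memory: its coordinates are in the cells `2 i` and `2 i + 1`. -/
def State.point (st : State) (i : ℕ) : Plane := !₂[st.reals (2 * i), st.reals (2 * i + 1)]

/-- The memory holds the vertices of `K`: their number `n` is in the natural-number cell `0`, and the
points number `0, …, n - 1` are the vertices of `K`, each exactly once. -/
def StoresVertices (K : PlaneComplex) (st : State) : Prop :=
  Set.BijOn st.point (Set.Iio (st.nats 0)) K.verts

open Classical in
/-- The endpoints of the edge number `k` in memory: the numbers of these two vertices are in the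
natural-number cells `2 k + 2` and `2 k + 3`. -/
def State.edge (st : State) (k : ℕ) : Finset Plane :=
  {st.point (st.nats (2 * k + 2)), st.point (st.nats (2 * k + 3))}

/-- The memory holds the one-skeleton of `K`: the vertices as above, the number `m` of edges in the
natural-number cell `1`, and the edges number `0, …, m - 1`, given by the numbers of their
endpoints, are the edges of `K`, each exactly once. -/
def StoresOneSkeleton (K : PlaneComplex) (st : State) : Prop :=
  StoresVertices K st ∧
  (∀ k < st.nats 1, st.nats (2 * k + 2) < st.nats 0 ∧ st.nats (2 * k + 3) < st.nats 0) ∧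
  Set.BijOn st.edge (Set.Iio (st.nats 1)) K.edges

/-- For every complex in the class `𝒦`, accessed only through an oracle whose queries take
`Q n` time steps, the program `P` halts with a memory content as required by `Goal`, after at most
`T n` time steps and at most `D n` oracle queries, where `n` is the number of vertices. -/
def Reconstructs (Goal : PlaneComplex → State → Prop) (𝒦 : Set PlaneComplex) (Q : ℕ → ℕ)
    (P : Prog) (T D : ℕ → ℝ) : Prop :=
  ∀ K ∈ 𝒦, ∀ O : Plane → DgmData, IsOracleFor K O →
    ∃ (st : State) (t : ℕ), Exec O (Q K.numVerts) P init st t ∧ Goal K st ∧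
      (t : ℝ) ≤ T K.numVerts ∧ (st.queries : ℝ) ≤ D K.numVerts

end RealRAM

end

/-! Fix a vertex `v` and let the key of another vertex `u` be the inverse slope of the line through
`v` and `u`. No three vertices are collinear, so the keys are distinct and the edges going up from
`v` are linearly ordered by key. Finding the edge of rank `k` is a selection problem for which
persistence diagrams act as counting queries.

Counting: when simplices enter one at a time, an edge either kills a component or creates a 1-cycle.
Hence the number of edges of height `z` is the number of deaths `z` in dimension 0 plus the number
of births `z` in dimension 1 (`IsCompatibleOrder.countP_add_countP`). If no other vertex shares the
height of `v`, the edges at the height of `v` are those joining `v` to a lower vertex in the chosen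
direction. Binary search in the sorted arrays counts them in logarithmic time. The downward
direction yields the number of edges going up from `v` (`countP_down`). The direction orthogonal to
the lines of inverse slope `κ` yields the up-edges with key below `κ` plus the down-edges with key
above `κ` (`countP_slopeDir`). Vertices are treated by increasing height, so the down-edges are
already known and can be discounted.

Search: the candidates are initially all vertices except `v`. A step chooses a pivot among them,
queries a threshold between its key and the next larger key, and keeps one side (`Narrowed.step`).
The pivot is an approximate median, found in linear time by deterministic thinning: groups of eight
blocks are merged and only every fourth element by rank survives (`IsThinned.succ`,
`IsThinned.split`, `Does.pivot`). Each step discards at least 1/64 of the candidates. By a geometric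
series, one edge costs `O(n)` time for handling candidates and `O(log n)` queries
(`Does.searchLoop`).

Total: an embedded complex has at most `3 n` edges (`IsDrawing.ncard_edges_le`), proved by charging
angularly neighbouring edges to vertices visible horizontally. This gives `O(n log n)` queries and
`O(n ^ 2)` time for handling candidates. The binary searches add `O(n log ^ 2 n)`, which is `O(n ^
2)` (`size_mul_log_le`). Sorting by height and flagging known neighbours are quadratic as well. -/

noncomputable section

namespace RealRAM

/-! ### Timed execution -/

/-- Started in `st`, the program `P` halts within time `T` in a state satisfying `R`. -/
def Does (O : Plane → DgmData) (q : ℕ) (P : Prog) (st : State) (T : ℝ) (R : State → Prop) : Prop :=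
  ∃ (st' : State) (t : ℕ), Exec O q P st st' t ∧ (t : ℝ) ≤ T ∧ R st'

variable {O : Plane → DgmData} {q : ℕ}

theorem Does.mono {P : Prog} {st : State} {T T' : ℝ} {R R' : State → Prop}
    (h : Does O q P st T R) (hT : T ≤ T') (hR : ∀ s, R s → R' s) : Does O q P st T' R' := by
  obtain ⟨st', t, h1, h2, h3⟩ := h
  exact ⟨st', t, h1, h2.trans hT, hR _ h3⟩

theorem Does.seq {P Q : Prog} {st : State} {T₁ T₂ : ℝ} {R R' : State → Prop}
    (h : Does O q P st T₁ R') (h' : ∀ s, R' s → Does O q Q s T₂ R) :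
    Does O q (.seq P Q) st (T₁ + T₂) R := by
  obtain ⟨s1, t1, h1, h2, h3⟩ := h
  obtain ⟨s2, t2, h4, h5, h6⟩ := h' _ h3
  exact ⟨s2, t1 + t2, .seq h1 h4, by push_cast; linarith, h6⟩

/-- Sequential composition, with the remaining time in the second premise. -/
theorem Does.step {P Q : Prog} {st : State} {T T₁ : ℝ} {R R' : State → Prop}
    (h : Does O q P st T₁ R') (h' : ∀ s, R' s → Does O q Q s (T - T₁) R) :
    Does O q (.seq P Q) st T R :=
  (h.seq h').mono (by linarith) fun _ h => h

theorem Does.ite {P Q : Prog} {c : Test} {st : State} {T : ℝ} {R : State → Prop}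
    (h : c.eval st → Does O q P st T R) (h' : ¬ c.eval st → Does O q Q st T R) :
    Does O q (.ite c P Q) st (c.cost + T) R := by
  by_cases hc : c.eval st
  · obtain ⟨s1, t1, h1, h2, h3⟩ := h hc
    exact ⟨s1, c.cost + t1, .ite_true hc h1, by push_cast; linarith, h3⟩
  · obtain ⟨s1, t1, h1, h2, h3⟩ := h' hc
    exact ⟨s1, c.cost + t1, .ite_false hc h1, by push_cast; linarith, h3⟩

theorem Test.one_le_cost (c : Test) : 1 ≤ c.cost := by
  cases c <;> simp [Test.cost]

/-- Rule for loops with a potential function. -/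
theorem Does.while {P : Prog} {c : Test} (Inv : State → Prop) (Φ : State → ℝ)
    (hΦ : ∀ s, Inv s → 0 ≤ Φ s)
    (hstep : ∀ s, Inv s → c.eval s → ∃ T : ℝ,
      Does O q P s T (fun s' => Inv s' ∧ T + c.cost + Φ s' ≤ Φ s)) (st : State) (hst : Inv st) :
    Does O q (.loop c P) st (Φ st + c.cost) (fun s => Inv s ∧ ¬ c.eval s) := by
  -- Every round lowers the potential by at least the cost of the test, which is at least 1.
  -- Induction on an integer bound for the potential therefore gives termination and the time bound
  -- together.
  obtain ⟨N, hN⟩ := exists_nat_ge (Φ st)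
  induction N generalizing st with
  | zero =>
    have hc : ¬ c.eval st := by
      intro hc
      obtain ⟨T, s', t, -, h2, h3, h4⟩ := hstep st hst hc
      have := hΦ _ h3
      have h5 : (1 : ℝ) ≤ c.cost := by exact_mod_cast c.one_le_cost
      have h6 : (0 : ℝ) ≤ t := t.cast_nonneg
      norm_num at hN
      linarith
    exact ⟨st, c.cost, .loop_done hc, by linarith [hΦ _ hst], hst, hc⟩
  | succ N ih =>
    by_cases hc : c.eval st
    · obtain ⟨T, s', t, h1, h2, h3, h4⟩ := hstep st hst hc
      have h5 : (1 : ℝ) ≤ c.cost := by exact_mod_cast c.one_le_cost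
      have h6 : (0 : ℝ) ≤ t := t.cast_nonneg
      obtain ⟨s2, t2, h7, h8, h9⟩ := ih s' h3 (by push_cast at hN; linarith)
      exact ⟨s2, c.cost + t + t2, .loop_step hc h1 h7, by push_cast; linarith, h9⟩
    · exact ⟨st, c.cost, .loop_done hc, by linarith [hΦ _ hst], hst, hc⟩

/-! ### Programs without loops and queries -/

/-- The program contains neither loops nor queries. -/
def Prog.Simple : Prog → Prop
  | .skip => True
  | .setNat _ _ => True
  | .setReal _ _ => True
  | .query _ _ => False
  | .seq P Q => P.Simple ∧ Q.Simple
  | .ite _ P Q => P.Simple ∧ Q.Simple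
  | .loop _ _ => False

open Classical in
/-- The effect of a program without loops and queries. -/
def Prog.run : Prog → State → State
  | .skip, st => st
  | .setNat a v, st => { st with nats := Function.update st.nats (a.eval st) (v.eval st) }
  | .setReal a v, st => { st with reals := Function.update st.reals (a.eval st) (v.eval st) }
  | .query _ _, st => st
  | .seq P Q, st => Q.run (P.run st)
  | .ite c P Q, st => if c.eval st then P.run st else Q.run st
  | .loop _ _, st => st

/-- An upper bound for the running time of a program without loops and queries. -/
def Prog.time : Prog → ℕ
  | .skip => 1
  | .setNat a v => a.cost + v.cost + 1
  | .setReal a v => a.cost + v.cost + 1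
  | .query _ _ => 0
  | .seq P Q => P.time + Q.time
  | .ite c P Q => c.cost + (P.time + Q.time)
  | .loop _ _ => 0

theorem Prog.Simple.exec {P : Prog} (hP : P.Simple) (st : State) :
    ∃ t ≤ P.time, Exec O q P st (P.run st) t := by
  induction P generalizing st with
  | skip => exact ⟨1, le_rfl, .skip st⟩
  | setNat a v => exact ⟨_, le_rfl, .setNat a v st⟩
  | setReal a v => exact ⟨_, le_rfl, .setReal a v st⟩
  | query => exact hP.elim
  | loop => exact hP.elim
  | seq P Q ihP ihQ =>
    obtain ⟨t1, h1, h2⟩ := ihP hP.1 st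
    obtain ⟨t2, h3, h4⟩ := ihQ hP.2 (P.run st)
    exact ⟨t1 + t2, Nat.add_le_add h1 h3, .seq h2 h4⟩
  | ite c P Q ihP ihQ =>
    obtain ⟨t1, h1, h2⟩ := ihP hP.1 st
    obtain ⟨t2, h3, h4⟩ := ihQ hP.2 st
    by_cases hc : c.eval st
    · refine ⟨c.cost + t1, by simp only [Prog.time]; omega, ?_⟩
      simpa only [Prog.run, if_pos hc] using Exec.ite_true hc h2
    · refine ⟨c.cost + t2, by simp only [Prog.time]; omega, ?_⟩
      simpa only [Prog.run, if_neg hc] using Exec.ite_false hc h4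

theorem Does.simple {P : Prog} (hP : P.Simple) {st : State} {R : State → Prop}
    (h : R (P.run st)) : Does O q P st P.time R := by
  obtain ⟨t, h1, h2⟩ := hP.exec (O := O) (q := q) st
  exact ⟨_, t, h2, by exact_mod_cast h1, h⟩

/-! ### Scratch memory -/

/-- Names of the scratch arrays; the entry number `0` of an array is also used as a variable. -/
inductive Var
  | ord | e₀ | e₁ | nb | S
  | m | i | j | u | v | r | k | U | Lt | τ | N | p | p' | l | c | h | a | b | lo | hi | o | M | g | bs
  deriving DecidableEq

/-- The residue modulo `32` of the addresses of an array. -/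
def Var.code : Var → ℕ
  | ord => 0 | e₀ => 1 | e₁ => 2 | nb => 3 | S => 4 | m => 5 | i => 6 | j => 7 | u => 8 | v => 9
  | r => 10 | k => 11 | U => 12 | Lt => 13 | τ => 14 | N => 15 | p => 16 | p' => 17 | l => 18
  | c => 19 | h => 20 | a => 21 | b => 22 | lo => 23 | hi => 24 | o => 25 | M => 26 | g => 27
  | bs => 28

theorem Var.code_lt (x : Var) : x.code < 32 := by cases x <;> decide

theorem Var.code_injective : Function.Injective Var.code := by
  intro x y h
  cases x <;> cases y <;> first | rfl | exact absurd h (by decide)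

/-- The address of the entry `i` of the array `x`, beyond the cells `0, …, 8 n + 15`. -/
def State.addr (st : State) (x : Var) (i : ℕ) : ℕ := 8 * st.nats 0 + 16 + (32 * i + x.code)

/-- The entry `i` of the array `x`. -/
def State.F (st : State) (x : Var) (i : ℕ) : ℕ := st.nats (st.addr x i)

/-- Assignment to the entry `i` of the array `x`. -/
def State.set (st : State) (x : Var) (i w : ℕ) : State :=
  { st with nats := Function.update st.nats (st.addr x i) w }

theorem State.addr_eq_iff (st : State) (x y : Var) (i j : ℕ) :
    st.addr x i = st.addr y j ↔ x = y ∧ i = j := by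
  constructor
  · intro h
    have h1 := x.code_lt
    have h2 := y.code_lt
    unfold State.addr at h
    have h3 : i = j := by omega
    exact ⟨Var.code_injective (by omega), h3⟩
  · rintro ⟨rfl, rfl⟩; rfl

@[simp] theorem State.set_dgms (st : State) (x : Var) (i w : ℕ) :
    (st.set x i w).dgms = st.dgms := rfl

@[simp] theorem State.set_queries (st : State) (x : Var) (i w : ℕ) :
    (st.set x i w).queries = st.queries := rfl

theorem State.set_nats_of_lt (st : State) (x : Var) (i w a : ℕ) (ha : a < 8 * st.nats 0 + 16) :
    (st.set x i w).nats a = st.nats a := by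
  refine Function.update_of_ne ?_ _ _
  unfold State.addr; omega

@[simp] theorem State.set_nats_zero (st : State) (x : Var) (i w : ℕ) :
    (st.set x i w).nats 0 = st.nats 0 := st.set_nats_of_lt x i w 0 (by omega)

theorem State.set_F (st : State) (x y : Var) (i j w : ℕ) :
    (st.set x i w).F y j = if y = x ∧ j = i then w else st.F y j := by
  have h : (st.set x i w).addr y j = st.addr y j := by simp [State.addr]
  unfold State.F
  rw [h]
  by_cases hh : y = x ∧ j = i
  · rw [if_pos hh, (st.addr_eq_iff y x j i).2 hh]
    exact Function.update_self _ _ _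
  · rw [if_neg hh]
    exact Function.update_of_ne (fun h' => hh ((st.addr_eq_iff y x j i).1 h')) _ _

@[simp] theorem State.set_F_self (st : State) (x : Var) (i w : ℕ) :
    (st.set x i w).F x i = w := by simp [State.set_F]

theorem State.set_F_same (st : State) (x : Var) (i j w : ℕ) :
    (st.set x i w).F x j = if j = i then w else st.F x j := by simp [State.set_F]

@[simp] theorem State.set_F_of_ne (st : State) {x y : Var} (h : y ≠ x) (i w : ℕ) :
    (st.set x i w).F y = st.F y := by
  funext j; simp [State.set_F, h]

/-- Twice an expression. -/
def NExpr.dbl (a : NExpr) : NExpr := .add a a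

/-- The address of an array entry. -/
def cell (x : Var) (i : NExpr) : NExpr :=
  .add (.add (NExpr.mem (.const 0)).dbl.dbl.dbl (.const 16))
    (.add i.dbl.dbl.dbl.dbl.dbl (.const x.code))

/-- Reading an array entry. -/
def ld (x : Var) (i : NExpr) : NExpr := .mem (cell x i)

/-- Reading a variable. -/
def gv (x : Var) : NExpr := ld x (.const 0)

/-- Writing an array entry. -/
def sto (x : Var) (i v : NExpr) : Prog := .setNat (cell x i) v

/-- Writing a variable. -/
def sv (x : Var) (v : NExpr) : Prog := sto x (.const 0) v

@[simp] theorem NExpr.eval_dbl (st : State) (a : NExpr) : a.dbl.eval st = 2 * a.eval st := by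
  simp only [NExpr.dbl, NExpr.eval]; ring

theorem cell_eval (st : State) (x : Var) (i : NExpr) :
    (cell x i).eval st = st.addr x (i.eval st) := by
  simp only [cell, NExpr.eval, NExpr.eval_dbl, State.addr]; ring

@[simp] theorem ld_eval (st : State) (x : Var) (i : NExpr) :
    (ld x i).eval st = st.F x (i.eval st) := by
  simp only [ld, NExpr.eval, cell_eval, State.F]

@[simp] theorem gv_eval (st : State) (x : Var) : (gv x).eval st = st.F x 0 := by
  simp [gv, NExpr.eval]

@[simp] theorem sto_run (st : State) (x : Var) (i v : NExpr) :
    (sto x i v).run st = st.set x (i.eval st) (v.eval st) := by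
  simp only [sto, Prog.run, cell_eval, State.set]

@[simp] theorem sv_run (st : State) (x : Var) (v : NExpr) :
    (sv x v).run st = st.set x 0 (v.eval st) := by
  simp [sv, NExpr.eval]

@[simp] theorem sto_simple (x : Var) (i v : NExpr) : (sto x i v).Simple := trivial

@[simp] theorem sv_simple (x : Var) (v : NExpr) : (sv x v).Simple := trivial

attribute [irreducible] cell NExpr.dbl Prog.time

/-! ### Frames -/

/-- The step from `s` to `s'` changes at most the arrays in `X`; if `quiet` holds then the diagrams
are also unchanged. -/
structure Pres (quiet : Prop) (X : List Var) (s s' : State) : Prop where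
  reals : s'.reals = s.reals
  nats_zero : s'.nats 0 = s.nats 0
  F : ∀ y, y ∉ X → s'.F y = s.F y
  dgms : quiet → s'.dgms = s.dgms
  queries : quiet → s'.queries = s.queries

variable {quiet : Prop} {X Y : List Var} {s s' s'' : State}

theorem Pres.refl (s : State) : Pres quiet X s s := ⟨rfl, rfl, fun _ _ => rfl, fun _ => rfl, fun _ => rfl⟩

theorem Pres.mono {quiet' : Prop} (h : Pres quiet X s s') (hXY : X ⊆ Y) (hq : quiet' → quiet) :
    Pres quiet' Y s s' :=
  ⟨h.reals, h.nats_zero, fun y hy => h.F y fun h' => hy (hXY h'), fun hh => h.dgms (hq hh),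
    fun hh => h.queries (hq hh)⟩

theorem Pres.trans (h : Pres quiet X s s') (h' : Pres quiet X s' s'') : Pres quiet X s s'' :=
  ⟨h'.reals.trans h.reals, h'.nats_zero.trans h.nats_zero,
    fun y hy => (h'.F y hy).trans (h.F y hy), fun hh => (h'.dgms hh).trans (h.dgms hh),
    fun hh => (h'.queries hh).trans (h.queries hh)⟩

theorem Pres.set (h : Pres quiet X s s') {x : Var} (hx : x ∈ X) (i w : ℕ) :
    Pres quiet X s (s'.set x i w) :=
  ⟨h.reals, by simpa using h.nats_zero,
    fun y hy => by rw [State.set_F_of_ne _ (by rintro rfl; exact hy hx), h.F y hy], h.dgms, h.queries⟩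

/-! ### Counting loops -/

/-- The program running `body` for `x = 0, …, N - 1`. -/
def forLoop (x : Var) (N : NExpr) (body : Prog) : Prog :=
  .seq (sv x (.const 0))
    (.loop (.natLt (gv x) N) (.seq body (sv x (.add (gv x) (.const 1)))))

/-- The overhead of a counting loop per round. -/
def forCost (x : Var) (N : NExpr) : ℝ :=
  (((sv x (.const 0)).time : ℕ) : ℝ) + ((Test.natLt (gv x) N).cost : ℕ) +
    (sv x (.add (gv x) (.const 1))).time

theorem forCost_nonneg (x : Var) (N : NExpr) : 0 ≤ forCost x N := by
  unfold forCost; positivity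

/-- The counter is outside the frame `X` of the body, so it survives each round. The invariant is
required after the counter has been advanced, which is why the body must establish it for `s'.set x
0 (k + 1)`. The bound `Ne` is evaluated anew in every round and must keep the value `n`. -/
theorem Does.for {body : Prog} {x : Var} {Ne : NExpr} {X : List Var} {st : State} (n : ℕ)
    (T : ℕ → ℝ) (Inv : ℕ → State → Prop) (hi : x ∉ X) (hT : ∀ k, 0 ≤ T k)
    (h0 : Inv 0 (st.set x 0 0))
    (hN : ∀ s, Pres quiet (x :: X) st s → Ne.eval s = n)
    (hb : ∀ k s, k < n → Pres quiet (x :: X) st s → s.F x 0 = k → Inv k s →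
      Does O q body s (T k) (fun s' => Pres quiet X s s' ∧ Inv (k + 1) (s'.set x 0 (k + 1)))) :
    Does O q (forLoop x Ne body) st (∑ k ∈ Finset.range n, T k + (n + 1) * forCost x Ne)
      (fun s => Pres quiet (x :: X) st s ∧ Inv n s) := by
  set A : ℝ := ((sv x (.const 0)).time : ℝ) with hA
  set B : ℝ := ((Test.natLt (gv x) Ne).cost : ℝ) with hB
  set C : ℝ := ((sv x (.add (gv x) (.const 1))).time : ℝ) with hC
  have hA0 : 0 ≤ A := Nat.cast_nonneg _
  have hB0 : 0 ≤ B := Nat.cast_nonneg _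
  have hC0 : 0 ≤ C := Nat.cast_nonneg _
  -- The potential is the time still to be spent, including test and increment of each remaining
  -- round.
  let Φ : State → ℝ := fun s => ∑ k ∈ Finset.Ico (s.F x 0) n, (T k + B + C)
  have key : Does O q (forLoop x Ne body) st (A + (Φ (st.set x 0 0) + B))
      (fun s => (Pres quiet (x :: X) st s ∧ s.F x 0 ≤ n ∧ Inv (s.F x 0) s) ∧
        ¬ (Test.natLt (gv x) Ne).eval s) := by
    refine Does.seq (R' := fun s => s = st.set x 0 0)
      (Does.simple (sv_simple _ _) (by simp [NExpr.eval])) ?_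
    rintro _ rfl
    refine Does.while (fun s => Pres quiet (x :: X) st s ∧ s.F x 0 ≤ n ∧ Inv (s.F x 0) s) Φ ?_ ?_ _ ?_
    · intro s _
      exact Finset.sum_nonneg fun k _ => by have := hT k; positivity
    · rintro s ⟨h1, h2, h3⟩ hc
      have hlt : s.F x 0 < n := by simpa [Test.eval, hN s h1] using hc
      refine ⟨T (s.F x 0) + C, ?_⟩
      refine Does.seq (hb _ s hlt h1 rfl h3) ?_
      rintro s' ⟨h4, h5⟩
      have hF : s'.F x = s.F x := h4.F x hi
      refine Does.simple (sv_simple _ _) ?_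
      have h6 : (sv x (.add (gv x) (.const 1))).run s' = s'.set x 0 (s.F x 0 + 1) := by
        simp [NExpr.eval, hF]
      rw [h6]
      refine ⟨⟨?_, ?_, ?_⟩, ?_⟩
      · exact (h1.trans (h4.mono (List.subset_cons_self _ _) id)).set (by simp) _ _
      · simpa using hlt
      · simpa using h5
      · simp only [Φ, State.set_F_self]
        rw [Finset.sum_eq_sum_Ico_succ_bot hlt]
        linarith
    · exact ⟨(Pres.refl st).set (by simp) _ _, by simp, by simpa using h0⟩
  refine key.mono ?_ ?_
  · simp only [Φ, State.set_F_self, forCost, ← hA, ← hB, ← hC, Finset.sum_add_distrib,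
      Finset.sum_const, Nat.card_Ico, nsmul_eq_mul, Finset.range_eq_Ico]
    have : (0 : ℝ) ≤ n := n.cast_nonneg
    simp only [Nat.sub_zero]
    nlinarith [mul_nonneg this hA0]
  · rintro s ⟨⟨h1, h2, h3⟩, h4⟩
    have : s.F x 0 = n := by
      have : ¬ s.F x 0 < n := by simpa [Test.eval, hN s h1] using h4
      omega
    exact ⟨h1, this ▸ h3⟩

/-- A counting loop with a simple body. -/
theorem Does.forSimple {body : Prog} {x : Var} {Ne : NExpr} {X : List Var} {st : State} (n : ℕ)
    (Inv : ℕ → State → Prop) (hi : x ∉ X) (hs : body.Simple)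
    (h0 : Inv 0 (st.set x 0 0))
    (hN : ∀ s, Pres True (x :: X) st s → Ne.eval s = n)
    (hb : ∀ k s, k < n → Pres True (x :: X) st s → s.F x 0 = k → Inv k s →
      Pres True X s (body.run s) ∧ Inv (k + 1) ((body.run s).set x 0 (k + 1))) :
    Does O q (forLoop x Ne body) st ((n + 1) * (body.time + forCost x Ne))
      (fun s => Pres True (x :: X) st s ∧ Inv n s) := by
  refine (Does.for (quiet := True) n (fun _ => body.time) Inv hi (fun _ => Nat.cast_nonneg _) h0 hN
    fun k s h1 h2 h3 h4 => Does.simple hs (hb k s h1 h2 h3 h4)).mono ?_ fun _ h => h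
  simp only [Finset.sum_const, Finset.card_range, nsmul_eq_mul]
  have : (0 : ℝ) ≤ body.time := Nat.cast_nonneg _
  nlinarith

/-! ### Coordinates -/

/-- The first coordinate of the point number `a`. -/
def xe (a : NExpr) : RExpr := .mem a.dbl

/-- The second coordinate of the point number `a`. -/
def ye (a : NExpr) : RExpr := .mem (.add a.dbl (.const 1))

/-- The first coordinate of the point number `i`. -/
def State.px (st : State) (i : ℕ) : ℝ := st.reals (2 * i)

/-- The second coordinate of the point number `i`. -/
def State.py (st : State) (i : ℕ) : ℝ := st.reals (2 * i + 1)

@[simp] theorem xe_eval (st : State) (a : NExpr) : (xe a).eval st = st.px (a.eval st) := by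
  simp [xe, RExpr.eval, State.px]

@[simp] theorem ye_eval (st : State) (a : NExpr) : (ye a).eval st = st.py (a.eval st) := by
  simp [ye, RExpr.eval, State.py, NExpr.eval]

@[simp] theorem State.set_px (st : State) (x : Var) (i w : ℕ) : (st.set x i w).px = st.px := rfl

@[simp] theorem State.set_py (st : State) (x : Var) (i w : ℕ) : (st.set x i w).py = st.py := rfl

/-- The inverse slope of the line through the points number `v` and `u`. -/
def State.key (st : State) (v u : ℕ) : ℝ := (st.px u - st.px v) / (st.py u - st.py v)

/-- The inverse slope of the line through the points number `v` and `u`. -/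
def keye (v u : NExpr) : RExpr := .div (.sub (xe u) (xe v)) (.sub (ye u) (ye v))

@[simp] theorem keye_eval (st : State) (v u : NExpr) :
    (keye v u).eval st = st.key (v.eval st) (u.eval st) := by
  simp [keye, RExpr.eval, State.key]

attribute [irreducible] keye

@[simp] theorem State.set_key (st : State) (x : Var) (i w : ℕ) : (st.set x i w).key = st.key := rfl

theorem Pres.px (h : Pres quiet X s s') : s'.px = s.px := by
  funext i; simp [State.px, h.reals]

theorem Pres.py (h : Pres quiet X s s') : s'.py = s.py := by
  funext i; simp [State.py, h.reals]

theorem Pres.key (h : Pres quiet X s s') : s'.key = s.key := by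
  funext i j; simp [State.key, h.px, h.py]

end RealRAM

namespace RealRAM

variable {O : Plane → DgmData} {q : ℕ}

/-! ### Binary search -/

/-- Binary search for the number of indices below `len` that satisfy `¬ t₁ ∧ t₂`. -/
def bsearch (len : NExpr) (t₁ t₂ : Test) : Prog :=
  .seq (.seq (sv .lo (.const 0)) (sv .hi len))
    (.loop (.natLt (gv .lo) (gv .hi))
      (.seq (sv .j (.half (.add (gv .lo) (gv .hi))))
        (.ite t₁ (sv .hi (gv .j)) (.ite t₂ (sv .lo (.add (gv .j) (.const 1))) (sv .hi (gv .j))))))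

/-- Below `lo` everything satisfies `pr`, from `hi` on nothing does, and the number of binary digits
of `hi - lo` drops in each round. Two tests are allowed because a death value may be infinite: `t₁`
recognises this before `t₂` reads the value, which would read as `0`. -/
theorem Does.bsearch (len : NExpr) (t₁ t₂ : Test) : ∃ C : ℝ, 0 ≤ C ∧
    ∀ (O : Plane → DgmData) (q : ℕ) (st : State) (n : ℕ) (pr : ℕ → Prop),
    len.eval (st.set .lo 0 0) = n → (∀ i j, i ≤ j → j < n → pr j → pr i) →
    (∀ s, Pres True [.lo, .hi, .j] st s → s.F .j 0 < n →
      ((¬ t₁.eval s ∧ t₂.eval s) ↔ pr (s.F .j 0))) →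
    Does O q (bsearch len t₁ t₂) st (C * (n.size + 1)) (fun s => Pres True [.lo, .hi, .j] st s ∧
      s.F .lo 0 ≤ n ∧ (∀ i < s.F .lo 0, pr i) ∧ ∀ i, s.F .lo 0 ≤ i → i < n → ¬ pr i) := by
  set body : Prog := .seq (sv .j (.half (.add (gv .lo) (gv .hi))))
        (.ite t₁ (sv .hi (gv .j)) (.ite t₂ (sv .lo (.add (gv .j) (.const 1))) (sv .hi (gv .j))))
    with hbody
  classical
  have hs : body.Simple := by simp [body, Prog.Simple]
  set init : Prog := .seq (sv .lo (.const 0)) (sv .hi len) with hinit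
  set A : ℝ := ((body.time + (Test.natLt (gv .lo) (gv .hi)).cost : ℕ) : ℝ) with hA
  have hA0 : 0 ≤ A := Nat.cast_nonneg _
  refine ⟨A + init.time, by positivity, fun O q st n pr hlen hmono htest => ?_⟩
  let Inv : State → Prop := fun s => Pres True [.lo, .hi, .j] st s ∧ s.F .lo 0 ≤ s.F .hi 0 ∧
    s.F .hi 0 ≤ n ∧ (∀ i < s.F .lo 0, pr i) ∧ ∀ i, s.F .hi 0 ≤ i → i < n → ¬ pr i
  let Φ : State → ℝ := fun s => A * (s.F .hi 0 - s.F .lo 0).size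
  have hstart : Inv (init.run st) := by
    have h1 : init.run st = (st.set .lo 0 0).set .hi 0 n := by
      simp [hinit, Prog.run, NExpr.eval, hlen]
    rw [h1]
    refine ⟨((Pres.refl st).set (by simp) _ _).set (by simp) _ _, by simp, by simp, by simp, ?_⟩
    intro i h2 h3
    simp at h2; omega
  have main : Does O q (RealRAM.bsearch len t₁ t₂) st
      (init.time + (A * n.size + (Test.natLt (gv .lo) (gv .hi)).cost))
      (fun s => Inv s ∧ ¬ (Test.natLt (gv .lo) (gv .hi)).eval s) := by
    refine Does.seq (R' := fun s => s = init.run st) (Does.simple (by simp [Prog.Simple]) rfl) ?_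
    rintro _ rfl
    have hΦ0 : Φ (init.run st) = A * n.size := by
      simp [Φ, hinit, Prog.run, NExpr.eval, hlen]
    rw [← hΦ0]
    refine Does.while Inv Φ (fun s _ => by positivity) ?_ _ hstart
    rintro s ⟨h1, h2, h3, h4, h5⟩ hc
    have hc : s.F .lo 0 < s.F .hi 0 := by simpa [Test.eval] using hc
    refine ⟨body.time, Does.simple hs ?_⟩
    set mid := (s.F .lo 0 + s.F .hi 0) / 2 with hmid
    set s1 := s.set .j 0 mid with hs1
    have h1' : Pres True [.lo, .hi, .j] st s1 := h1.set (by simp) _ _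
    have hmn : mid < n := by omega
    have ht := htest s1 h1' (by simpa [hs1] using hmn)
    have hj : s1.F .j 0 = mid := by simp [hs1]
    rw [hj] at ht
    have hlo : s1.F .lo = s.F .lo := by simp [hs1]
    have hhi : s1.F .hi = s.F .hi := by simp [hs1]
    have hrun : body.run s = if pr mid then s1.set .lo 0 (mid + 1) else s1.set .hi 0 mid := by
      have e1 : (sv .j (.half (.add (gv .lo) (gv .hi)))).run s = s1 := by
        simp [NExpr.eval, hs1, hmid]
      simp only [hbody, Prog.run, e1, sv_run, NExpr.eval, gv_eval, hj]
      by_cases ha : t₁.eval s1 <;> by_cases hb : t₂.eval s1 <;> simp [ha, hb] at ht ⊢ <;> simp [ht]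
    -- An interval of at most half the length has one binary digit less, which pays for one round.
    have hsz : ∀ a : ℕ, a ≤ (s.F .hi 0 - s.F .lo 0) / 2 →
        (body.time : ℝ) + (Test.natLt (gv .lo) (gv .hi)).cost + A * a.size ≤ Φ s := by
      intro a ha
      have h6 : a.size + 1 ≤ (s.F .hi 0 - s.F .lo 0).size := by
        have h7 : 1 ≤ (s.F .hi 0 - s.F .lo 0).size := Nat.size_pos.2 (by omega)
        have h8 : (s.F .hi 0 - s.F .lo 0) < 2 ^ (s.F .hi 0 - s.F .lo 0).size := Nat.lt_size_self _
        have h9 : a.size ≤ (s.F .hi 0 - s.F .lo 0).size - 1 := by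
          rw [Nat.size_le]
          obtain ⟨e, he⟩ : ∃ e, (s.F .hi 0 - s.F .lo 0).size = e + 1 := ⟨_, (Nat.sub_add_cancel h7).symm⟩
          rw [he] at h8 ⊢
          rw [pow_succ] at h8
          simp only [Nat.add_sub_cancel]
          omega
        omega
      have h10 : ((a.size + 1 : ℕ) : ℝ) ≤ ((s.F .hi 0 - s.F .lo 0).size : ℕ) := by exact_mod_cast h6
      have h11 := mul_le_mul_of_nonneg_left h10 hA0
      have h12 : (body.time : ℝ) + (Test.natLt (gv .lo) (gv .hi)).cost = A := by rw [hA]; push_cast; rfl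
      rw [h12]
      simp only [Φ]
      push_cast at h11
      linarith
    rw [hrun]
    by_cases hp : pr mid
    · rw [if_pos hp]
      refine ⟨⟨h1'.set (by simp) _ _, ?_, ?_, ?_, ?_⟩, ?_⟩
      · simp [hhi]; omega
      · simpa [hhi] using h3
      · simp only [State.set_F_self]
        intro i hi
        exact hmono i mid (by omega) hmn hp
      · simpa [hhi] using h5
      · have := hsz (s.F .hi 0 - (mid + 1)) (by omega)
        simpa [Φ, hhi] using this
    · rw [if_neg hp]
      refine ⟨⟨h1'.set (by simp) _ _, ?_, ?_, ?_, ?_⟩, ?_⟩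
      · simp [hlo]; omega
      · simpa using hmn.le
      · simpa [hlo] using h4
      · simp only [State.set_F_self]
        intro i hi hin hpi
        exact hp (hmono mid i hi hin hpi)
      · have := hsz (mid - s.F .lo 0) (by omega)
        simpa [Φ, hlo] using this
  refine main.mono ?_ ?_
  · have h1 : ((Test.natLt (gv .lo) (gv .hi)).cost : ℝ) ≤ A := by
      rw [hA]; push_cast; linarith [(Nat.cast_nonneg body.time : (0 : ℝ) ≤ _)]
    have h2 : (0 : ℝ) ≤ n.size := Nat.cast_nonneg _
    have h3 : (0 : ℝ) ≤ init.time := Nat.cast_nonneg _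
    nlinarith
  · rintro s ⟨⟨h1, h2, h3, h4, h5⟩, h6⟩
    have h6 : ¬ s.F .lo 0 < s.F .hi 0 := by simpa [Test.eval] using h6
    have h7 : s.F .lo 0 = s.F .hi 0 := by omega
    exact ⟨h1, by omega, h4, by rw [h7]; exact h5⟩

theorem List.countP_eq_of_prefix {α : Type*} (l : List α) (f : α → Bool) (k : ℕ) (hk : k ≤ l.length)
    (h₁ : ∀ i (hi : i < l.length), i < k → f l[i] = true)
    (h₂ : ∀ i (hi : i < l.length), k ≤ i → f l[i] = false) : l.countP f = k := by
  rw [← List.take_append_drop k l, List.countP_append]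
  have e1 : (l.take k).countP f = (l.take k).length := by
    rw [List.countP_eq_length]
    intro a ha
    obtain ⟨i, hi, rfl⟩ := List.getElem_of_mem ha
    simp only [List.length_take] at hi
    rw [List.getElem_take]
    exact h₁ i (by omega) (by omega)
  have e2 : (l.drop k).countP f = 0 := by
    rw [List.countP_eq_zero]
    intro a ha
    obtain ⟨i, hi, rfl⟩ := List.getElem_of_mem ha
    simp only [List.length_drop] at hi
    rw [List.getElem_drop]
    simp [h₂ (k + i) (by omega) (by omega)]
  rw [e1, e2, List.length_take]
  omega

/-! ### Counting the points of a diagram at a given height -/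

/-- The height of the current vertex `v` in direction `(sx, sy)`. -/
def heightExpr (sx sy : RExpr) : RExpr := .add (.mul sx (xe (gv .v))) (.mul sy (ye (gv .v)))

/-- The number of the most recent diagram. -/
def lastDgm : NExpr := .sub .numDgms (.const 1)

/-- The number of zero-dimensional points of the last diagram with death value at most `h`
(below `h`). -/
def deathSearch (strict : Bool) (h : RExpr) : Prog :=
  bsearch (.dgmSize lastDgm (.const 0)) (.deathInf .death lastDgm (.const 0) (gv .j))
    (bif strict then .realLt (.deathOf .death lastDgm (.const 0) (gv .j)) h
      else .not (.realLt h (.deathOf .death lastDgm (.const 0) (gv .j))))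

/-- The number of one-dimensional points of the last diagram with birth value at most `h`
(below `h`). -/
def birthSearch (strict : Bool) (h : RExpr) : Prog :=
  bsearch (.dgmSize lastDgm (.const 1)) (.natLt (.const 0) (.const 0))
    (bif strict then .realLt (.birthOf .birth lastDgm (.const 1) (gv .j)) h
      else .not (.realLt h (.birthOf .birth lastDgm (.const 1) (gv .j))))

/-- The comparison `<` or `≤`. -/
def cmp {α : Type*} [Preorder α] (strict : Bool) (x y : α) : Prop := bif strict then x < y else x ≤ y

theorem cmp_of_le {α : Type*} [Preorder α] {strict : Bool} {x y z : α} (h : x ≤ y)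
    (h' : cmp strict y z) : cmp strict x z := by
  cases strict
  · exact h.trans h'
  · exact h.trans_lt h'

open Classical in
-- Sortedness makes the points up to height `z` a prefix of the array, so its length is their
-- number. The machine reads the length of the array sorted by birth, while the search runs in the
-- one sorted by death; hence the hypothesis that both lengths agree.
theorem Does.deathSearch (strict : Bool) (h : RExpr) : ∃ C : ℝ, 0 ≤ C ∧
    ∀ (O : Plane → DgmData) (q : ℕ) (st : State) (D : DgmData) (z : ℝ),
    st.dgms (st.queries - 1) = D → (D.byBirth 0).length = (D.byDeath 0).length →
    (D.byDeath 0).Pairwise (fun x y => x.2 ≤ y.2) →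
    (∀ s, Pres True [.lo, .hi, .j] st s → h.eval s = z) →
    Does O q (deathSearch strict h) st (C * ((D.byDeath 0).length.size + 1))
      (fun s => Pres True [.lo, .hi, .j] st s ∧
        s.F .lo 0 = (D.byDeath 0).countP (fun x => cmp strict x.2 (z : WithTop ℝ))) := by
  obtain ⟨C, hC0, hC⟩ := Does.bsearch (.dgmSize lastDgm (.const 0))
    (.deathInf .death lastDgm (.const 0) (gv .j))
    (bif strict then .realLt (.deathOf .death lastDgm (.const 0) (gv .j)) h
      else .not (.realLt h (.deathOf .death lastDgm (.const 0) (gv .j))))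
  refine ⟨C, hC0, fun O q st D z hD hlen hsort hz => ?_⟩
  set l := D.byDeath 0 with hl
  refine (hC O q st l.length (fun i => cmp strict (l.getD i (0, 0)).2 (z : WithTop ℝ)) ?_ ?_ ?_).mono
    le_rfl ?_
  · simp [NExpr.eval, lastDgm, hD, hlen]
  · intro i j hij hj hp
    rcases hij.eq_or_lt with rfl | hlt
    · exact hp
    · refine cmp_of_le ?_ hp
      rw [List.getD_eq_getElem _ _ hj, List.getD_eq_getElem _ _ (hlt.trans hj)]
      exact List.pairwise_iff_getElem.1 hsort i j _ hj hlt
  · intro s hs hj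
    have e1 : (pt (s.dgms (s.queries - 1)) .death 0 (s.F .j 0)) = l.getD (s.F .j 0) (0, 0) := by
      rw [hs.dgms trivial, hs.queries trivial, hD]; rfl
    cases strict
    · simp only [Test.eval, NExpr.eval, lastDgm, RExpr.eval, cond_false, gv_eval, cmp, e1, hz s hs]
      cases (l.getD (s.F .j 0) (0, 0)).2 with
      | top => simp
      | coe a => simp
    · simp only [Test.eval, NExpr.eval, lastDgm, RExpr.eval, cond_true, gv_eval, cmp, e1, hz s hs]
      cases (l.getD (s.F .j 0) (0, 0)).2 with
      | top => simp
      | coe a => simp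
  · rintro s ⟨h1, h2, h3, h4⟩
    refine ⟨h1, (List.countP_eq_of_prefix l _ _ h2 ?_ ?_).symm⟩
    · intro i hi hik
      have := h3 i hik
      rw [List.getD_eq_getElem _ _ hi] at this
      simpa using this
    · intro i hi hik
      have := h4 i hik hi
      rw [List.getD_eq_getElem _ _ hi] at this
      simpa using this

open Classical in
theorem Does.birthSearch (strict : Bool) (h : RExpr) : ∃ C : ℝ, 0 ≤ C ∧
    ∀ (O : Plane → DgmData) (q : ℕ) (st : State) (D : DgmData) (z : ℝ),
    st.dgms (st.queries - 1) = D →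
    (D.byBirth 1).Pairwise (fun x y => x.1 ≤ y.1) →
    (∀ s, Pres True [.lo, .hi, .j] st s → h.eval s = z) →
    Does O q (birthSearch strict h) st (C * ((D.byBirth 1).length.size + 1))
      (fun s => Pres True [.lo, .hi, .j] st s ∧
        s.F .lo 0 = (D.byBirth 1).countP (fun x => cmp strict x.1 z)) := by
  obtain ⟨C, hC0, hC⟩ := Does.bsearch (.dgmSize lastDgm (.const 1))
    -- A guard that never holds: births are finite and need no separate test.
    (.natLt (.const 0) (.const 0))
    (bif strict then .realLt (.birthOf .birth lastDgm (.const 1) (gv .j)) h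
      else .not (.realLt h (.birthOf .birth lastDgm (.const 1) (gv .j))))
  refine ⟨C, hC0, fun O q st D z hD hsort hz => ?_⟩
  set l := D.byBirth 1 with hl
  refine (hC O q st l.length (fun i => cmp strict (l.getD i (0, 0)).1 z) ?_ ?_ ?_).mono
    le_rfl ?_
  · simp [NExpr.eval, lastDgm, hD, hl]
  · intro i j hij hj hp
    rcases hij.eq_or_lt with rfl | hlt
    · exact hp
    · refine cmp_of_le ?_ hp
      rw [List.getD_eq_getElem _ _ hj, List.getD_eq_getElem _ _ (hlt.trans hj)]
      exact List.pairwise_iff_getElem.1 hsort i j _ hj hlt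
  · intro s hs hj
    have e1 : (pt (s.dgms (s.queries - 1)) .birth 1 (s.F .j 0)) = l.getD (s.F .j 0) (0, 0) := by
      rw [hs.dgms trivial, hs.queries trivial, hD]; rfl
    cases strict
    · simp [Test.eval, NExpr.eval, lastDgm, RExpr.eval, cmp, e1, hz s hs]
    · simp [Test.eval, NExpr.eval, lastDgm, RExpr.eval, cmp, e1, hz s hs]
  · rintro s ⟨h1, h2, h3, h4⟩
    refine ⟨h1, (List.countP_eq_of_prefix l _ _ h2 ?_ ?_).symm⟩
    · intro i hi hik
      have := h3 i hik
      rw [List.getD_eq_getElem _ _ hi] at this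
      simpa using this
    · intro i hi hik
      have := h4 i hik hi
      rw [List.getD_eq_getElem _ _ hi] at this
      simpa using this

/-- Reduces counting the points exactly at height `z` to the difference of two prefix lengths, each
found by one binary search. -/
theorem List.countP_cmp {α β : Type*} [LinearOrder β] (l : List α) (f : α → β) (z : β)
    [DecidablePred fun x => cmp false (f x) z] [DecidablePred fun x => cmp true (f x) z]
    [DecidablePred fun x => f x = z] :
    l.countP (fun x => cmp false (f x) z) =
      l.countP (fun x => cmp true (f x) z) + l.countP (fun x => f x = z) := by
  induction l with
  | nil => rfl
  | cons a l ih =>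
    simp only [List.countP_cons, ih]
    rcases lt_trichotomy (f a) z with h | h | h
    · simp [cmp, h, h.le, h.ne]; omega
    · simp [cmp, h]; omega
    · simp [cmp, h.not_ge, h.not_gt, h.ne']

/-- Query the direction `(sx, sy)` and count the edges whose height is that of the vertex `v`. -/
def countProg (sx sy : RExpr) : Prog :=
  .seq (.query sx sy)
    (.seq (deathSearch false (heightExpr sx sy)) (.seq (sv .c (gv .lo))
      (.seq (deathSearch true (heightExpr sx sy)) (.seq (sv .c (.sub (gv .c) (gv .lo)))
        (.seq (birthSearch false (heightExpr sx sy)) (.seq (sv .c (.add (gv .c) (gv .lo)))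
          (.seq (birthSearch true (heightExpr sx sy)) (sv .c (.sub (gv .c) (gv .lo))))))))))

open Classical in
theorem Does.countProg (sx sy : RExpr) : ∃ C : ℝ, 0 ≤ C ∧
    ∀ (O : Plane → DgmData) (q : ℕ) (st : State) (D : DgmData) (x y z : ℝ),
    (∀ s, Pres False [.c, .lo, .hi, .j] st s → sx.eval s = x ∧ sy.eval s = y) →
    O !₂[x, y] = D → ‖(!₂[x, y] : Plane)‖ = 1 →
    z = x * st.px (st.F .v 0) + y * st.py (st.F .v 0) →
    (D.byBirth 0).length = (D.byDeath 0).length →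
    (D.byDeath 0).Pairwise (fun x y => x.2 ≤ y.2) →
    (D.byBirth 1).Pairwise (fun x y => x.1 ≤ y.1) →
    Does O q (countProg sx sy) st
      (C * ((D.byDeath 0).length.size + (D.byBirth 1).length.size + 1) + q)
      (fun s => Pres False [.c, .lo, .hi, .j] st s ∧ s.queries = st.queries + 1 ∧
        s.F .c 0 = (D.byDeath 0).countP (fun x => x.2 = (z : WithTop ℝ)) +
          (D.byBirth 1).countP (fun x => x.1 = z)) := by
  obtain ⟨C₁, hC₁, H₁⟩ := Does.deathSearch false (heightExpr sx sy)
  obtain ⟨C₂, hC₂, H₂⟩ := Does.deathSearch true (heightExpr sx sy)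
  obtain ⟨C₃, hC₃, H₃⟩ := Does.birthSearch false (heightExpr sx sy)
  obtain ⟨C₄, hC₄, H₄⟩ := Does.birthSearch true (heightExpr sx sy)
  refine ⟨C₁ + C₂ + C₃ + C₄ + ((sv .c (gv .lo)).time + (sv .c (.sub (gv .c) (gv .lo))).time +
    (sv .c (.add (gv .c) (gv .lo))).time + (sv .c (.sub (gv .c) (gv .lo))).time +
    (sx.cost + sy.cost + 1)), by positivity, ?_⟩
  intro O q st D x y z hxy hD hunit hz hlen hs0 hs1
  have hst := hxy st (Pres.refl st)
  set s₀ : State := { st with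
          dgms := Function.update st.dgms st.queries D
          queries := st.queries + 1 } with hs₀
  have P0 : Pres False [.c, .lo, .hi, .j] st s₀ := ⟨rfl, rfl, fun _ _ => rfl, fun h => h.elim, fun h => h.elim⟩
  have hq0 : s₀.queries = st.queries + 1 := rfl
  have hd0 : s₀.dgms (s₀.queries - 1) = D := by simp [hs₀]
  have up : ∀ {s}, Pres True [.c, .lo, .hi, .j] s₀ s → Pres False [.c, .lo, .hi, .j] st s :=
    fun h => P0.trans (h.mono (List.Subset.refl _) (fun h => h.elim))
  have hd : ∀ {s}, Pres True [.c, .lo, .hi, .j] s₀ s → s.dgms (s.queries - 1) = D := fun h => by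
    rw [h.dgms trivial, h.queries trivial, hd0]
  have hh : ∀ {s}, Pres True [.c, .lo, .hi, .j] s₀ s → ∀ s', Pres True [.lo, .hi, .j] s s' →
      (heightExpr sx sy).eval s' = z := fun h s' h' => by
    have h2 := up (h.trans (h'.mono (List.subset_cons_self _ _) id))
    obtain ⟨e1, e2⟩ := hxy s' h2
    simp [heightExpr, RExpr.eval, e1, e2, h2.px, h2.py, h2.F .v (by simp), hz]
  have ext : ∀ {s s'}, Pres True [.c, .lo, .hi, .j] s₀ s → Pres True [.lo, .hi, .j] s s' →
      Pres True [.c, .lo, .hi, .j] s₀ s' := fun h h' => h.trans (h'.mono (List.subset_cons_self _ _) id)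
  refine Does.step (T₁ := (sx.cost + sy.cost + 1 + q : ℕ)) (R' := fun s => s = s₀) ?_ ?_
  · refine ⟨_, _, Exec.query sx sy st (by rw [hst.1, hst.2]; exact hunit), le_rfl, ?_⟩
    rw [hst.1, hst.2, hD]
  · rintro _ rfl
    refine Does.step (H₁ O q s₀ D z hd0 hlen hs0 (hh (Pres.refl _))) ?_
    rintro s ⟨h1, h1'⟩
    replace h1 := ext (Pres.refl _) h1
    refine Does.step (Does.simple (sv_simple _ _) (R := fun s' => s' = s.set .c 0 (s.F .lo 0)) (by simp)) ?_
    rintro _ rfl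
    have h2 := h1.set (x := .c) (by simp) 0 (s.F .lo 0)
    refine Does.step (H₂ O q _ D z (hd h2) hlen hs0 (hh h2)) ?_
    rintro s2 ⟨h3, h3'⟩
    have h4 := ext h2 h3
    have e1 : s2.F .c 0 = s.F .lo 0 := by rw [h3.F _ (by simp)]; simp
    refine Does.step (Does.simple (sv_simple _ _)
      (R := fun s' => s' = s2.set .c 0 (s.F .lo 0 - s2.F .lo 0)) (by simp [NExpr.eval, e1])) ?_
    rintro _ rfl
    have h5 := h4.set (x := .c) (by simp) 0 (s.F .lo 0 - s2.F .lo 0)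
    refine Does.step (H₃ O q _ D z (hd h5) hs1 (hh h5)) ?_
    rintro s3 ⟨h6, h6'⟩
    have h7 := ext h5 h6
    have e2 : s3.F .c 0 = s.F .lo 0 - s2.F .lo 0 := by rw [h6.F _ (by simp)]; simp
    refine Does.step (Does.simple (sv_simple _ _)
      (R := fun s' => s' = s3.set .c 0 (s.F .lo 0 - s2.F .lo 0 + s3.F .lo 0))
      (by simp [NExpr.eval, e2])) ?_
    rintro _ rfl
    have h8 := h7.set (x := .c) (by simp) 0 (s.F .lo 0 - s2.F .lo 0 + s3.F .lo 0)
    refine Does.step (H₄ O q _ D z (hd h8) hs1 (hh h8)) ?_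
    rintro s4 ⟨h9, h9'⟩
    have h10 := ext h8 h9
    have e3 : s4.F .c 0 = s.F .lo 0 - s2.F .lo 0 + s3.F .lo 0 := by rw [h9.F _ (by simp)]; simp
    refine (Does.simple (sv_simple _ _)
      (R := fun s' => s' = s4.set .c 0 (s.F .lo 0 - s2.F .lo 0 + s3.F .lo 0 - s4.F .lo 0))
      (by simp [NExpr.eval, e3])).mono ?_ ?_
    · set a : ℝ := ((D.byDeath 0).length.size : ℝ)
      set b : ℝ := ((D.byBirth 1).length.size : ℝ)
      have ha : 0 ≤ a := Nat.cast_nonneg _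
      have hb : 0 ≤ b := Nat.cast_nonneg _
      have t1 : (0 : ℝ) ≤ (sv .c (gv .lo)).time := Nat.cast_nonneg _
      have t2 : (0 : ℝ) ≤ (sv .c (.sub (gv .c) (gv .lo))).time := Nat.cast_nonneg _
      have t3 : (0 : ℝ) ≤ (sv .c (.add (gv .c) (gv .lo))).time := Nat.cast_nonneg _
      have t4 : (0 : ℝ) ≤ sx.cost := Nat.cast_nonneg _
      have t5 : (0 : ℝ) ≤ sy.cost := Nat.cast_nonneg _
      push_cast
      nlinarith [mul_nonneg hC₁ hb, mul_nonneg hC₂ hb, mul_nonneg hC₃ ha, mul_nonneg hC₄ ha,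
        mul_nonneg t1 (add_nonneg ha hb), mul_nonneg t2 (add_nonneg ha hb),
        mul_nonneg t3 (add_nonneg ha hb), mul_nonneg t4 (add_nonneg ha hb),
        mul_nonneg t5 (add_nonneg ha hb)]
    · rintro _ rfl
      refine ⟨(up h10).set (by simp) _ _, ?_, ?_⟩
      · rw [State.set_queries, h10.queries trivial]
      -- The machine subtraction is truncated, but each non-strict count is at least the strict one,
      -- so nothing is lost.
      · rw [State.set_F_self, h1', h3', h6', h9', List.countP_cmp (D.byDeath 0) (fun x => x.2),
          List.countP_cmp (D.byBirth 1) (fun x => x.1)]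
        omega

end RealRAM

/-! ### Counting simplices with augmented persistence diagrams -/

section Persistence

variable {L : List (Finset Plane)}

theorem stage_mono (L : List (Finset Plane)) : Monotone (stage L) := fun _ _ h _ hσ =>
  (List.take_subset_take_left L h) hσ

theorem stage_zero (L : List (Finset Plane)) : stage L 0 = ∅ := by simp [stage]

theorem stage_finite (L : List (Finset Plane)) (a : ℕ) : (stage L a).Finite :=
  List.finite_toSet _

theorem stage_succ {a : ℕ} (ha : a < L.length) : stage L (a + 1) = insert L[a] (stage L a) := by
  ext σ
  simp only [stage, List.take_add_one, List.getElem?_eq_getElem ha, Option.toList_some,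
    List.mem_append, List.mem_singleton, Set.mem_ofPred_eq, Set.mem_insert_iff]
  tauto

theorem chainSpace_mono {A B : Set (Finset Plane)} (h : A ⊆ B) (p : ℕ) :
    chainSpace A p ≤ chainSpace B p :=
  Finsupp.supported_mono fun _ hσ => ⟨h hσ.1, hσ.2⟩

theorem cycleSpace_mono {A B : Set (Finset Plane)} (h : A ⊆ B) (p : ℕ) :
    cycleSpace A p ≤ cycleSpace B p := inf_le_inf_right _ (chainSpace_mono h p)

theorem boundarySpace_mono {A B : Set (Finset Plane)} (h : A ⊆ B) (p : ℕ) :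
    boundarySpace A p ≤ boundarySpace B p := Submodule.map_mono (chainSpace_mono h _)

theorem finrank_chainSpace {A : Set (Finset Plane)} (hA : A.Finite) (p : ℕ) :
    Module.finrank (ZMod 2) (chainSpace A p) = {σ | σ ∈ A ∧ σ.card = p + 1}.ncard := by
  have hf : {σ | σ ∈ A ∧ σ.card = p + 1}.Finite := hA.subset fun _ h => h.1
  have := hf.fintype
  rw [chainSpace, (Finsupp.supportedEquivFinsupp (M := ZMod 2) (R := ZMod 2) _).finrank_eq,
    Module.finrank_finsupp_self, Set.ncard_eq_toFinset_card', Set.toFinset_card]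

instance chainSpace_stage_finite (L : List (Finset Plane)) (a p : ℕ) :
    Module.Finite (ZMod 2) (chainSpace (stage L a) p) := by
  have hf : Finite {σ | σ ∈ stage L a ∧ σ.card = p + 1} :=
    ((stage_finite L a).subset fun _ h => h.1).to_subtype
  exact Module.Finite.equiv (Finsupp.supportedEquivFinsupp (M := ZMod 2) (R := ZMod 2)
    {σ | σ ∈ stage L a ∧ σ.card = p + 1}).symm

instance cycleSpace_stage_finite (L : List (Finset Plane)) (a p : ℕ) :
    Module.Finite (ZMod 2) (cycleSpace (stage L a) p) :=
  Submodule.finiteDimensional_of_le inf_le_left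

instance boundarySpace_stage_finite (L : List (Finset Plane)) (a p : ℕ) :
    Module.Finite (ZMod 2) (boundarySpace (stage L a) p) := by
  unfold boundarySpace; infer_instance

/-- The dimension of the space of cycles of a stage. -/
def zDim (L : List (Finset Plane)) (p a : ℕ) : ℤ :=
  Module.finrank (ZMod 2) (cycleSpace (stage L a) p)

/-- The dimension of the space of cycles of the stage `a` that bound in the stage `b`. -/
def wDim (L : List (Finset Plane)) (p a b : ℕ) : ℤ :=
  Module.finrank (ZMod 2) ↥(cycleSpace (stage L a) p ⊓ boundarySpace (stage L b) p)

theorem persistentBetti_eq (L : List (Finset Plane)) (p a b : ℕ) :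
    (persistentBetti (stage L a) (stage L b) p : ℤ) = zDim L p a - wDim L p a b := by
  unfold persistentBetti zDim wDim
  rw [Nat.cast_sub (Submodule.finrank_mono inf_le_left)]

/-- From dim `X` + dim `Y` = dim (`X + Y`) + dim (`X ∩ Y`). It shows below that the truncations in
the definitions of the multiplicities never take effect. -/
theorem finrank_add_le_of_le {V : Type*} [AddCommGroup V] [Module (ZMod 2) V]
    (X Y Z W : Submodule (ZMod 2) V) [Module.Finite (ZMod 2) Z] (hX : X ≤ Z) (hY : Y ≤ Z)
    (hW : X ⊓ Y ≤ W) [Module.Finite (ZMod 2) W] :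
    Module.finrank (ZMod 2) X + Module.finrank (ZMod 2) Y ≤
      Module.finrank (ZMod 2) Z + Module.finrank (ZMod 2) W := by
  have := Submodule.finiteDimensional_of_le hX
  have := Submodule.finiteDimensional_of_le hY
  rw [← Submodule.finrank_sup_add_finrank_inf_eq X Y]
  exact Nat.add_le_add (Submodule.finrank_mono (sup_le hX hY)) (Submodule.finrank_mono hW)

/-- The terms `zDim` cancel. The remaining second difference is nonnegative by the dimension
inequality for `Z_a ∩ B_{b+1}` and `Z_{a+1} ∩ B_b`, both inside `Z_{a+1} ∩ B_{b+1}` and meeting in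
`Z_a ∩ B_b`. -/
theorem pairMultiplicity_eq (L : List (Finset Plane)) (p a b : ℕ) :
    (pairMultiplicity L p a b : ℤ) =
      wDim L p (a + 1) (b + 1) - wDim L p (a + 1) b - (wDim L p a (b + 1) - wDim L p a b) := by
  unfold pairMultiplicity
  simp only [persistentBetti_eq]
  rw [Int.toNat_of_nonneg]
  · ring
  · have h := finrank_add_le_of_le
      (cycleSpace (stage L a) p ⊓ boundarySpace (stage L (b + 1)) p)
      (cycleSpace (stage L (a + 1)) p ⊓ boundarySpace (stage L b) p)
      (cycleSpace (stage L (a + 1)) p ⊓ boundarySpace (stage L (b + 1)) p)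
      (cycleSpace (stage L a) p ⊓ boundarySpace (stage L b) p)
      (inf_le_inf_right _ (cycleSpace_mono (stage_mono L a.le_succ) p))
      (inf_le_inf_left _ (boundarySpace_mono (stage_mono L b.le_succ) p))
      (le_inf (inf_le_left.trans inf_le_left) (inf_le_right.trans inf_le_right))
    unfold wDim
    zify at h
    linarith

theorem essentialMultiplicity_eq (L : List (Finset Plane)) (p a : ℕ) :
    (essentialMultiplicity L p a : ℤ) =
      zDim L p (a + 1) - wDim L p (a + 1) L.length - (zDim L p a - wDim L p a L.length) := by
  unfold essentialMultiplicity
  simp only [persistentBetti_eq]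
  rw [Int.toNat_of_nonneg]
  have h := finrank_add_le_of_le (cycleSpace (stage L a) p)
    (cycleSpace (stage L (a + 1)) p ⊓ boundarySpace (stage L L.length) p)
    (cycleSpace (stage L (a + 1)) p)
    (cycleSpace (stage L a) p ⊓ boundarySpace (stage L L.length) p)
    (cycleSpace_mono (stage_mono L a.le_succ) p) inf_le_left
    (le_inf inf_le_left (inf_le_right.trans inf_le_right))
  unfold wDim zDim
  zify at h
  linarith

/-- Summing over all birth times of classes dying at `b` telescopes, and the empty stage `0`
contributes nothing. -/
theorem sum_pairMultiplicity_birth (L : List (Finset Plane)) (p b : ℕ) :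
    ((∑ a ∈ Finset.range b, pairMultiplicity L p a b : ℕ) : ℤ) =
      wDim L p b (b + 1) - wDim L p b b := by
  push_cast
  simp only [pairMultiplicity_eq]
  rw [Finset.sum_range_sub (fun a => wDim L p a (b + 1) - wDim L p a b)]
  have h0 : ∀ c, wDim L p 0 c = 0 := by
    intro c
    have : cycleSpace (stage L 0) p = ⊥ := by
      simp [cycleSpace, chainSpace, stage_zero]
    simp [wDim, this]
  simp [h0]

/-- For a fixed birth time the sum over the death times telescopes, and the essential multiplicity
cancels the upper end of the sum. -/
theorem births_eq (L : List (Finset Plane)) (p : ℕ) {a : ℕ} (ha : a < L.length) :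
    ((essentialMultiplicity L p a +
      ∑ b ∈ Finset.Ico (a + 1) L.length, pairMultiplicity L p a b : ℕ) : ℤ) =
      zDim L p (a + 1) - zDim L p a - (wDim L p (a + 1) (a + 1) - wDim L p a (a + 1)) := by
  push_cast
  simp only [pairMultiplicity_eq, essentialMultiplicity_eq]
  have key : ∑ b ∈ Finset.Ico (a + 1) L.length,
      (wDim L p (a + 1) (b + 1) - wDim L p (a + 1) b - (wDim L p a (b + 1) - wDim L p a b)) =
      (wDim L p (a + 1) L.length - wDim L p a L.length) -
        (wDim L p (a + 1) (a + 1) - wDim L p a (a + 1)) := by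
    rw [← Finset.sum_Ico_sub (fun b => wDim L p (a + 1) b - wDim L p a b) ha]
    exact Finset.sum_congr rfl fun _ _ => by ring
  rw [key]; ring

variable {K : PlaneComplex} {s : Plane}

theorem IsCompatibleOrder.nodup (h : IsCompatibleOrder K s L) : L.Nodup :=
  h.ordered.imp fun h' => by rintro rfl; exact h'.2 (Finset.Subset.refl _)

/-- Facets are listed strictly before their simplex, so the last of the first `a + 1` simplices is
not a facet of any of them. -/
theorem IsCompatibleOrder.boundarySpace_le (h : IsCompatibleOrder K s L) (p a : ℕ) :
    boundarySpace (stage L (a + 1)) p ≤ chainSpace (stage L a) p := by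
  classical
  unfold boundarySpace
  rw [chainSpace, Finsupp.supported_eq_span_single, Submodule.map_span_le]
  rintro _ ⟨σ, ⟨hσ, hcard⟩, rfl⟩
  have hne : ¬ σ.card ≤ 1 := by omega
  simp only [boundaryMap, Finsupp.linearCombination_single, one_smul, if_neg hne]
  refine Submodule.sum_mem _ fun v hv => ?_
  refine Finsupp.single_mem_supported _ _ ⟨?_, ?_⟩
  · obtain ⟨i, hi, rfl⟩ := List.getElem_of_mem (show σ ∈ L.take (a + 1) from hσ)
    rw [List.length_take] at hi
    rw [List.getElem_take] at hv hcard ⊢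
    have hiL : i < L.length := by omega
    have hface : (L[i].erase v) ∈ K.faces := by
      refine K.toSimplicialComplex.down_closed ((h.mem_iff _).1 (List.getElem_mem hiL))
        (Finset.erase_subset _ _) ?_
      rw [← Finset.card_pos, Finset.card_erase_of_mem hv]; omega
    obtain ⟨k, hk, hke⟩ := List.getElem_of_mem ((h.mem_iff _).2 hface)
    have hki : k < i := by
      rcases lt_trichotomy k i with h1 | h1 | h1
      · exact h1
      · subst h1
        have := Finset.card_erase_of_mem hv
        rw [← hke] at this; omega
      · exact absurd (hke ▸ Finset.erase_subset v L[i])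
          (List.pairwise_iff_getElem.1 h.ordered i k hiL hk h1).2
    rw [← hke]
    have hk2 : k < (L.take a).length := by rw [List.length_take]; omega
    have : (L.take a)[k] = L[k] := List.getElem_take
    exact this ▸ List.getElem_mem hk2
  · rw [Finset.card_erase_of_mem hv]; omega

/-- The simplex that has just entered occurs in no boundary yet, so the cycles that already bound do
not involve it. -/
theorem IsCompatibleOrder.wDim_succ (h : IsCompatibleOrder K s L) (p a : ℕ) :
    wDim L p (a + 1) (a + 1) = wDim L p a (a + 1) := by
  have : cycleSpace (stage L (a + 1)) p ⊓ boundarySpace (stage L (a + 1)) p =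
      cycleSpace (stage L a) p ⊓ boundarySpace (stage L (a + 1)) p := by
    refine le_antisymm (fun x hx => ⟨⟨h.boundarySpace_le p a hx.2, hx.1.2⟩, hx.2⟩)
      (inf_le_inf_right _ (cycleSpace_mono (stage_mono L a.le_succ) p))
  unfold wDim
  rw [this]

theorem cycleSpace_zero (A : Set (Finset Plane)) : cycleSpace A 0 = chainSpace A 0 := by
  refine inf_eq_left.2 ?_
  rw [chainSpace, Finsupp.supported_eq_span_single, Submodule.span_le]
  rintro _ ⟨σ, ⟨-, hσ⟩, rfl⟩
  simp [boundaryMap, hσ]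

theorem IsCompatibleOrder.wDim_zero (h : IsCompatibleOrder K s L) {a b : ℕ} (hab : b ≤ a + 1) :
    wDim L 0 a b = Module.finrank (ZMod 2) (boundarySpace (stage L b) 0) := by
  have : cycleSpace (stage L a) 0 ⊓ boundarySpace (stage L b) 0 = boundarySpace (stage L b) 0 := by
    rw [cycleSpace_zero]
    exact inf_eq_right.2 ((boundarySpace_mono (stage_mono L hab) 0).trans (h.boundarySpace_le 0 a))
  unfold wDim
  rw [this]

/-- Rank-nullity for the boundary map restricted to the chains of one dimension. -/
theorem finrank_chainSpace_succ (L : List (Finset Plane)) (p a : ℕ) :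
    (Module.finrank (ZMod 2) (chainSpace (stage L a) (p + 1)) : ℤ) =
      zDim L (p + 1) a + Module.finrank (ZMod 2) (boundarySpace (stage L a) p) := by
  set C := chainSpace (stage L a) (p + 1)
  have h := LinearMap.finrank_range_add_finrank_ker (K := ZMod 2) (V := C) (V₂ := Chain)
    (boundaryMap.domRestrict C)
  have e1 : LinearMap.range (boundaryMap.domRestrict C) = boundarySpace (stage L a) p := by
    rw [LinearMap.range_domRestrict]; rfl
  have e2 : Module.finrank (ZMod 2) (LinearMap.ker (boundaryMap.domRestrict C)) =
      Module.finrank (ZMod 2) (cycleSpace (stage L a) (p + 1)) := by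
    rw [LinearMap.ker_domRestrict, ← Submodule.finrank_map_subtype_eq, Submodule.map_comap_subtype]
    rfl
  rw [e1, e2] at h
  unfold zDim
  rw [← h]; push_cast; ring

theorem finrank_chainSpace_step (hL : L.Nodup) (p : ℕ) {a : ℕ} (ha : a < L.length) :
    Module.finrank (ZMod 2) (chainSpace (stage L (a + 1)) p) =
      Module.finrank (ZMod 2) (chainSpace (stage L a) p) + if L[a].card = p + 1 then 1 else 0 := by
  rw [finrank_chainSpace (stage_finite L _), finrank_chainSpace (stage_finite L _), stage_succ ha]
  have hnot : L[a] ∉ stage L a := by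
    intro hmem
    obtain ⟨i, hi, hie⟩ := List.getElem_of_mem (show L[a] ∈ L.take a from hmem)
    rw [List.length_take] at hi
    rw [List.getElem_take] at hie
    have := (List.Nodup.getElem_inj_iff hL).1 hie
    omega
  have hfin : {σ | σ ∈ stage L a ∧ σ.card = p + 1}.Finite := (stage_finite L a).subset fun _ h => h.1
  split_ifs with hc
  · have : {σ | σ ∈ insert L[a] (stage L a) ∧ σ.card = p + 1} =
        insert L[a] {σ | σ ∈ stage L a ∧ σ.card = p + 1} := by
      ext σ
      simp only [Set.mem_insert_iff, Set.mem_ofPred_eq]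
      constructor
      · rintro ⟨h1 | h1, h2⟩
        · exact Or.inl h1
        · exact Or.inr ⟨h1, h2⟩
      · rintro (rfl | h1)
        · exact ⟨Or.inl rfl, hc⟩
        · exact ⟨Or.inr h1.1, h1.2⟩
    rw [this, Set.ncard_insert_of_notMem (fun h => hnot h.1) hfin]
  · congr 1
    ext σ
    simp only [Set.mem_insert_iff, Set.mem_ofPred_eq]
    constructor
    · rintro ⟨rfl | h1, h2⟩
      · exact absurd h2 hc
      · exact ⟨h1, h2⟩
    · exact fun h => ⟨Or.inr h.1, h.2⟩

/-- An edge either destroys a component or creates a cycle. -/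
theorem IsCompatibleOrder.deaths_add_births (h : IsCompatibleOrder K s L) {a : ℕ}
    (ha : a < L.length) :
    (∑ b ∈ Finset.range a, pairMultiplicity L 0 b a) + (essentialMultiplicity L 1 a +
      ∑ b ∈ Finset.Ico (a + 1) L.length, pairMultiplicity L 1 a b) =
      if L[a].card = 2 then 1 else 0 := by
  -- When `L[a]` enters, `h1` identifies the deaths in dimension 0 with the growth of `B_0`, and
  -- `h2` the births in dimension 1 with the growth of `Z_1`. By rank-nullity these growths add up
  -- to that of `C_1`, which is 1 exactly for an edge.
  have h1 := sum_pairMultiplicity_birth L 0 a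
  have h2 := births_eq L 1 ha
  have h3 := finrank_chainSpace_succ L 0 a
  have h4 := finrank_chainSpace_succ L 0 (a + 1)
  have h5 := finrank_chainSpace_step h.nodup 1 ha
  rw [h.wDim_zero le_rfl, h.wDim_zero a.le_succ] at h1
  rw [h.wDim_succ] at h2
  simp only [zero_add] at h3 h4
  zify at h5 ⊢
  rw [h3, h4] at h5
  push_cast at h1 h2
  norm_num at h5
  linarith

theorem countP_replicate {α : Type*} (f : α → Prop) [DecidablePred f] (n : ℕ) (x : α) :
    (Multiset.replicate n x).countP f = if f x then n else 0 := by
  split_ifs with h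
  · rw [Multiset.countP_eq_card_filter, Multiset.filter_eq_self.2, Multiset.card_replicate]
    intro a ha; rwa [Multiset.eq_of_mem_replicate ha]
  · rw [Multiset.countP_eq_zero]
    intro a ha; rwa [Multiset.eq_of_mem_replicate ha]

open Classical in
-- Each index of the list contributes its deaths in dimension 0 and its births in dimension 1.
-- Together these are 1 if the simplex is an edge and 0 otherwise, so only the edges of height `z`
-- are counted, whichever compatible order the oracle used.
theorem IsCompatibleOrder.countP_add_countP (h : IsCompatibleOrder K s L) (z : ℝ) :
    (augmentedDiagram s L 0).countP (fun x => x.2 = (z : WithTop ℝ)) +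
      (augmentedDiagram s L 1).countP (fun x => x.1 = z) =
      {σ | σ ∈ K.edges ∧ height s σ = z}.ncard := by
  have e0 : (augmentedDiagram s L 0).countP (fun x => x.2 = (z : WithTop ℝ)) =
      ∑ b ∈ Finset.range L.length, if height s (L.getD b ∅) = z then
        ∑ a ∈ Finset.range b, pairMultiplicity L 0 a b else 0 := by
    rw [← Multiset.coe_countPAddMonoidHom, augmentedDiagram, map_sum]
    simp only [map_add, map_sum, Multiset.coe_countPAddMonoidHom, countP_replicate]
    simp only [WithTop.top_ne_coe, if_false, zero_add, WithTop.coe_inj, Finset.range_eq_Ico]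
    -- The diagram lists pairs by birth; deaths are counted by exchanging the two sums.
    rw [Finset.sum_Ico_Ico_comm']
    refine Finset.sum_congr rfl fun b _ => ?_
    split_ifs <;> simp
  have e1 : (augmentedDiagram s L 1).countP (fun x => x.1 = z) =
      ∑ a ∈ Finset.range L.length, if height s (L.getD a ∅) = z then
        (essentialMultiplicity L 1 a +
          ∑ b ∈ Finset.Ico (a + 1) L.length, pairMultiplicity L 1 a b) else 0 := by
    rw [← Multiset.coe_countPAddMonoidHom, augmentedDiagram, map_sum]
    simp only [map_add, map_sum, Multiset.coe_countPAddMonoidHom, countP_replicate]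
    refine Finset.sum_congr rfl fun b _ => ?_
    split_ifs <;> simp
  rw [e0, e1, ← Finset.sum_add_distrib]
  have e2 : ∀ a ∈ Finset.range L.length,
      ((if height s (L.getD a ∅) = z then
        ∑ b ∈ Finset.range a, pairMultiplicity L 0 b a else 0) +
      if height s (L.getD a ∅) = z then (essentialMultiplicity L 1 a +
          ∑ b ∈ Finset.Ico (a + 1) L.length, pairMultiplicity L 1 a b) else 0) =
      if (height s (L.getD a ∅) = z ∧ (L.getD a ∅).card = 2) then 1 else 0 := by
    intro a ha
    rw [Finset.mem_range] at ha
    have := h.deaths_add_births ha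
    rw [List.getD_eq_getElem _ _ ha]
    split_ifs with h1 h2 h2 <;> simp_all
  rw [Finset.sum_congr rfl e2, ← Finset.card_filter]
  symm
  rw [← Set.ncard_coe_finset]
  refine Set.ncard_congr' ?_ |>.symm
  refine Equiv.ofBijective
    (fun a => ⟨L.getD a.1 ∅, ?_⟩) ⟨?_, ?_⟩
  · have ha := a.2
    simp only [Finset.coe_filter, Finset.mem_range, Set.mem_ofPred_eq] at ha
    refine ⟨⟨(h.mem_iff _).1 ?_, ha.2.2⟩, ha.2.1⟩
    rw [List.getD_eq_getElem _ _ ha.1]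
    exact List.getElem_mem ha.1
  · rintro ⟨a, ha⟩ ⟨b, hb⟩ hab
    simp only [Finset.coe_filter, Finset.mem_range, Set.mem_ofPred_eq] at ha hb
    simp only [Subtype.mk.injEq] at hab ⊢
    rw [List.getD_eq_getElem _ _ ha.1, List.getD_eq_getElem _ _ hb.1] at hab
    exact (List.Nodup.getElem_inj_iff h.nodup).1 hab
  · rintro ⟨σ, hσ⟩
    obtain ⟨i, hi, rfl⟩ := List.getElem_of_mem ((h.mem_iff σ).2 hσ.1.1)
    refine ⟨⟨i, ?_⟩, ?_⟩
    · simp only [Finset.coe_filter, Finset.mem_range, Set.mem_ofPred_eq]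
      rw [List.getD_eq_getElem _ _ hi]
      exact ⟨hi, hσ.2, hσ.1.2⟩
    · simp only [List.getD_eq_getElem _ _ hi]

/-- The births of dimension `p` sum to the dimension of the space of `p`-cycles of `K`, which lies
in the space of `p`-chains. It bounds the array lengths in the binary searches. -/
theorem IsCompatibleOrder.card_augmentedDiagram_le (h : IsCompatibleOrder K s L) (p : ℕ) :
    (augmentedDiagram s L p).card ≤ {σ | σ ∈ K.faces ∧ σ.card = p + 1}.ncard := by
  have e1 : (augmentedDiagram s L p).card = ∑ a ∈ Finset.range L.length,
      (essentialMultiplicity L p a +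
          ∑ b ∈ Finset.Ico (a + 1) L.length, pairMultiplicity L p a b) := by
    simp [augmentedDiagram, Multiset.card_sum]
  have e2 : ((augmentedDiagram s L p).card : ℤ) = zDim L p L.length := by
    rw [e1, Nat.cast_sum, Finset.sum_congr rfl fun a ha => births_eq L p (Finset.mem_range.1 ha)]
    simp only [h.wDim_succ, sub_self, sub_zero]
    rw [Finset.sum_range_sub]
    have : cycleSpace (stage L 0) p = ⊥ := by
      simp [cycleSpace, chainSpace, stage_zero]
    simp [zDim, this]
  have e3 : Module.finrank (ZMod 2) (cycleSpace (stage L L.length) p) ≤ _ :=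
    Submodule.finrank_mono (inf_le_left : _ ≤ chainSpace (stage L L.length) p)
  rw [finrank_chainSpace (stage_finite L _)] at e3
  have e4 : stage L L.length = K.faces := by
    ext σ; simp [stage, h.mem_iff]
  rw [e4] at e3
  unfold zDim at e2
  rw [e4] at e2
  have : (augmentedDiagram s L p).card = Module.finrank (ZMod 2) (cycleSpace K.faces p) := by
    exact_mod_cast e2
  omega

end Persistence

/-! ### The number of edges of a plane straight-line graph -/

/-- A straight-line drawing: the vertices `0, …, n - 1` have the coordinates `(x i, y i)`, `E a b`
says that there is an edge going up from `a` to `b`, and edges meet only in common endpoints. -/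
structure IsDrawing (n : ℕ) (x y : ℕ → ℝ) (E : ℕ → ℕ → Prop) : Prop where
  lt_left : ∀ {a b}, E a b → a < n
  lt_right : ∀ {a b}, E a b → b < n
  height_lt : ∀ {a b}, E a b → y a < y b
  height_inj : ∀ {a b}, a < n → b < n → y a = y b → a = b
  inter : ∀ {a b c d}, E a b → E c d → ∀ η, y a ≤ η → η ≤ y b → y c ≤ η → η ≤ y d →
    x a + (η - y a) * ((x b - x a) / (y b - y a)) = x c + (η - y c) * ((x d - x c) / (y d - y c)) →
    (a = c ∧ b = d) ∨ (η = y a ∧ (a = c ∨ a = d)) ∨ (η = y b ∧ (b = c ∨ b = d))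

namespace IsDrawing

variable {n : ℕ} {x y : ℕ → ℝ} {E : ℕ → ℕ → Prop}

/-- The inverse slope of an edge. -/
def slope (x y : ℕ → ℝ) (a b : ℕ) : ℝ := (x b - x a) / (y b - y a)

/-- The first coordinate of the point of the line through `a` and `b` at height `η`. -/
def line (x y : ℕ → ℝ) (a b : ℕ) (η : ℝ) : ℝ := x a + (η - y a) * slope x y a b

/-- Reflection reverses the angular order, so one charging argument serves for both kinds of
neighbouring pairs. -/
theorem neg (h : IsDrawing n x y E) : IsDrawing n (fun i => - x i) y E where
  lt_left := h.lt_left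
  lt_right := h.lt_right
  height_lt := h.height_lt
  height_inj := h.height_inj
  inter := by
    intro a b c d h1 h2 η h3 h4 h5 h6 h7
    refine h.inter h1 h2 η h3 h4 h5 h6 ?_
    have e1 : (- x b - - x a) / (y b - y a) = - ((x b - x a) / (y b - y a)) := by ring
    have e2 : (- x d - - x c) / (y d - y c) = - ((x d - x c) / (y d - y c)) := by ring
    rw [e1, e2] at h7
    linarith

theorem slope_neg (x y : ℕ → ℝ) (a b : ℕ) : slope (fun i => - x i) y a b = - slope x y a b := by
  unfold slope; ring

/-- The edges `a b` and `a b'` are neighbours in the angular order at `a`. -/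
def Next (x y : ℕ → ℝ) (E : ℕ → ℕ → Prop) (a b b' : ℕ) : Prop :=
  E a b ∧ E a b' ∧ slope x y a b < slope x y a b' ∧
    ∀ c, E a c → ¬ (slope x y a b < slope x y a c ∧ slope x y a c < slope x y a b')

theorem line_top (h : IsDrawing n x y E) {a b : ℕ} (hE : E a b) : line x y a b (y b) = x b := by
  have := sub_pos.2 (h.height_lt hE)
  unfold line slope
  field_simp
  ring

theorem line_bot (x y : ℕ → ℝ) (a b : ℕ) : line x y a b (y a) = x a := by
  simp [line]

/-- Two edges leaving `a` with equal slope agree up to the lower of their upper ends, which is then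
a meeting point above `a` and must be a common endpoint. -/
theorem slope_inj (h : IsDrawing n x y E) {a b c : ℕ} (hb : E a b) (hc : E a c)
    (hs : slope x y a b = slope x y a c) : b = c := by
  have h1 := h.height_lt hb
  have h2 := h.height_lt hc
  rcases h.inter hb hc (min (y b) (y c)) (le_min h1.le h2.le) (min_le_left _ _)
    (le_min h1.le h2.le) (min_le_right _ _) (by unfold slope at hs; rw [hs]) with h3 | h3 | h3
  · exact h3.2
  · exact absurd h3.1 (lt_min h1 h2).ne'
  · rcases h3.2 with h4 | h4
    · rw [h4] at h1; exact absurd h1 (lt_irrefl _)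
    · exact h4

/-- Two affine functions that change their order meet. -/
theorem exists_zero_of_affine {f : ℝ → ℝ} (hf : Continuous f) {u w : ℝ} (huw : u < w)
    (hu : f u ≤ 0) (hw : 0 < f w) : ∃ η, u ≤ η ∧ η < w ∧ f η = 0 := by
  obtain ⟨η, hη, h0⟩ := intermediate_value_Icc huw.le hf.continuousOn ⟨hu, hw.le⟩
  refine ⟨η, hη.1, lt_of_le_of_ne hη.2 ?_, h0⟩
  rintro rfl
  exact absurd h0 hw.ne'

theorem continuous_line (x y : ℕ → ℝ) (a b : ℕ) : Continuous (line x y a b) := by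
  unfold line; fun_prop

/-- From the longer of two neighbouring edges, some vertex can be seen horizontally. -/
theorem exists_visible (h : IsDrawing n x y E) {a b b' : ℕ} (hN : Next x y E a b b')
    (hlow : y b' < y b) : ∃ t < n, y a < y t ∧ y t < y b ∧ line x y a b (y t) < x t ∧
      ∀ c d, E c d → y c < y t → y t < y d →
        ¬ (line x y a b (y t) < line x y c d (y t) ∧ line x y c d (y t) < x t) := by
  classical
  obtain ⟨hb, hb', hs, hnext⟩ := hN
  -- The vertices between the two edges, up to the top `b'` of the shorter one; `b'` itself belongs
  -- to this set. The lowest of them is the visible vertex.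
  let T : Finset ℕ := (Finset.range n).filter fun t =>
    y a < y t ∧ y t ≤ y b' ∧ line x y a b (y t) < x t ∧ x t ≤ line x y a b' (y t)
  have hT : T.Nonempty := by
    refine ⟨b', ?_⟩
    simp only [T, Finset.mem_filter, Finset.mem_range]
    refine ⟨h.lt_right hb', h.height_lt hb', le_rfl, ?_, (h.line_top hb').ge⟩
    rw [← h.line_top hb']
    have := sub_pos.2 (h.height_lt hb')
    unfold line
    nlinarith
  obtain ⟨t, htT, hmin⟩ := T.exists_min_image y hT
  simp only [T, Finset.mem_filter, Finset.mem_range] at htT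
  obtain ⟨htn, h1, h2, h3, h4⟩ := htT
  refine ⟨t, htn, h1, h2.trans_lt hlow, h3, ?_⟩
  rintro c d hcd hc hd ⟨h5, h6⟩
  have hη : max (y a) (y c) < y t := max_lt h1 hc
  have hca : a ≠ c := by
    rintro rfl
    refine hnext d hcd ⟨?_, ?_⟩
    · unfold line at h5; by_contra hh; nlinarith
    · have := h6.trans_le h4
      unfold line at this; by_contra hh; nlinarith
  -- An edge `c d` hiding `t` is followed downwards from the height of `t`. It cannot cross either
  -- side of the wedge, so it is still strictly inside at the height where it starts or where the
  -- wedge ends.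
  have hf : 0 < line x y c d (max (y a) (y c)) - line x y a b (max (y a) (y c)) := by
    by_contra hle
    obtain ⟨η, e1, e2, e3⟩ := exists_zero_of_affine
      ((continuous_line x y c d).sub (continuous_line x y a b)) hη (not_lt.1 hle)
      (by simpa using h5)
    rcases h.inter hb hcd η ((le_max_left _ _).trans e1) (by linarith) ((le_max_right _ _).trans e1)
      (by linarith) (sub_eq_zero.1 e3).symm with h7 | h7 | h7
    · exact hca h7.1
    · rcases h7.2 with h8 | h8
      · exact hca h8
      · rw [h8] at h1; linarith
    · linarith [h7.1]
  have hg : 0 < line x y a b' (max (y a) (y c)) - line x y c d (max (y a) (y c)) := by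
    by_contra hle
    obtain ⟨η, e1, e2, e3⟩ := exists_zero_of_affine
      ((continuous_line x y a b').sub (continuous_line x y c d)) hη (not_lt.1 hle)
      (by simpa using h6.trans_le h4)
    rcases h.inter hb' hcd η ((le_max_left _ _).trans e1) (by linarith) ((le_max_right _ _).trans e1)
      (by linarith) (sub_eq_zero.1 e3) with h7 | h7 | h7
    · exact hca h7.1
    · rcases h7.2 with h8 | h8
      · exact hca h8
      · rw [h8] at h1; linarith
    · linarith [h7.1]
  -- If `c` is not above `a`, the edge would pass strictly between two lines that meet at the apex.
  -- Otherwise `c` lies in `T` and is lower than `t`, against the choice of `t`.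
  rcases le_or_gt (y c) (y a) with hle | hgt
  · rw [max_eq_left hle, line_bot] at hf hg
    linarith
  · rw [max_eq_right hgt.le, line_bot] at hf hg
    have := hmin c (by
      simp only [T, Finset.mem_filter, Finset.mem_range]
      exact ⟨h.lt_left hcd, hgt, by linarith, by linarith, by linarith⟩)
    linarith

/-- The triples formed by two neighbouring edges, the first of which is longer. -/
def Falling (x y : ℕ → ℝ) (E : ℕ → ℕ → Prop) : Set (ℕ × ℕ × ℕ) :=
  {p | Next x y E p.1 p.2.1 p.2.2 ∧ y p.2.2 < y p.2.1}

/-- Charge each pair to a vertex visible horizontally to the right of its longer edge. If two longer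
edges see the same vertex, neither may stand between the other and that vertex, so they meet at its
height, which is interior to both; hence they coincide. The neighbour in the angular order is then
determined too. -/
theorem ncard_falling_le (h : IsDrawing n x y E) : (Falling x y E).ncard ≤ n := by
  have hex : ∀ p : ℕ × ℕ × ℕ, ∃ t, p ∈ Falling x y E → t < n ∧ y p.1 < y t ∧ y t < y p.2.1 ∧
      line x y p.1 p.2.1 (y t) < x t ∧ ∀ c d, E c d → y c < y t → y t < y d →
        ¬ (line x y p.1 p.2.1 (y t) < line x y c d (y t) ∧ line x y c d (y t) < x t) := by
    intro p
    by_cases hp : p ∈ Falling x y E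
    · obtain ⟨t, ht⟩ := h.exists_visible hp.1 hp.2
      exact ⟨t, fun _ => ht⟩
    · exact ⟨0, fun h => absurd h hp⟩
  choose t ht using hex
  have hcard := Set.ncard_le_ncard_of_injOn (s := Falling x y E) (t := (Finset.range n : Set ℕ)) t
    (fun p hp => by simpa using (ht p hp).1) ?_ (Finset.finite_toSet _)
  · simpa using hcard
  · rintro ⟨a, b, b'⟩ hp ⟨c, d, d'⟩ hp' heq
    obtain ⟨-, h1, h2, h3, h4⟩ := ht _ hp
    obtain ⟨-, h5, h6, h7, h8⟩ := ht _ hp'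
    rw [← heq] at h5 h6 h7 h8
    obtain ⟨⟨q1, q2, q3, q4⟩, -⟩ := hp
    obtain ⟨⟨q1', q2', q3', q4'⟩, -⟩ := hp'
    simp only at *
    have hl := h4 c d q1' h5 h6
    have hr := h8 a b q1 h1 h2
    have heq2 : line x y a b (y (t (a, b, b'))) = line x y c d (y (t (a, b, b'))) := by
      rcases lt_trichotomy (line x y a b (y (t (a, b, b')))) (line x y c d (y (t (a, b, b')))) with
        hh | hh | hh
      · exact absurd ⟨hh, h7⟩ hl
      · exact hh
      · exact absurd ⟨hh, h3⟩ hr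
    obtain ⟨rfl, rfl⟩ : a = c ∧ b = d := by
      rcases h.inter q1 q1' _ h1.le h2.le h5.le h6.le heq2 with h9 | h9 | h9
      · exact h9
      · exact absurd h9.1 h1.ne'
      · exact absurd h9.1 h2.ne
    have : b' = d' := by
      refine h.slope_inj q2 q2' ?_
      rcases lt_trichotomy (slope x y a b') (slope x y a d') with hh | hh | hh
      · exact absurd ⟨q3, hh⟩ (q4' _ q2)
      · exact hh
      · exact absurd ⟨q3', hh⟩ (q4 _ q2')
    rw [this]

/-- A plane straight-line graph with `n` vertices has at most `3 n` edges. -/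
theorem ncard_edges_le (h : IsDrawing n x y E) : {p : ℕ × ℕ | E p.1 p.2}.ncard ≤ 3 * n := by
  classical
  -- `A` contains the last edge in the angular order at each lower endpoint; all other edges have a
  -- successor. `B` and `C` collect the pairs whose longer edge is the first one, in the drawing and
  -- in its mirror image.
  set A : Set (ℕ × ℕ) := {p | E p.1 p.2 ∧ ∀ c, E p.1 c → slope x y p.1 c ≤ slope x y p.1 p.2}
  set B : Set (ℕ × ℕ × ℕ) := Falling x y E
  set C : Set (ℕ × ℕ × ℕ) := Falling (fun i => - x i) y E
  have hfin3 : ∀ x', IsDrawing n x' y E → (Falling x' y E).Finite := by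
    intro x' h'
    refine ((Finset.range n ×ˢ (Finset.range n ×ˢ Finset.range n)).finite_toSet).subset ?_
    rintro p ⟨hp, -⟩
    simp only [Finset.coe_product, Set.mem_prod, Finset.mem_coe, Finset.mem_range]
    exact ⟨h'.lt_left hp.1, h'.lt_right hp.1, h'.lt_right hp.2.1⟩
  have hA : A.ncard ≤ n := by
    have := Set.ncard_le_ncard_of_injOn (s := A) (t := (Finset.range n : Set ℕ)) Prod.fst
      (fun p hp => by simpa using h.lt_left hp.1) ?_ (Finset.finite_toSet _)
    · simpa using this
    · rintro ⟨a, b⟩ ⟨h1, h2⟩ ⟨c, d⟩ ⟨h3, h4⟩ rfl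
      have := h.slope_inj h1 h3 (le_antisymm (h4 _ h1) (h2 _ h3))
      simp_all
  have hAfin : A.Finite := by
    refine ((Finset.range n ×ˢ Finset.range n).finite_toSet).subset ?_
    rintro p ⟨hp, -⟩
    simp only [Finset.coe_product, Set.mem_prod, Finset.mem_coe, Finset.mem_range]
    exact ⟨h.lt_left hp, h.lt_right hp⟩
  have hB : B.ncard ≤ n := h.ncard_falling_le
  have hC : C.ncard ≤ n := h.neg.ncard_falling_le
  have hBf := hfin3 _ h
  have hCf := hfin3 _ h.neg
  have hsub : {p : ℕ × ℕ | E p.1 p.2} ⊆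
      A ∪ (fun p : ℕ × ℕ × ℕ => (p.1, p.2.1)) '' B ∪ (fun p : ℕ × ℕ × ℕ => (p.1, p.2.2)) '' C := by
    rintro ⟨a, b⟩ hE
    simp only [Set.mem_ofPred_eq] at hE
    by_cases hAp : ∀ c, E a c → slope x y a c ≤ slope x y a b
    · exact Or.inl (Or.inl ⟨hE, hAp⟩)
    push Not at hAp
    obtain ⟨c, hc1, hc2⟩ := hAp
    let T : Finset ℕ := (Finset.range n).filter fun c => E a c ∧ slope x y a b < slope x y a c
    have hT : T.Nonempty := ⟨c, by
      simp only [T, Finset.mem_filter, Finset.mem_range]; exact ⟨h.lt_right hc1, hc1, hc2⟩⟩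
    obtain ⟨b', hb', hmin⟩ := T.exists_min_image (slope x y a) hT
    simp only [T, Finset.mem_filter, Finset.mem_range] at hb'
    obtain ⟨hb'n, hb', hsl⟩ := hb'
    have hnext : ∀ c, E a c → ¬ (slope x y a b < slope x y a c ∧ slope x y a c < slope x y a b') := by
      rintro c h1 ⟨h2, h3⟩
      have := hmin c (by
        simp only [T, Finset.mem_filter, Finset.mem_range]; exact ⟨h.lt_right h1, h1, h2⟩)
      linarith
    -- If the successor is shorter, the edge is the longer member of a pair in `B`. If it is longer,
    -- the edge is the shorter member of a pair in `C`, since the mirror image exchanges the order.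
    -- This explains the two projections.
    rcases lt_trichotomy (y b') (y b) with hlt | heq | hgt
    · exact Or.inl (Or.inr ⟨(a, b, b'), ⟨⟨hE, hb', hsl, hnext⟩, hlt⟩, rfl⟩)
    · rw [h.height_inj hb'n (h.lt_right hE) heq] at hsl
      exact absurd hsl (lt_irrefl _)
    · refine Or.inr ⟨(a, b', b), ⟨⟨hb', hE, ?_, ?_⟩, hgt⟩, rfl⟩
      · simpa only [slope_neg, neg_lt_neg_iff] using hsl
      · intro c hc
        simp only [slope_neg, neg_lt_neg_iff]
        exact fun hh => hnext c hc ⟨hh.2, hh.1⟩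
  calc _ ≤ _ := Set.ncard_le_ncard hsub ((hAfin.union (hBf.image _)).union (hCf.image _))
    _ ≤ (A ∪ (fun p : ℕ × ℕ × ℕ => (p.1, p.2.1)) '' B).ncard +
        ((fun p : ℕ × ℕ × ℕ => (p.1, p.2.2)) '' C).ncard := Set.ncard_union_le _ _
    _ ≤ A.ncard + ((fun p : ℕ × ℕ × ℕ => (p.1, p.2.1)) '' B).ncard +
        ((fun p : ℕ × ℕ × ℕ => (p.1, p.2.2)) '' C).ncard :=
      Nat.add_le_add_right (Set.ncard_union_le _ _) _
    _ ≤ A.ncard + B.ncard + C.ncard := by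
      exact Nat.add_le_add (Nat.add_le_add_left (Set.ncard_image_le hBf) _)
        (Set.ncard_image_le hCf)
    _ ≤ 3 * n := by omega

end IsDrawing

/-! ### Numbered vertices -/

/-- The plane point with the given coordinates. -/
def coordPoint (X Y : ℕ → ℝ) (i : ℕ) : Plane := !₂[X i, Y i]

/-- The points `(X i, Y i)`, `i < n`, are the vertices of `K`, each exactly once. -/
def IsNumbering (K : PlaneComplex) (n : ℕ) (X Y : ℕ → ℝ) : Prop :=
  Set.BijOn (coordPoint X Y) (Set.Iio n) K.verts

open Classical in
/-- There is an edge of `K` going up from the vertex number `a` to the vertex number `b`. -/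
def UpEdge (K : PlaneComplex) (n : ℕ) (X Y : ℕ → ℝ) (a b : ℕ) : Prop :=
  a < n ∧ b < n ∧ Y a < Y b ∧ {coordPoint X Y a, coordPoint X Y b} ∈ K.edges

theorem inner_coordPoint (s : Plane) (X Y : ℕ → ℝ) (i : ℕ) :
    inner ℝ s (coordPoint X Y i) = s 0 * X i + s 1 * Y i := by
  simp [PiLp.inner_apply, coordPoint, Fin.sum_univ_two, mul_comm]

theorem height_pair [DecidableEq Plane] (s a b : Plane) :
    height s {a, b} = max (inner ℝ s a) (inner ℝ s b) := by
  unfold height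
  rw [Finset.coe_pair, Set.image_pair, csSup_pair]

theorem StoresDiagram.length_bounds {K : PlaneComplex} {s : Plane} {D : DgmData}
    (h : StoresDiagram K s D) :
    (D.byBirth 0).length = (D.byDeath 0).length ∧ (D.byDeath 0).length ≤ K.verts.ncard ∧
      (D.byBirth 1).length ≤ K.edges.ncard := by
  obtain ⟨L, hL, h⟩ := h
  have h0 := congrArg Multiset.card (h 0).1
  have h1 := congrArg Multiset.card (h 0).2.2.1
  have h2 := congrArg Multiset.card (h 1).1
  rw [Multiset.coe_card] at h0 h1 h2
  refine ⟨h0.trans h1.symm, ?_, ?_⟩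
  · rw [h1]
    refine (hL.card_augmentedDiagram_le 0).trans ?_
    have hs : {σ | σ ∈ K.faces ∧ σ.card = 0 + 1} ⊆ (fun v : Plane => ({v} : Finset Plane)) '' K.verts := by
      rintro σ ⟨h3, h4⟩
      obtain ⟨v, rfl⟩ := Finset.card_eq_one.1 h4
      exact ⟨v, h3, rfl⟩
    have hfin : K.verts.Finite := by
      refine Set.Finite.of_finite_image (f := fun v : Plane => ({v} : Finset Plane)) ?_
        (Finset.singleton_injective.injOn)
      refine K.finite_faces.subset ?_
      rintro _ ⟨v, hv, rfl⟩
      exact hv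
    exact (Set.ncard_le_ncard hs (hfin.image _)).trans (Set.ncard_image_le hfin)
  · rw [h2]
    exact hL.card_augmentedDiagram_le 1

namespace IsNumbering

variable {K : PlaneComplex} {n : ℕ} {X Y : ℕ → ℝ}

theorem height_inj (h : IsNumbering K n X Y) {a b : ℕ} (ha : a < n) (hb : b < n)
    (hab : Y a = Y b) : a = b :=
  h.injOn ha hb (K.generalPosition.unique_height _ (h.mapsTo ha) _ (h.mapsTo hb)
    (by simpa [coordPoint] using hab))

theorem ncard_verts (h : IsNumbering K n X Y) : K.verts.ncard = n := by
  rw [← h.image_eq, h.injOn.ncard_image]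
  simp [Set.ncard_eq_toFinset_card']

/-- Equal inverse slopes would put three distinct vertices on one line through `v`. The denominators
are nonzero because the heights are distinct. -/
theorem key_inj (h : IsNumbering K n X Y) {v a b : ℕ} (hv : v < n) (ha : a < n) (hb : b < n)
    (hav : a ≠ v) (hbv : b ≠ v)
    (hk : (X a - X v) / (Y a - Y v) = (X b - X v) / (Y b - Y v)) : a = b := by
  by_contra hab
  have hne : ∀ {i j}, i < n → j < n → i ≠ j → coordPoint X Y i ≠ coordPoint X Y j :=
    fun hi hj hij he => hij (h.injOn hi hj he)
  have hI := K.generalPosition.affineIndependent _ (h.mapsTo hv) _ (h.mapsTo ha) _ (h.mapsTo hb)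
    (hne hv ha hav.symm) (hne hv hb hbv.symm) (hne ha hb hab)
  rw [affineIndependent_iff_not_collinear_set] at hI
  apply hI
  rw [collinear_iff_of_mem (p₀ := coordPoint X Y v) (by simp)]
  set κ := (X a - X v) / (Y a - Y v) with hκ
  have hYa : Y a - Y v ≠ 0 := sub_ne_zero.2 fun he => hav (h.height_inj ha hv he)
  have hYb : Y b - Y v ≠ 0 := sub_ne_zero.2 fun he => hbv (h.height_inj hb hv he)
  have ea : X a - X v = κ * (Y a - Y v) := by rw [hκ]; field_simp
  have eb : X b - X v = κ * (Y b - Y v) := by rw [hk]; field_simp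
  refine ⟨!₂[κ, 1], ?_⟩
  intro p hp
  simp only [Set.mem_insert_iff, Set.mem_singleton_iff] at hp
  have key : ∀ i, X i - X v = κ * (Y i - Y v) →
      coordPoint X Y i = (Y i - Y v) • (!₂[κ, 1] : Plane) +ᵥ coordPoint X Y v := by
    intro i hi
    ext j
    fin_cases j
    · simp [coordPoint]; linarith
    · simp [coordPoint]
  rcases hp with rfl | rfl | rfl
  · exact ⟨_, key v (by simp)⟩
  · exact ⟨_, key a ea⟩
  · exact ⟨_, key b eb⟩

theorem coordPoint_mem_segment {a b : ℕ} (hab : Y a < Y b) {η : ℝ} (h1 : Y a ≤ η) (h2 : η ≤ Y b) :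
    (!₂[X a + (η - Y a) * ((X b - X a) / (Y b - Y a)), η] : Plane) ∈
      segment ℝ (coordPoint X Y a) (coordPoint X Y b) := by
  have hpos := sub_pos.2 hab
  refine ⟨(Y b - η) / (Y b - Y a), (η - Y a) / (Y b - Y a), by
    apply div_nonneg <;> linarith, by apply div_nonneg <;> linarith, by field_simp; ring, ?_⟩
  ext j
  fin_cases j
  · simp [coordPoint]; field_simp; ring
  · simp [coordPoint]; field_simp; ring

/-- In a simplicial complex a common point of two edges lies in the convex hull of their common
vertices; the case distinction is by which endpoints those are. -/
theorem isDrawing (h : IsNumbering K n X Y) : IsDrawing n X Y (UpEdge K n X Y) where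
  lt_left h' := h'.1
  lt_right h' := h'.2.1
  height_lt h' := h'.2.2.1
  height_inj := h.height_inj
  inter := by
    classical
    rintro a b c d ⟨ha, hb, hab, he⟩ ⟨hc, hd, hcd, he'⟩ η h1 h2 h3 h4 heq
    have m1 := coordPoint_mem_segment (X := X) hab h1 h2
    have m2 := coordPoint_mem_segment (X := X) hcd h3 h4
    rw [← heq] at m2
    have m3 := K.inter_subset_convexHull he.1 he'.1 ⟨by
      rw [Finset.coe_pair, convexHull_pair]; exact m1, by
      rw [Finset.coe_pair, convexHull_pair]; exact m2⟩
    set z : Plane := !₂[X a + (η - Y a) * ((X b - X a) / (Y b - Y a)), η] with hz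
    simp only [Finset.coe_pair] at m3
    have hinj : ∀ {i j}, i < n → j < n → coordPoint X Y i = coordPoint X Y j → i = j :=
      fun hi hj he => h.injOn hi hj he
    by_cases pa : a = c ∨ a = d
    · by_cases pb : b = c ∨ b = d
      · left
        rcases pa with rfl | rfl
        · rcases pb with rfl | rfl
          · exact absurd hab (lt_irrefl _)
          · exact ⟨rfl, rfl⟩
        · rcases pb with rfl | rfl
          · exact absurd hab hcd.not_gt
          · exact absurd hab (lt_irrefl _)
      · right; left
        refine ⟨?_, pa⟩
        have hsub : ({coordPoint X Y a, coordPoint X Y b} ∩ {coordPoint X Y c, coordPoint X Y d} :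
            Set Plane) ⊆ {coordPoint X Y a} := by
          rintro p ⟨rfl | rfl, hp⟩
          · rfl
          · exfalso
            rcases hp with hp | hp
            · exact pb (Or.inl (hinj hb hc hp))
            · exact pb (Or.inr (hinj hb hd hp))
        have := convexHull_mono hsub m3
        rw [convexHull_singleton] at this
        have := congrArg (fun p : Plane => p 1) (Set.mem_singleton_iff.1 this)
        simpa [hz, coordPoint] using this
    · right; right
      have hsub : ({coordPoint X Y a, coordPoint X Y b} ∩ {coordPoint X Y c, coordPoint X Y d} :
          Set Plane) ⊆ {coordPoint X Y b} := by
        rintro p ⟨rfl | rfl, hp⟩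
        · exfalso
          rcases hp with hp | hp
          · exact pa (Or.inl (hinj ha hc hp))
          · exact pa (Or.inr (hinj ha hd hp))
        · rfl
      have m4 := convexHull_mono hsub m3
      rw [convexHull_singleton] at m4
      have := congrArg (fun p : Plane => p 1) (Set.mem_singleton_iff.1 m4)
      refine ⟨by simpa [hz, coordPoint] using this, ?_⟩
      by_contra hpb
      have hempty : ({coordPoint X Y a, coordPoint X Y b} ∩ {coordPoint X Y c, coordPoint X Y d} :
          Set Plane) = ∅ := by
        refine Set.eq_empty_of_forall_notMem ?_
        rintro p ⟨rfl | rfl, hp⟩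
        · rcases hp with hp | hp
          · exact pa (Or.inl (hinj ha hc hp))
          · exact pa (Or.inr (hinj ha hd hp))
        · rcases hp with hp | hp
          · exact hpb (Or.inl (hinj hb hc hp))
          · exact hpb (Or.inr (hinj hb hd hp))
      rw [hempty, convexHull_empty] at m3
      exact m3

open Classical in
/-- Every edge is given by the numbers of its lower and its upper endpoint. -/
theorem bijOn_edges (h : IsNumbering K n X Y) :
    Set.BijOn (fun p : ℕ × ℕ => ({coordPoint X Y p.1, coordPoint X Y p.2} : Finset Plane))
      {p | UpEdge K n X Y p.1 p.2} K.edges := by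
  have hinj : ∀ {i j}, i < n → j < n → coordPoint X Y i = coordPoint X Y j → i = j :=
      fun hi hj he => h.injOn hi hj he
  refine ⟨fun p hp => hp.2.2.2, ?_, ?_⟩
  · rintro ⟨a, b⟩ ⟨ha, hb, hab, -⟩ ⟨c, d⟩ ⟨hc, hd, hcd, -⟩ heq
    simp only at *
    have h1 : coordPoint X Y a ∈ ({coordPoint X Y c, coordPoint X Y d} : Finset Plane) := by
      rw [← heq]; simp
    have h2 : coordPoint X Y b ∈ ({coordPoint X Y c, coordPoint X Y d} : Finset Plane) := by
      rw [← heq]; simp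
    simp only [Finset.mem_insert, Finset.mem_singleton] at h1 h2
    have h1' : a = c ∨ a = d := h1.imp (hinj ha hc) (hinj ha hd)
    have h2' : b = c ∨ b = d := h2.imp (hinj hb hc) (hinj hb hd)
    rcases h1' with rfl | rfl <;> rcases h2' with rfl | rfl
    · exact absurd hab (lt_irrefl _)
    · rfl
    · exact absurd hab hcd.not_gt
    · exact absurd hab (lt_irrefl _)
  · rintro σ hσ
    obtain ⟨p, p', hne, rfl⟩ := Finset.card_eq_two.1 hσ.2
    have hv : ∀ r ∈ ({p, p'} : Finset Plane), r ∈ K.verts := fun r hr =>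
      K.toSimplicialComplex.down_closed hσ.1 (Finset.singleton_subset_iff.2 hr)
        (Finset.singleton_nonempty _)
    obtain ⟨i, hi, rfl⟩ := h.surjOn (hv p (by simp))
    obtain ⟨j, hj, rfl⟩ := h.surjOn (hv p' (by simp))
    rcases lt_trichotomy (Y i) (Y j) with hlt | heq | hgt
    · exact ⟨(i, j), ⟨hi, hj, hlt, hσ⟩, rfl⟩
    · exact absurd (congrArg _ (h.height_inj hi hj heq)) hne
    · refine ⟨(j, i), ⟨hj, hi, hgt, ?_⟩, ?_⟩
      · rw [Finset.pair_comm]; exact hσ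
      · exact Finset.pair_comm _ _

theorem ncard_edges (h : IsNumbering K n X Y) :
    K.edges.ncard = {p : ℕ × ℕ | UpEdge K n X Y p.1 p.2}.ncard := by
  classical
  rw [← h.bijOn_edges.image_eq, h.bijOn_edges.injOn.ncard_image]

theorem ncard_edges_le (h : IsNumbering K n X Y) : K.edges.ncard ≤ 3 * n := by
  rw [h.ncard_edges]; exact h.isDrawing.ncard_edges_le

/-! ### The edges at a vertex counted by a diagram -/

/-- The upper endpoints of the edges going up from `v`. -/
def ups (K : PlaneComplex) (n : ℕ) (X Y : ℕ → ℝ) (v : ℕ) : Set ℕ := {u | UpEdge K n X Y v u}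

/-- The lower endpoints of the edges going down from `v`. -/
def downs (K : PlaneComplex) (n : ℕ) (X Y : ℕ → ℝ) (v : ℕ) : Set ℕ := {u | UpEdge K n X Y u v}

theorem ups_finite (K : PlaneComplex) (n : ℕ) (X Y : ℕ → ℝ) (v : ℕ) : (ups K n X Y v).Finite :=
  (Set.finite_Iio n).subset fun _ h => h.2.1

theorem downs_finite (K : PlaneComplex) (n : ℕ) (X Y : ℕ → ℝ) (v : ℕ) :
    (downs K n X Y v).Finite :=
  (Set.finite_Iio n).subset fun _ h => h.1

/-- An edge gets the height of its higher endpoint in direction `s`. Since no other vertex has the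
height of `v`, an edge of that height ends at `v` and has its other end strictly lower in direction
`s`. -/
theorem ncard_height_eq (h : IsNumbering K n X Y) (s : Plane) {v : ℕ} (hv : v < n)
    (hs : ∀ u < n, u ≠ v → inner ℝ s (coordPoint X Y u) ≠ inner ℝ s (coordPoint X Y v)) :
    {σ | σ ∈ K.edges ∧ height s σ = inner ℝ s (coordPoint X Y v)}.ncard =
      {u | u ∈ ups K n X Y v ∧ inner ℝ s (coordPoint X Y u) < inner ℝ s (coordPoint X Y v)}.ncard +
      {u | u ∈ downs K n X Y v ∧
        inner ℝ s (coordPoint X Y u) < inner ℝ s (coordPoint X Y v)}.ncard := by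
  classical
  set A := {u | u ∈ ups K n X Y v ∧ inner ℝ s (coordPoint X Y u) < inner ℝ s (coordPoint X Y v)}
  set B := {u | u ∈ downs K n X Y v ∧ inner ℝ s (coordPoint X Y u) < inner ℝ s (coordPoint X Y v)}
  have hinj : ∀ {i j}, i < n → j < n → coordPoint X Y i = coordPoint X Y j → i = j :=
      fun hi hj he => h.injOn hi hj he
  have hdisj : Disjoint A B := by
    rw [Set.disjoint_left]
    rintro u ⟨h1, -⟩ ⟨h2, -⟩
    exact absurd h1.2.2.1 h2.2.2.1.not_gt
  rw [← Set.ncard_union_eq hdisj ((ups_finite K n X Y v).subset fun _ h => h.1)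
    ((downs_finite K n X Y v).subset fun _ h => h.1)]
  have hbij : Set.BijOn (fun u => ({coordPoint X Y v, coordPoint X Y u} : Finset Plane)) (A ∪ B)
      {σ | σ ∈ K.edges ∧ height s σ = inner ℝ s (coordPoint X Y v)} := by
    refine ⟨?_, ?_, ?_⟩
    · rintro u (⟨h1, h2⟩ | ⟨h1, h2⟩)
      · exact ⟨h1.2.2.2, by rw [height_pair, max_eq_left h2.le]⟩
      · exact ⟨by have hh := h1.2.2.2; rw [Finset.pair_comm] at hh; exact hh, by rw [height_pair, max_eq_left h2.le]⟩
    · have hlt : ∀ u ∈ A ∪ B, u < n ∧ u ≠ v := by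
        rintro u (⟨h1, -⟩ | ⟨h1, -⟩)
        · exact ⟨h1.2.1, by rintro rfl; exact lt_irrefl _ h1.2.2.1⟩
        · exact ⟨h1.1, by rintro rfl; exact lt_irrefl _ h1.2.2.1⟩
      intro u hu w hw heq
      have h1 : coordPoint X Y u ∈ ({coordPoint X Y v, coordPoint X Y w} : Finset Plane) := by
        rw [← show _ = ({coordPoint X Y v, coordPoint X Y w} : Finset Plane) from heq]; simp
      simp only [Finset.mem_insert, Finset.mem_singleton] at h1
      rcases h1 with h1 | h1
      · exact absurd (hinj (hlt u hu).1 hv h1) (hlt u hu).2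
      · exact hinj (hlt u hu).1 (hlt w hw).1 h1
    · rintro σ ⟨hσ, hht⟩
      obtain ⟨⟨a, b⟩, hab, rfl⟩ := h.bijOn_edges.surjOn hσ
      simp only at hht ⊢
      have ha : a < n := hab.1
      have hb : b < n := hab.2.1
      have hne : a ≠ b := by rintro rfl; exact lt_irrefl _ hab.2.2.1
      rw [height_pair] at hht
      rcases le_total (inner ℝ s (coordPoint X Y a)) (inner ℝ s (coordPoint X Y b)) with hle | hle
      · rw [max_eq_right hle] at hht
        have hbv : b = v := by by_contra hh; exact hs b hb hh hht
        subst hbv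
        exact ⟨a, Or.inr ⟨hab, lt_of_le_of_ne hle (hs a ha hne)⟩, Finset.pair_comm _ _⟩
      · rw [max_eq_left hle] at hht
        have hav : a = v := by by_contra hh; exact hs a ha hh hht
        subst hav
        exact ⟨b, Or.inl ⟨hab, lt_of_le_of_ne hle (hs b hb hne.symm)⟩, rfl⟩
  rw [← hbij.image_eq, hbij.injOn.ncard_image]

open Classical in
/-- The number of edges whose height is that of the vertex `v`, read off from a diagram. -/
theorem countP_eq (h : IsNumbering K n X Y) {s : Plane} {D : DgmData} (hD : StoresDiagram K s D)
    {v : ℕ} (hv : v < n)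
    (hs : ∀ u < n, u ≠ v → inner ℝ s (coordPoint X Y u) ≠ inner ℝ s (coordPoint X Y v)) :
    (D.byDeath 0).countP (fun x => x.2 = ((inner ℝ s (coordPoint X Y v) : ℝ) : WithTop ℝ)) +
        (D.byBirth 1).countP (fun x => x.1 = inner ℝ s (coordPoint X Y v)) =
      {u | u ∈ ups K n X Y v ∧ inner ℝ s (coordPoint X Y u) < inner ℝ s (coordPoint X Y v)}.ncard +
      {u | u ∈ downs K n X Y v ∧
        inner ℝ s (coordPoint X Y u) < inner ℝ s (coordPoint X Y v)}.ncard := by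
  obtain ⟨L, hL, hD⟩ := hD
  rw [← h.ncard_height_eq s hv hs, ← hL.countP_add_countP, ← (hD 0).2.2.1, ← (hD 1).1,
    Multiset.coe_countP, Multiset.coe_countP]

/-- The direction orthogonal to the lines with inverse slope `κ`. -/
def slopeDir (κ : ℝ) : Plane := !₂[1 / Real.sqrt (1 + κ * κ), (0 - κ) / Real.sqrt (1 + κ * κ)]

theorem norm_slopeDir (κ : ℝ) : ‖slopeDir κ‖ = 1 := by
  have h : 0 < 1 + κ * κ := by nlinarith [mul_self_nonneg κ]
  rw [EuclideanSpace.norm_eq, Real.sqrt_eq_one]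
  simp only [slopeDir, Fin.sum_univ_two, PiLp.toLp_apply, Matrix.cons_val_zero, Matrix.cons_val_one,
    Real.norm_eq_abs, sq_abs, div_pow, Real.sq_sqrt h.le]
  field_simp
  ring

/-- Up to a positive factor the height of `u` is `X u - κ * Y u`. Dividing the difference by `Y u -
Y v` reverses the inequality for `u` below `v`, so down-edges are counted on the opposite side of
`κ`. -/
theorem inner_slopeDir_lt (κ : ℝ) {u v : ℕ} (hY : Y u ≠ Y v) :
    (inner ℝ (slopeDir κ) (coordPoint X Y u) < inner ℝ (slopeDir κ) (coordPoint X Y v) ↔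
      (Y v < Y u ∧ (X u - X v) / (Y u - Y v) < κ) ∨
        (Y u < Y v ∧ κ < (X u - X v) / (Y u - Y v))) := by
  have h : 0 < Real.sqrt (1 + κ * κ) := Real.sqrt_pos.2 (by nlinarith [mul_self_nonneg κ])
  rw [inner_coordPoint, inner_coordPoint]
  have e : ∀ i, slopeDir κ 0 * X i + slopeDir κ 1 * Y i = (X i - κ * Y i) / Real.sqrt (1 + κ * κ) := by
    intro i; simp [slopeDir]; field_simp; ring
  rw [e, e, div_lt_div_iff_of_pos_right h]
  rcases lt_or_gt_of_ne hY with hlt | hgt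
  · have h1 : Y u - Y v < 0 := sub_neg.2 hlt
    rw [lt_div_iff_of_neg h1]
    constructor
    · intro hh; exact Or.inr ⟨hlt, by linarith⟩
    · rintro (⟨h2, -⟩ | ⟨-, h2⟩)
      · exact absurd hlt h2.not_gt
      · linarith
  · have h1 : 0 < Y u - Y v := sub_pos.2 hgt
    rw [div_lt_iff₀ h1]
    constructor
    · intro hh; exact Or.inl ⟨hgt, by linarith⟩
    · rintro (⟨-, h2⟩ | ⟨h2, -⟩)
      · linarith
      · exact absurd hgt h2.not_gt

theorem inner_slopeDir_ne (κ : ℝ) {u v : ℕ} (hY : Y u ≠ Y v)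
    (hκ : (X u - X v) / (Y u - Y v) ≠ κ) :
    inner ℝ (slopeDir κ) (coordPoint X Y u) ≠ inner ℝ (slopeDir κ) (coordPoint X Y v) := by
  have h : 0 < Real.sqrt (1 + κ * κ) := Real.sqrt_pos.2 (by nlinarith [mul_self_nonneg κ])
  rw [inner_coordPoint, inner_coordPoint]
  have e : ∀ i, slopeDir κ 0 * X i + slopeDir κ 1 * Y i = (X i - κ * Y i) / Real.sqrt (1 + κ * κ) := by
    intro i; simp [slopeDir]; field_simp; ring
  rw [e, e, Ne, div_left_inj' h.ne']
  intro hh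
  apply hκ
  rw [div_eq_iff (sub_ne_zero.2 hY)]
  linarith

open Classical in
theorem countP_slopeDir (h : IsNumbering K n X Y) {κ : ℝ} {D : DgmData}
    (hD : StoresDiagram K (slopeDir κ) D) {v : ℕ} (hv : v < n)
    (hκ : ∀ u < n, u ≠ v → (X u - X v) / (Y u - Y v) ≠ κ) :
    (D.byDeath 0).countP
          (fun x => x.2 = ((inner ℝ (slopeDir κ) (coordPoint X Y v) : ℝ) : WithTop ℝ)) +
        (D.byBirth 1).countP (fun x => x.1 = inner ℝ (slopeDir κ) (coordPoint X Y v)) =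
      {u | u ∈ ups K n X Y v ∧ (X u - X v) / (Y u - Y v) < κ}.ncard +
      {u | u ∈ downs K n X Y v ∧ κ < (X u - X v) / (Y u - Y v)}.ncard := by
  rw [h.countP_eq hD hv fun u hu huv =>
    inner_slopeDir_ne κ (fun he => huv (h.height_inj hu hv he)) (hκ u hu huv)]
  congr 2
  · ext u
    refine and_congr_right fun hu => ?_
    have hlt : Y v < Y u := hu.2.2.1
    rw [inner_slopeDir_lt κ hlt.ne']
    simp [hlt, hlt.not_gt]
  · ext u
    refine and_congr_right fun hu => ?_
    have hlt : Y u < Y v := hu.2.2.1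
    rw [inner_slopeDir_lt κ hlt.ne]
    simp [hlt, hlt.not_gt]

open Classical in
-- Downwards, the higher endpoint of an edge is its lower one in the usual sense, so exactly the
-- up-edges of `v` have the height of `v`.
theorem countP_down (h : IsNumbering K n X Y) {D : DgmData}
    (hD : StoresDiagram K !₂[0, -1] D) {v : ℕ} (hv : v < n) :
    (D.byDeath 0).countP
          (fun x => x.2 = ((inner ℝ (!₂[0, -1] : Plane) (coordPoint X Y v) : ℝ) : WithTop ℝ)) +
        (D.byBirth 1).countP (fun x => x.1 = inner ℝ (!₂[0, -1] : Plane) (coordPoint X Y v)) =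
      (ups K n X Y v).ncard := by
  have e : ∀ i, inner ℝ (!₂[0, -1] : Plane) (coordPoint X Y i) = - Y i := by
    intro i; rw [inner_coordPoint]; simp
  rw [h.countP_eq hD hv fun u hu huv => by
    rw [e, e, Ne, neg_inj]; exact fun he => huv (h.height_inj hu hv he)]
  have e1 : {u | u ∈ ups K n X Y v ∧ inner ℝ (!₂[0, -1] : Plane) (coordPoint X Y u) <
      inner ℝ (!₂[0, -1] : Plane) (coordPoint X Y v)} = ups K n X Y v := by
    ext u
    refine and_iff_left_of_imp fun hu => ?_
    rw [e, e]; exact neg_lt_neg hu.2.2.1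
  have e2 : {u | u ∈ downs K n X Y v ∧ inner ℝ (!₂[0, -1] : Plane) (coordPoint X Y u) <
      inner ℝ (!₂[0, -1] : Plane) (coordPoint X Y v)} = ∅ := by
    refine Set.eq_empty_of_forall_notMem ?_
    rintro u ⟨hu, hlt⟩
    rw [e, e, neg_lt_neg_iff] at hlt
    exact absurd hlt hu.2.2.1.not_gt
  rw [e1, e2, Set.ncard_empty, add_zero]

end IsNumbering

/-! ### Approximate medians by thinning -/

open Classical in
/-- The number of entries with values at most `x` in the segment of length `len` from `lo`. -/
def cnt (a : ℕ → ℝ) (lo len : ℕ) (x : ℝ) : ℕ := Nat.count (fun i => a (lo + i) ≤ x) len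

theorem cnt_le (a : ℕ → ℝ) (lo len : ℕ) (x : ℝ) : cnt a lo len x ≤ len := Nat.count_le _

theorem cnt_add (a : ℕ → ℝ) (lo m n : ℕ) (x : ℝ) :
    cnt a lo (m + n) x = cnt a lo m x + cnt a (lo + m) n x := by
  simp only [cnt, Nat.count_add, add_assoc]

theorem cnt_mul (a : ℕ → ℝ) (lo m b : ℕ) (x : ℝ) :
    cnt a lo (m * b) x = ∑ r ∈ Finset.range m, cnt a (lo + r * b) b x := by
  induction m with
  | zero => simp [cnt]
  | succ m ih => rw [Nat.succ_mul, cnt_add, ih, Finset.sum_range_succ]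

theorem cnt_congr {a b : ℕ → ℝ} {lo lo' len : ℕ} (h : ∀ i < len, a (lo + i) = b (lo' + i)) (x : ℝ) :
    cnt a lo len x = cnt b lo' len x := by
  classical
  simp only [cnt, Nat.count_eq_card_filter_range]
  congr 1
  refine Finset.filter_congr fun i hi => ?_
  rw [h i (Finset.mem_range.1 hi)]

/-- In a segment with distinct entries, the ranks of the entries with values at most `x` are
`1, …, cnt a lo len x`. -/
theorem card_filter_rank (a : ℕ → ℝ) (lo len : ℕ)
    (hinj : ∀ i < len, ∀ j < len, a (lo + i) = a (lo + j) → i = j) (x : ℝ) (p : ℕ → Prop)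
    [DecidablePred p] [DecidablePred fun i => p (cnt a lo len (a (lo + i))) ∧ a (lo + i) ≤ x] :
    Nat.count (fun i => p (cnt a lo len (a (lo + i))) ∧ a (lo + i) ≤ x) len =
      ((Finset.Icc 1 (cnt a lo len x)).filter p).card := by
  classical
  set rk : ℕ → ℕ := fun i => cnt a lo len (a (lo + i))
  set A := (Finset.range len).filter fun i => a (lo + i) ≤ x
  have hcard : ∀ y, cnt a lo len y = ((Finset.range len).filter fun i => a (lo + i) ≤ y).card := by
    intro y; simp only [cnt, Nat.count_eq_card_filter_range]
  have hlt : ∀ i < len, ∀ j < len, a (lo + i) < a (lo + j) → rk i < rk j := by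
    intro i hi j hj hij
    simp only [rk, hcard]
    refine Finset.card_lt_card (Finset.ssubset_iff_of_subset ?_ |>.2 ⟨j, ?_, ?_⟩)
    · intro k hk
      simp only [Finset.mem_filter] at hk ⊢
      exact ⟨hk.1, hk.2.trans hij.le⟩
    · simp [hj]
    · simp [hij]
  have hmaps : Set.InjOn rk A := by
    intro i hi j hj hij
    simp only [A, Finset.coe_filter, Finset.mem_range, Set.mem_ofPred_eq] at hi hj
    rcases lt_trichotomy (a (lo + i)) (a (lo + j)) with h | h | h
    · exact absurd hij (hlt i hi.1 j hj.1 h).ne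
    · exact hinj i hi.1 j hj.1 h
    · exact absurd hij (hlt j hj.1 i hi.1 h).ne'
  have himg : A.image rk = Finset.Icc 1 (cnt a lo len x) := by
    refine Finset.eq_of_subset_of_card_le ?_ ?_
    · intro r hr
      obtain ⟨i, hi, rfl⟩ := Finset.mem_image.1 hr
      simp only [A, Finset.mem_filter, Finset.mem_range] at hi
      simp only [Finset.mem_Icc, rk, hcard]
      constructor
      · exact Finset.card_pos.2 ⟨i, by simp [hi.1]⟩
      · refine Finset.card_le_card fun k hk => ?_
        simp only [Finset.mem_filter] at hk ⊢
        exact ⟨hk.1, hk.2.trans hi.2⟩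
    · rw [Finset.card_image_of_injOn hmaps, Nat.card_Icc, hcard]
      simp [A]
  rw [← himg, Finset.filter_image, Finset.card_image_of_injOn, Nat.count_eq_card_filter_range]
  · congr 1
    ext i
    simp only [A, Finset.mem_filter]
    tauto
  · exact hmaps.mono fun i hi => (Finset.mem_filter.1 hi).1

/-- Entries up to `x` have the ranks `1, …, c`, and `c / 4` of these numbers are divisible by `4`.
-/
theorem count_dvd_rank (a : ℕ → ℝ) (lo len : ℕ)
    (hinj : ∀ i < len, ∀ j < len, a (lo + i) = a (lo + j) → i = j) (x : ℝ)
    [DecidablePred fun i => 4 ∣ cnt a lo len (a (lo + i)) ∧ a (lo + i) ≤ x] :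
    Nat.count (fun i => 4 ∣ cnt a lo len (a (lo + i)) ∧ a (lo + i) ≤ x) len =
      cnt a lo len x / 4 := by
  rw [card_filter_rank a lo len hinj x (4 ∣ ·)]
  exact Nat.Ioc_filter_dvd_card_eq_div (cnt a lo len x) 4

theorem exists_rank_eq (a : ℕ → ℝ) (lo len : ℕ)
    (hinj : ∀ i < len, ∀ j < len, a (lo + i) = a (lo + j) → i = j) {r : ℕ} (hr : 1 ≤ r)
    (hr' : r ≤ len) : ∃ i < len, cnt a lo len (a (lo + i)) = r := by
  classical
  obtain ⟨x, hx⟩ : ∃ x, ∀ i < len, a (lo + i) ≤ x := by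
    obtain ⟨x, hx⟩ := ((Finset.range len).image fun i => a (lo + i)).bddAbove
    exact ⟨x, fun i hi => hx (by simpa using ⟨i, hi, rfl⟩)⟩
  have h1 : cnt a lo len x = len := Nat.count_iff_forall.2 hx
  have h := card_filter_rank a lo len hinj x (· = r)
  rw [h1, Finset.filter_eq', if_pos (Finset.mem_Icc.2 ⟨hr, hr'⟩), Finset.card_singleton] at h
  have h2 : Nat.count (fun i => cnt a lo len (a (lo + i)) = r ∧ a (lo + i) ≤ x) len ≠ 0 := by omega
  obtain ⟨i, hi, h3⟩ := Nat.count_ne_iff_exists.1 h2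
  exact ⟨i, hi, h3.1⟩

/-- The rank of the entry `i` within its block of length `g` is divisible by `4`. -/
def Keep (a : ℕ → ℝ) (g i : ℕ) : Prop := 4 ∣ cnt a (g * (i / g)) g (a i)

open Classical in
-- Moving the kept entries to consecutive positions, in their order, turns prefixes of the old
-- sequence into prefixes of the new one.
theorem count_compress {a b : ℕ → ℝ} {keep : ℕ → Prop} [DecidablePred keep] {M : ℕ}
    (hb : ∀ i < M, keep i → b (Nat.count keep i) = a i) (x : ℝ) {k : ℕ} (hk : k ≤ M) :
    Nat.count (fun j => b j ≤ x) (Nat.count keep k) =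
      Nat.count (fun i => keep i ∧ a i ≤ x) k := by
  induction k with
  | zero => simp
  | succ k ih =>
    rw [Nat.count_succ (fun i => keep i ∧ a i ≤ x), ← ih (by omega), Nat.count_succ keep]
    by_cases h : keep k
    · simp only [h, if_true, true_and, Nat.count_succ, hb k (by omega) h]
    · simp [h]

theorem exists_of_lt_count {p : ℕ → Prop} [DecidablePred p] {i M : ℕ} (hi : i < Nat.count p M) :
    ∃ k < M, p k ∧ Nat.count p k = i :=
  ⟨Nat.nth p i, Nat.nth_lt_of_lt_count hi,
    Nat.nth_mem i fun hf => hi.trans_le (Nat.count_le_card hf M),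
    Nat.count_nth fun hf => hi.trans_le (Nat.count_le_card hf M)⟩

/-! ### One round of thinning and the approximation error -/

section Level

variable {a b : ℕ → ℝ} {g M : ℕ}

open Classical in
theorem count_keep_block (hg : 0 < g) (hinj : ∀ i < M, ∀ j < M, a i = a j → i = j) {β : ℕ}
    (hβ : (β + 1) * g ≤ M) (x : ℝ) :
    Nat.count (fun i => Keep a g (β * g + i) ∧ a (β * g + i) ≤ x) g = cnt a (β * g) g x / 4 := by
  rw [← count_dvd_rank a (β * g) g (fun i hi j hj h => by
    have := hinj (β * g + i) (by rw [Nat.succ_mul] at hβ; omega) (β * g + j)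
      (by rw [Nat.succ_mul] at hβ; omega) h
    omega) x]
  simp only [Nat.count_eq_card_filter_range]
  congr 1
  refine Finset.filter_congr fun i hi => ?_
  have h1 : (β * g + i) / g = β := by
    rw [mul_comm, Nat.mul_add_div hg, Nat.div_eq_of_lt (Finset.mem_range.1 hi), add_zero]
  rw [Keep, h1, mul_comm g β]

open Classical in
-- Every block keeps exactly a quarter of its entries, so the thinned sequence again consists of
-- equally long, aligned blocks.
theorem count_keep_mul (hg : 0 < g) (hg4 : 4 ∣ g) (hinj : ∀ i < M, ∀ j < M, a i = a j → i = j)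
    {β : ℕ} (hβ : β * g ≤ M) : Nat.count (Keep a g) (β * g) = β * (g / 4) := by
  induction β with
  | zero => simp
  | succ β ih =>
    obtain ⟨x, hx⟩ : ∃ x, ∀ i < M, a i ≤ x := by
      obtain ⟨x, hx⟩ := ((Finset.range M).image a).bddAbove
      exact ⟨x, fun i hi => hx (by simpa using ⟨i, hi, rfl⟩)⟩
    have hβ' : β * g + g ≤ M := by rw [Nat.succ_mul] at hβ; exact hβ
    have h1 := count_keep_block hg hinj hβ x
    have h2 : cnt a (β * g) g x = g := Nat.count_iff_forall.2 fun i hi => hx _ (by omega)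
    rw [h2] at h1
    have h3 : Nat.count (fun i => Keep a g (β * g + i)) g = g / 4 := by
      rw [← h1]
      simp only [Nat.count_eq_card_filter_range]
      congr 1
      refine Finset.filter_congr fun i hi => ?_
      rw [Finset.mem_range] at hi
      simp [hx (β * g + i) (by omega)]
    rw [Nat.succ_mul, Nat.count_add, ih (by omega), h3, Nat.succ_mul]

open Classical in
/-- Thinning divides the counts of every block by `4`. -/
theorem cnt_thin (hg : 0 < g) (hg4 : 4 ∣ g) (hinj : ∀ i < M, ∀ j < M, a i = a j → i = j)
    (hb : ∀ i < M, Keep a g i → b (Nat.count (Keep a g) i) = a i) {β : ℕ}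
    (hβ : (β + 1) * g ≤ M) (x : ℝ) :
    cnt b (β * (g / 4)) (g / 4) x = cnt a (β * g) g x / 4 := by
  have hβ' : β * g + g ≤ M := by rw [Nat.succ_mul] at hβ; exact hβ
  have h1 := count_compress hb x (k := β * g) (by omega)
  have h2 := count_compress hb x (k := (β + 1) * g) hβ
  rw [count_keep_mul hg hg4 hinj hβ, Nat.succ_mul β (g / 4), Nat.succ_mul β g, Nat.count_add,
    Nat.count_add, count_keep_block hg hinj hβ] at h2
  rw [count_keep_mul hg hg4 hinj (by omega)] at h1
  unfold cnt at *
  omega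

open Classical in
theorem thin_inj (hinj : ∀ i < M, ∀ j < M, a i = a j → i = j)
    (hb : ∀ i < M, Keep a g i → b (Nat.count (Keep a g) i) = a i) :
    ∀ i < Nat.count (Keep a g) M, ∀ j < Nat.count (Keep a g) M, b i = b j → i = j := by
  intro i hi j hj hij
  obtain ⟨k, hk, h1, rfl⟩ := exists_of_lt_count hi
  obtain ⟨l, hl, h2, rfl⟩ := exists_of_lt_count hj
  rw [hb k hk h1, hb l hl h2] at hij
  rw [hinj k hk l hl hij]

/-- The sequence `a` approximates `a₀` after `j` rounds of thinning. -/
def IsThinned (a₀ a : ℕ → ℝ) (k j : ℕ) : Prop :=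
  ∀ β < 8 ^ (k - j), ∀ x,
    4 ^ j * cnt a (β * (2 * 2 ^ j)) (2 * 2 ^ j) x ≤ cnt a₀ (β * (2 * 8 ^ j)) (2 * 8 ^ j) x ∧
    4 * cnt a₀ (β * (2 * 8 ^ j)) (2 * 8 ^ j) x + 3 * 4 ^ j ≤
      4 * 4 ^ j * cnt a (β * (2 * 2 ^ j)) (2 * 2 ^ j) x + 3 * 8 ^ j

theorem isThinned_zero (a₀ : ℕ → ℝ) (k : ℕ) : IsThinned a₀ a₀ k 0 := by
  intro β _ x; simp

open Classical in
-- After `j` rounds an entry stands for `4 ^ j` original ones, and a count is too small by at most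
-- `e_j = (3 / 4) * (8 ^ j - 4 ^ j)`; the definition is this bound multiplied by 4. Merging eight
-- blocks adds up eight errors, and rounding down to a multiple of 4 loses at most three entries of
-- weight `4 ^ j`. Indeed `e_{j+1} = 8 * e_j + 3 * 4 ^ j`.
theorem IsThinned.succ {a₀ : ℕ → ℝ} {k j : ℕ} (h : IsThinned a₀ a k j) (hj : j < k)
    (hM : M = 8 ^ (k - j) * (2 * 2 ^ j)) (hinj : ∀ i < M, ∀ i' < M, a i = a i' → i = i')
    (hb : ∀ i < M, Keep a (16 * 2 ^ j) i → b (Nat.count (Keep a (16 * 2 ^ j)) i) = a i) :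
    IsThinned a₀ b k (j + 1) := by
  intro β hβ x
  have hkj : k - j = (k - (j + 1)) + 1 := by omega
  have hg : 0 < 16 * 2 ^ j := by positivity
  have hg4 : 4 ∣ 16 * 2 ^ j := ⟨4 * 2 ^ j, by ring⟩
  have hgd : 16 * 2 ^ j / 4 = 2 * 2 ^ (j + 1) := by
    rw [pow_succ]; omega
  have hMβ : (β + 1) * (16 * 2 ^ j) ≤ M := by
    rw [hM, hkj, pow_succ]
    calc (β + 1) * (16 * 2 ^ j) ≤ 8 ^ (k - (j + 1)) * (16 * 2 ^ j) := Nat.mul_le_mul_right _ hβ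
      _ = _ := by ring
  have h1 := cnt_thin hg hg4 hinj hb hMβ x
  rw [hgd] at h1
  have h2 : cnt a (β * (16 * 2 ^ j)) (16 * 2 ^ j) x =
      ∑ r ∈ Finset.range 8, cnt a ((8 * β + r) * (2 * 2 ^ j)) (2 * 2 ^ j) x := by
    rw [show 16 * 2 ^ j = 8 * (2 * 2 ^ j) by ring, cnt_mul]
    exact Finset.sum_congr rfl fun r _ => by congr 1; ring
  have h3 : cnt a₀ (β * (2 * 8 ^ (j + 1))) (2 * 8 ^ (j + 1)) x =
      ∑ r ∈ Finset.range 8, cnt a₀ ((8 * β + r) * (2 * 8 ^ j)) (2 * 8 ^ j) x := by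
    rw [show 2 * 8 ^ (j + 1) = 8 * (2 * 8 ^ j) by ring, cnt_mul]
    exact Finset.sum_congr rfl fun r _ => by congr 1; ring
  have hr : ∀ r ∈ Finset.range 8, 8 * β + r < 8 ^ (k - j) := by
    intro r hr
    rw [Finset.mem_range] at hr
    rw [hkj, pow_succ]; omega
  have h4 := Finset.sum_le_sum fun r hr' => (h (8 * β + r) (hr r hr') x).1
  have h5 := Finset.sum_le_sum fun r hr' => (h (8 * β + r) (hr r hr') x).2
  simp only [Finset.sum_add_distrib, ← Finset.mul_sum, Finset.sum_const, Finset.card_range,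
    smul_eq_mul] at h4 h5
  rw [← h2, ← h3] at h4 h5
  rw [h1]
  set c := cnt a (β * (16 * 2 ^ j)) (16 * 2 ^ j) x
  set o := cnt a₀ (β * (2 * 8 ^ (j + 1))) (2 * 8 ^ (j + 1)) x
  have h6 : 4 * (c / 4) ≤ c := by omega
  have h7 : c ≤ 4 * (c / 4) + 3 := by omega
  have h8 := Nat.mul_le_mul_left (4 ^ j) h6
  have h9 := Nat.mul_le_mul_left (4 ^ j) h7
  constructor
  · calc 4 ^ (j + 1) * (c / 4) = 4 ^ j * (4 * (c / 4)) := by ring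
      _ ≤ o := h8.trans h4
  · have e1 : 4 * 4 ^ (j + 1) * (c / 4) = 4 * (4 ^ j * (4 * (c / 4))) := by ring
    have e2 : 4 * 4 ^ j * c = 4 * (4 ^ j * c) := by ring
    have e3 : 4 ^ j * (4 * (c / 4) + 3) = 4 ^ j * (4 * (c / 4)) + 3 * 4 ^ j := by ring
    rw [e1]
    rw [e2] at h5
    rw [e3] at h9
    rw [pow_succ 4 j, pow_succ 8 j]
    omega

/-- An entry of middle rank after complete thinning splits the original sequence evenly. -/
theorem IsThinned.split {a₀ : ℕ → ℝ} {k N : ℕ} (h : IsThinned a₀ a k k) (hN : 2 * 8 ^ k ≤ N)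
    (hN' : N < 16 * 8 ^ k) {x : ℝ} (hx : cnt a 0 (2 * 2 ^ k) x = 2 ^ k) :
    N ≤ 64 * cnt a₀ 0 N x ∧ N ≤ 64 * (N - cnt a₀ 0 N x) := by
  have h1 := h 0 (by simp) x
  simp only [zero_mul, hx] at h1
  obtain ⟨h1, h2⟩ := h1
  have e : 4 ^ k * 2 ^ k = 8 ^ k := by rw [← mul_pow]; norm_num
  rw [e] at h1
  rw [mul_assoc, e] at h2
  obtain ⟨m, rfl⟩ := Nat.exists_eq_add_of_le hN
  have h3 := cnt_add a₀ 0 (2 * 8 ^ k) m x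
  have h4 := cnt_le a₀ (0 + 2 * 8 ^ k) m x
  -- Among the first `2 * 8 ^ k` entries at least `8 ^ k` and at most `(7 / 4) * 8 ^ k` are counted,
  -- so at least `8 ^ k / 4` lie above `x`. As `N < 16 * 8 ^ k`, this exceeds `N / 64`, whatever the
  -- entries outside this prefix are.
  omega

end Level

namespace RealRAM

variable {O : Plane → DgmData} {q : ℕ} {quiet : Prop} {X : List Var} {s s' : State}

/-! ### The program for approximate medians -/

/-- The inverse slope of the line through the vertex `v` and the candidate number `j`. -/
def State.skey (st : State) (j : ℕ) : ℝ := st.key (st.F .v 0) (st.F .S j)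

/-- The inverse slope of the line through the vertex `v` and the candidate number `j`. -/
def keyS (j : NExpr) : RExpr := keye (gv .v) (ld .S j)

@[simp] theorem keyS_eval (st : State) (j : NExpr) : (keyS j).eval st = st.skey (j.eval st) := by
  simp [keyS, State.skey]

theorem Pres.skey (h : Pres quiet X s s') (hv : Var.v ∉ X) (hS : Var.S ∉ X) : s'.skey = s.skey := by
  funext j; simp [State.skey, h.key, h.F _ hv, h.F _ hS]

/-- The number of candidates in a segment with inverse slopes at most that of the candidate `e`. -/
def rankProg (start len e : NExpr) : Prog :=
  .seq (sv .r (.const 0)) (forLoop .b len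
    (.ite (.not (.realLt (keyS e) (keyS (.add start (gv .b))))) (sv .r (.add (gv .r) (.const 1))) .skip))

theorem Does.rank (start len e : NExpr) : ∃ C : ℝ, 0 ≤ C ∧
    ∀ (O : Plane → DgmData) (q : ℕ) (st : State) (lo n i : ℕ),
    (∀ s, Pres True [.r, .b] st s → start.eval s = lo ∧ len.eval s = n ∧ e.eval s = i) →
    Does O q (rankProg start len e) st (C * (n + 1)) (fun s => Pres True [.r, .b] st s ∧
      s.F .r 0 = cnt st.skey lo n (st.skey i)) := by
  set body : Prog :=
    .ite (.not (.realLt (keyS e) (keyS (.add start (gv .b))))) (sv .r (.add (gv .r) (.const 1))) .skip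
    with hbody
  refine ⟨(sv .r (.const 0)).time + (body.time + forCost .b len),
    by have := forCost_nonneg .b len; positivity, fun O q st lo n i h => ?_⟩
  have t0 : (0 : ℝ) ≤ body.time := Nat.cast_nonneg _
  have t1 := forCost_nonneg .b len
  have t2 : (0 : ℝ) ≤ (sv .r (.const 0)).time := Nat.cast_nonneg _
  refine Does.step (Does.simple (sv_simple _ _) (R := fun s => s = st.set .r 0 0)
    (by simp [NExpr.eval])) ?_
  rintro _ rfl
  have P0 : Pres True [.r, .b] st (st.set .r 0 0) := (Pres.refl st).set (by simp) _ _
  have hext : ∀ {s}, Pres True [.b, .r] (st.set .r 0 0) s → Pres True [.r, .b] st s := fun h' =>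
    P0.trans (h'.mono (by simp) id)
  refine (Does.forSimple (X := [.r]) n (fun k s => s.F .r 0 = cnt st.skey lo k (st.skey i))
    (by simp) (by simp [Prog.Simple]) ?_ ?_ ?_).mono ?_ ?_
  · simp [cnt]
  · exact fun s hs => (h s (hext hs)).2.1
  · intro k s hk hs hb hr
    have hP := hext hs
    obtain ⟨e1, e2, e3⟩ := h s hP
    have e4 : s.skey = st.skey := hP.skey (by simp) (by simp)
    have hstep : cnt st.skey lo (k + 1) (st.skey i) =
        cnt st.skey lo k (st.skey i) + if st.skey (lo + k) ≤ st.skey i then 1 else 0 := by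
      rw [cnt, Nat.count_succ]; rfl
    simp only [Prog.run, Test.eval, keyS_eval, NExpr.eval, e1, e3, gv_eval, hb, e4, not_lt,
      sv_run, hr]
    rw [hstep]
    split_ifs with hc
    · exact ⟨(Pres.refl s).set (by simp) _ _, by simp⟩
    · exact ⟨Pres.refl s, by simp [hr]⟩
  · have : (0 : ℝ) ≤ n := Nat.cast_nonneg _
    nlinarith
  · exact fun s hs => ⟨hext hs.1, hs.2⟩

/-- The remainder modulo `4` of the variable `r` is positive. -/
def remTest : Test := .natLt (.const 0) (.sub (gv .r) (NExpr.half (.half (gv .r))).dbl.dbl)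

theorem remTest_eval (st : State) : remTest.eval st ↔ ¬ 4 ∣ st.F .r 0 := by
  simp only [remTest, Test.eval, NExpr.eval, NExpr.eval_dbl, gv_eval]
  omega

/-- Treatment of one entry in a round of thinning. -/
def thinStep : Prog :=
  .seq (.ite (.natLt (gv .a) (.add (gv .bs) (gv .g))) .skip (sv .bs (.add (gv .bs) (gv .g))))
    (.seq (rankProg (.add (gv .lo) (gv .bs)) (gv .g) (.add (gv .lo) (gv .a)))
      (.ite remTest .skip
        (.seq (sto .S (gv .o) (ld .S (.add (gv .lo) (gv .a)))) (sv .o (.add (gv .o) (.const 1))))))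

/-- One round of thinning. -/
def thinRound : Prog :=
  .seq (.seq (sv .bs (.const 0)) (sv .hi (gv .o)))
    (.seq (forLoop .a (gv .M) thinStep)
      (.seq (sv .lo (gv .hi)) (.seq (sv .M (.sub (gv .o) (gv .hi))) (sv .g (gv .g).dbl))))

/-- The arrays changed by the search for an approximate median. -/
def pivotVars : List Var := [.S, .a, .r, .b, .bs, .hi, .lo, .M, .g, .o, .p]

open Classical in
-- The machine has no general division, so the start of the current block is maintained in `bs`: it
-- still belongs to the entry `k - 1` and is advanced by `g` when `k` enters the next block. For `k
-- = 0` the truncated `k - 1` gives the correct start `0`.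
theorem Does.thinStep : ∃ C : ℝ, 0 ≤ C ∧
    ∀ (O : Plane → DgmData) (q : ℕ) (st : State) (a : ℕ → ℝ) (lo g k : ℕ),
    st.F .lo 0 = lo → st.F .g 0 = g → 0 < g → st.F .a 0 = k → st.F .bs 0 = g * ((k - 1) / g) →
    (∀ i < g * (k / g) + g, st.skey (lo + i) = a i) →
    Does O q thinStep st (C * (g + 1)) (fun s => Pres True [.r, .b, .bs, .o, .S] st s ∧
      s.F .bs 0 = g * (k / g) ∧
      s.F .o 0 = st.F .o 0 + (if Keep a g k then 1 else 0) ∧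
      s.F .S = if Keep a g k then
        (st.set .S (st.F .o 0) (st.F .S (lo + k))).F .S else st.F .S) := by
  obtain ⟨C, hC, H⟩ := Does.rank (.add (gv .lo) (gv .bs)) (gv .g) (.add (gv .lo) (gv .a))
  set P₁ : Prog := .ite (.natLt (gv .a) (.add (gv .bs) (gv .g))) .skip (sv .bs (.add (gv .bs) (gv .g)))
    with hP₁
  set P₃ : Prog := .ite remTest .skip
        (.seq (sto .S (gv .o) (ld .S (.add (gv .lo) (gv .a)))) (sv .o (.add (gv .o) (.const 1))))
    with hP₃
  refine ⟨C + P₁.time + P₃.time, by positivity, ?_⟩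
  intro O q st a lo g k hlo hg hg0 ha hbs hkey
  have hdiv : (if k < g * ((k - 1) / g) + g then g * ((k - 1) / g) else g * ((k - 1) / g) + g) =
      g * (k / g) := by
    have h1 := Nat.div_add_mod (k - 1) g
    have h2 := Nat.mod_lt (k - 1) hg0
    set d := (k - 1) / g
    split_ifs with hc
    · rw [show k / g = d from ?_]
      rw [Nat.div_eq_iff hg0]
      constructor
      · rw [mul_comm]; omega
      · rw [mul_comm]; omega
    · rw [show k / g = d + 1 from ?_, Nat.mul_succ]
      rw [Nat.div_eq_iff hg0]
      constructor
      · rw [mul_comm, Nat.mul_succ]; omega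
      · rw [mul_comm, Nat.mul_succ]; omega
  set s1 := st.set .bs 0 (g * (k / g)) with hs1
  have hP1 : P₁.run st = st ∧ g * ((k - 1) / g) = g * (k / g) ∨ P₁.run st = s1 := by
    simp only [hP₁, Prog.run, Test.eval, NExpr.eval, gv_eval, ha, hbs, hg, sv_run]
    rw [hs1, ← hdiv]
    split_ifs <;> simp
  refine Does.step (Does.simple (by simp [Prog.Simple])
    (R := fun s => Pres True [.bs] st s ∧ s.F .bs 0 = g * (k / g)) ?_) ?_
  · rcases hP1 with ⟨h1, h2⟩ | h1
    · rw [h1]; exact ⟨Pres.refl _, by rw [hbs, h2]⟩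
    · rw [h1]; exact ⟨(Pres.refl _).set (by simp) _ _, by simp [hs1]⟩
  rintro s2 ⟨hp2, hb2⟩
  have e1 : s2.skey = st.skey := hp2.skey (by simp) (by simp)
  refine Does.step (H O q s2 (lo + g * (k / g)) g (lo + k) ?_) ?_
  · intro s hs
    have h1 : ∀ x, x ∉ [Var.r, .b, .bs] → s.F x = st.F x := fun x hx => by
      rw [hs.F x (by simp at hx ⊢; tauto), hp2.F x (by simp at hx ⊢; tauto)]
    simp [NExpr.eval, h1, hlo, hg, ha, hs.F .bs (by simp), hb2]
  rintro s3 ⟨hp3, hr3⟩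
  have hr : s3.F .r 0 = cnt a (g * (k / g)) g (a k) := by
    rw [hr3, e1, hkey k (by
      have := Nat.div_add_mod k g
      have := Nat.mod_lt k hg0
      omega)]
    refine cnt_congr (fun i hi => ?_) _
    rw [add_assoc, hkey _ (by omega)]
  have hF3 : ∀ x, x ∉ [Var.r, .b, .bs] → s3.F x = st.F x := fun x hx => by
    rw [hp3.F x (by simp at hx ⊢; tauto), hp2.F x (by simp at hx ⊢; tauto)]
  have hpres : Pres True [.r, .b, .bs, .o, .S] st s3 :=
    (hp2.mono (by simp) id).trans (hp3.mono (by simp) id)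
  have hbs3 : s3.F .bs 0 = g * (k / g) := by rw [hp3.F _ (by simp), hb2]
  refine (Does.simple (by simp [Prog.Simple]) (R := fun s =>
    Pres True [.r, .b, .bs, .o, .S] st s ∧
      s.F .bs 0 = g * (k / g) ∧
      s.F .o 0 = st.F .o 0 + (if Keep a g k then 1 else 0) ∧
      s.F .S = if Keep a g k then
        (st.set .S (st.F .o 0) (st.F .S (lo + k))).F .S else st.F .S) ?_).mono ?_ fun _ h => h
  · simp only [Prog.run, remTest_eval, hr]
    by_cases hk : Keep a g k
    · have hk' : 4 ∣ cnt a (g * (k / g)) g (a k) := hk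
      simp only [hk, hk', not_true_eq_false, if_false, if_true, sto_run, sv_run]
      refine ⟨(hpres.set (by simp) _ _).set (by simp) _ _, by simpa using hbs3, ?_, ?_⟩
      · simp [NExpr.eval, hF3]
      · simp only [NExpr.eval, ld_eval, gv_eval]
        funext j
        simp [State.set_F_same, hF3, hlo, ha]
    · have hk' : ¬ 4 ∣ cnt a (g * (k / g)) g (a k) := hk
      simp only [hk, hk', not_false_eq_true, if_true, if_false]
      exact ⟨hpres, hbs3, by simp [hF3], hF3 _ (by simp)⟩
  · have t1 : (0 : ℝ) ≤ P₁.time := Nat.cast_nonneg _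
    have t2 : (0 : ℝ) ≤ P₃.time := Nat.cast_nonneg _
    have t3 : (0 : ℝ) ≤ g := Nat.cast_nonneg _
    nlinarith

open Classical in
-- Survivors are appended at position `o`, behind everything in use, so the original candidates
-- remain intact. Each rank is found by scanning a block of length `g`, hence a cost of order `M *
-- g`.
theorem Does.thinRound : ∃ C : ℝ, 0 ≤ C ∧
    ∀ (O : Plane → DgmData) (q : ℕ) (st : State) (lo g M o : ℕ),
    st.F .lo 0 = lo → st.F .g 0 = g → st.F .M 0 = M → st.F .o 0 = o → 0 < g → g ∣ M → lo + M ≤ o →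
    Does O q thinRound st (C * (M * (g + 1) + 1)) (fun s => Pres True pivotVars st s ∧
      s.F .lo 0 = o ∧ s.F .g 0 = 2 * g ∧
      s.F .M 0 = Nat.count (Keep (fun i => st.skey (lo + i)) g) M ∧
      s.F .o 0 = o + Nat.count (Keep (fun i => st.skey (lo + i)) g) M ∧
      (∀ i < o, s.F .S i = st.F .S i) ∧
      ∀ i < M, Keep (fun i => st.skey (lo + i)) g i →
        s.F .S (o + Nat.count (Keep (fun i => st.skey (lo + i)) g) i) = st.F .S (lo + i)) := by
  obtain ⟨C, hC, H⟩ := Does.thinStep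
  set P₁ : Prog := .seq (sv .bs (.const 0)) (sv .hi (gv .o)) with hP₁
  set P₃ : Prog := .seq (sv .lo (gv .hi)) (.seq (sv .M (.sub (gv .o) (gv .hi))) (sv .g (gv .g).dbl))
    with hP₃
  have t0 := forCost_nonneg .a (gv .M)
  refine ⟨C + forCost .a (gv .M) + P₁.time + P₃.time, by positivity, ?_⟩
  intro O q st lo g M o hlo hg hM ho hg0 hgM hloM
  set a : ℕ → ℝ := fun i => st.skey (lo + i) with ha
  set s1 := (st.set .bs 0 0).set .hi 0 o with hs1
  refine Does.step (Does.simple (by simp [Prog.Simple])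
    (R := fun s => s = s1) (by simp [Prog.run, hs1, NExpr.eval, ho])) ?_
  rintro _ rfl
  have hP1 : Pres True pivotVars st s1 :=
    ((Pres.refl st).set (by simp [pivotVars]) _ _).set (by simp [pivotVars]) _ _
  let Inv : ℕ → State → Prop := fun k s => s.F .bs 0 = g * ((k - 1) / g) ∧
    s.F .o 0 = o + Nat.count (Keep a g) k ∧ (∀ i < o, s.F .S i = st.F .S i) ∧
      ∀ i < k, Keep a g i → s.F .S (o + Nat.count (Keep a g) i) = st.F .S (lo + i)
  refine Does.step (Does.for (quiet := True) (X := [.r, .b, .bs, .o, .S]) M (fun _ => C * (g + 1)) Inv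
    (by simp) (fun _ => by positivity) ?_ ?_ ?_) ?_
  · refine ⟨by simp [hs1], by simp [hs1, ho], by simp [hs1], by simp⟩
  · intro s hs
    simp [hs.F .M (by simp), hs1, hM]
  · rintro k s hk hs hka ⟨h1, h2, h3, h4⟩
    have hF : ∀ x, x ∉ [Var.a, .r, .b, .bs, .o, .S, .hi] → s.F x = st.F x := fun x hx => by
      rw [hs.F x (by simp at hx ⊢; tauto), hs1, State.set_F_of_ne _ (by simp at hx; tauto),
        State.set_F_of_ne _ (by simp at hx; tauto)]
    have hkey : s.key = st.key := by rw [hs.key]; rfl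
    have hblock : g * (k / g) + g ≤ M := by
      obtain ⟨d, rfl⟩ := hgM
      have : k / g < d := Nat.div_lt_of_lt_mul hk
      rw [← Nat.mul_succ]
      exact Nat.mul_le_mul_left _ this
    refine (H O q s a lo g k (by rw [hF _ (by simp), hlo]) (by rw [hF _ (by simp), hg]) hg0 hka h1
      ?_).mono le_rfl ?_
    · intro i hi
      simp only [ha, State.skey, hkey, hF .v (by simp)]
      rw [h3 _ (by omega)]
    · rintro s' ⟨h5, h6, h7, h8⟩
      refine ⟨h5, ?_, ?_, ?_, ?_⟩
      · simpa using h6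
      · rw [State.set_F_of_ne _ (by simp), h7, h2, Nat.count_succ]; ring
      · intro i hi
        rw [State.set_F_of_ne _ (by simp), h8]
        split_ifs
        · rw [State.set_F_same, if_neg (by omega), h3 i hi]
        · exact h3 i hi
      · intro i hi hki
        rw [State.set_F_of_ne _ (by simp), h8]
        rcases Nat.lt_succ_iff_lt_or_eq.1 hi with hlt | rfl
        · have hne : Nat.count (Keep a g) i < Nat.count (Keep a g) k := Nat.count_strict_mono hki hlt
          split_ifs
          · rw [State.set_F_same, if_neg (by omega), h4 i hlt hki]
          · exact h4 i hlt hki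
        · rw [if_pos hki, State.set_F_same, if_pos (by rw [h2]), h3 _ (by omega)]
  · rintro s ⟨hs, h1, h2, h3, h4⟩
    have hhi : s.F .hi 0 = o := by rw [hs.F _ (by simp)]; simp [hs1]
    have hg' : s.F .g 0 = g := by rw [hs.F _ (by simp)]; simp [hs1, hg]
    refine (Does.simple (by simp [Prog.Simple]) (R := fun s' =>
      s' = ((s.set .lo 0 o).set .M 0 (Nat.count (Keep a g) M)).set .g 0 (2 * g)) ?_).mono ?_ ?_
    · simp [Prog.run, NExpr.eval, hhi, h2, hg']
    · simp only [Finset.sum_const, Finset.card_range, nsmul_eq_mul]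
      have t1 : (0 : ℝ) ≤ P₁.time := Nat.cast_nonneg _
      have t2 : (0 : ℝ) ≤ P₃.time := Nat.cast_nonneg _
      have t3 : (0 : ℝ) ≤ (M : ℝ) * g := by positivity
      have t4 : (0 : ℝ) ≤ (M : ℝ) := by positivity
      nlinarith [mul_nonneg t0 t3, mul_nonneg t1 t3, mul_nonneg t2 t3, mul_nonneg t1 t4,
        mul_nonneg t2 t4]
    · rintro _ rfl
      refine ⟨((((hP1.trans (hs.mono (by simp [pivotVars]) id)).set ?_ _ _).set ?_ _ _).set ?_ _ _),
        ?_, ?_, ?_, ?_, ?_, ?_⟩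
      · simp [pivotVars]
      · simp [pivotVars]
      · simp [pivotVars]
      · simp
      · simp
      · simp
      · simpa using h2
      · simpa using h3
      · simpa using h4

end RealRAM

/-! ### Finding an approximate median in linear time -/

namespace RealRAM

variable {O : Plane → DgmData} {q : ℕ} {quiet : Prop} {X : List Var} {s s' : State}

/-- Select the entry of middle rank. -/
def selectStep : Prog :=
  .seq (rankProg (gv .lo) (gv .M) (.add (gv .lo) (gv .a)))
    (.ite (.natLt (gv .r) (.half (gv .M))) .skip (.ite (.natLt (.half (gv .M)) (gv .r)) .skip
      (sv .p (ld .S (.add (gv .lo) (gv .a))))))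

/-- Find a candidate whose inverse slope splits the set of the candidates evenly. -/
def pivotProg : Prog :=
  .seq (.seq (sv .lo (.const 0)) (.seq (sv .o (gv .N)) (.seq (sv .g (.const 16)) (sv .M (.const 2)))))
    (.seq (.loop (.not (.natLt (gv .N) (gv .M).dbl.dbl.dbl)) (sv .M (gv .M).dbl.dbl.dbl))
      (.seq (.loop (.not (.natLt (gv .M) (gv .g))) thinRound)
        (forLoop .a (gv .M) selectStep)))

/-- Quadratic brute force over the ranks, affordable because it is applied only to the `2 * 2 ^ k`
entries left after thinning. -/
theorem Does.select : ∃ C : ℝ, 0 ≤ C ∧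
    ∀ (O : Plane → DgmData) (q : ℕ) (st : State) (lo M : ℕ),
    st.F .lo 0 = lo → st.F .M 0 = M → (∃ i < M, cnt st.skey lo M (st.skey (lo + i)) = M / 2) →
    Does O q (forLoop .a (gv .M) selectStep) st (C * ((M + 1) * (M + 1)))
      (fun s => Pres True [.a, .r, .b, .p] st s ∧
        ∃ i < M, cnt st.skey lo M (st.skey (lo + i)) = M / 2 ∧ s.F .p 0 = st.F .S (lo + i)) := by
  obtain ⟨C, hC, H⟩ := Does.rank (gv .lo) (gv .M) (.add (gv .lo) (gv .a))
  set P : Prog := .ite (.natLt (gv .r) (.half (gv .M))) .skip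
    (.ite (.natLt (.half (gv .M)) (gv .r)) .skip (sv .p (ld .S (.add (gv .lo) (gv .a))))) with hP
  have t0 := forCost_nonneg .a (gv .M)
  refine ⟨C + P.time + forCost .a (gv .M), by positivity, ?_⟩
  intro O q st lo M hlo hM hex
  let Inv : ℕ → State → Prop := fun k s =>
    (∃ i < k, cnt st.skey lo M (st.skey (lo + i)) = M / 2) →
      ∃ i < k, cnt st.skey lo M (st.skey (lo + i)) = M / 2 ∧ s.F .p 0 = st.F .S (lo + i)
  refine (Does.for (quiet := True) (X := [.r, .b, .p]) M (fun _ => C * (M + 1) + P.time) Inv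
    (by simp) (fun _ => by positivity) ?_ ?_ ?_).mono ?_ ?_
  · rintro ⟨i, hi, -⟩; exact absurd hi (Nat.not_lt_zero _)
  · intro s hs; simp [hs.F .M (by simp), hM]
  · intro k s hk hs hka hI
    have hskey : s.skey = st.skey := hs.skey (by simp) (by simp)
    refine Does.seq (H O q s lo M (lo + k) ?_) ?_
    · intro s' hs'
      have e : ∀ x, x ∉ [Var.a, .r, .b, .p] → s'.F x = st.F x := fun x hx => by
        rw [hs'.F x (by simp at hx ⊢; tauto), hs.F x hx]
      simp [NExpr.eval, e .lo (by simp), e .M (by simp), hs'.F .a (by simp), hlo, hM, hka]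
    · rintro s2 ⟨h1, h2⟩
      rw [hskey] at h2
      have hr : P.run s2 = if cnt st.skey lo M (st.skey (lo + k)) = M / 2 then
          s2.set .p 0 (st.F .S (lo + k)) else s2 := by
        have e : ∀ x, x ∉ [Var.a, .r, .b, .p] → s2.F x = st.F x := fun x hx => by
          rw [h1.F x (by simp at hx ⊢; tauto), hs.F x hx]
        have ea : s2.F .a 0 = k := by rw [h1.F _ (by simp), hka]
        rw [hP]
        simp only [Prog.run, Test.eval, NExpr.eval, gv_eval, h2, sv_run, ld_eval, e .M (by simp),
          e .lo (by simp), e .S (by simp), hM, hlo, ea]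
        rcases lt_trichotomy (cnt st.skey lo M (st.skey (lo + k))) (M / 2) with hh | hh | hh
        · simp [hh, hh.ne]
        · simp [hh]
        · simp [hh, hh.not_gt, hh.ne']
      refine Does.simple (by simp [Prog.Simple]) ?_
      rw [hr]
      have h3 : Pres True [.r, .b, .p] s s2 := h1.mono (by simp) id
      split_ifs with hc
      · refine ⟨h3.set (by simp) _ _, fun _ => ⟨k, k.lt_succ_self, hc, by simp⟩⟩
      · refine ⟨h3, ?_⟩
        rintro ⟨i, hi, hi'⟩
        have hik : i < k := by
          rcases Nat.lt_succ_iff_lt_or_eq.1 hi with h | rfl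
          · exact h
          · exact absurd hi' hc
        obtain ⟨i', h4, h5, h6⟩ := hI ⟨i, hik, hi'⟩
        refine ⟨i', h4.trans k.lt_succ_self, h5, ?_⟩
        rw [State.set_F_of_ne _ (by simp), h1.F _ (by simp), h6]
  · simp only [Finset.sum_const, Finset.card_range, nsmul_eq_mul]
    have t1 : (0 : ℝ) ≤ P.time := Nat.cast_nonneg _
    have t4 : (0 : ℝ) ≤ (M : ℝ) := by positivity
    nlinarith [mul_nonneg t1 t4, mul_nonneg t0 t4, mul_nonneg hC t4, mul_nonneg t1 (mul_nonneg t4 t4),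
      mul_nonneg t0 (mul_nonneg t4 t4)]
  · rintro s ⟨h1, h2⟩
    exact ⟨h1, h2 hex⟩

/-- Thinning groups blocks by eight, so it is run on a prefix of length `2 * 8 ^ k`. Choosing `k` as
large as possible leaves this prefix more than an eighth of all candidates. -/
theorem Does.grow : ∃ C : ℝ, 0 ≤ C ∧
    ∀ (O : Plane → DgmData) (q : ℕ) (st : State) (N : ℕ),
    st.F .N 0 = N → st.F .M 0 = 2 → 2 ≤ N →
    Does O q (.loop (.not (.natLt (gv .N) (gv .M).dbl.dbl.dbl)) (sv .M (gv .M).dbl.dbl.dbl)) st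
      (C * N) (fun s => Pres True [.M] st s ∧
        ∃ k, s.F .M 0 = 2 * 8 ^ k ∧ 2 * 8 ^ k ≤ N ∧ N < 16 * 8 ^ k) := by
  set c : Test := .not (.natLt (gv .N) (gv .M).dbl.dbl.dbl)
  set P : Prog := sv .M (gv .M).dbl.dbl.dbl
  refine ⟨c.cost + P.time, by positivity, ?_⟩
  intro O q st N hN hM hN2
  have t1 : (0 : ℝ) ≤ P.time := Nat.cast_nonneg _
  have t2 : (0 : ℝ) ≤ c.cost := Nat.cast_nonneg _
  let Φ : State → ℝ := fun s => (P.time + c.cost) * ((N : ℝ) - s.F .M 0)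
  refine (Does.while (fun s => Pres True [.M] st s ∧ ∃ k, s.F .M 0 = 2 * 8 ^ k ∧ 2 * 8 ^ k ≤ N) Φ
    ?_ ?_ st ⟨Pres.refl _, 0, by simpa using hM, by simpa using hN2⟩).mono ?_ ?_
  · rintro s ⟨-, k, h1, h2⟩
    rw [← h1] at h2
    have : (s.F .M 0 : ℝ) ≤ N := by exact_mod_cast h2
    have := sub_nonneg.2 this
    positivity
  · rintro s ⟨hs, k, h1, h2⟩ hc
    have hNs : s.F .N 0 = N := by rw [hs.F _ (by simp), hN]
    have hc' : 2 * (2 * (2 * (2 * 8 ^ k))) ≤ N := by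
      simpa [c, Test.eval, hNs, h1] using hc
    have hrun : P.run s = s.set .M 0 (2 * 8 ^ (k + 1)) := by
      simp only [P, sv_run, NExpr.eval_dbl, gv_eval, h1]
      congr 1; ring
    refine ⟨P.time, Does.simple (sv_simple _ _) ?_⟩
    rw [hrun]
    refine ⟨⟨hs.set (by simp) _ _, k + 1, by simp, by rw [pow_succ]; omega⟩, ?_⟩
    simp only [Φ, State.set_F_self, h1]
    have h8 : (1 : ℝ) ≤ 8 ^ k := one_le_pow₀ (by norm_num)
    have e : (2 * 8 ^ (k + 1) : ℝ) = 8 * (2 * 8 ^ k) := by ring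
    push_cast
    rw [e]
    nlinarith [mul_nonneg (add_nonneg t1 t2) (sub_nonneg.2 h8)]
  · simp only [Φ, hM]
    push_cast
    have : (2 : ℝ) ≤ N := by exact_mod_cast hN2
    nlinarith
  · rintro s ⟨⟨hs, k, h1, h2⟩, hc⟩
    have hNs : s.F .N 0 = N := by rw [hs.F _ (by simp), hN]
    refine ⟨hs, k, h1, h2, ?_⟩
    have : N < 2 * (2 * (2 * (2 * 8 ^ k))) := by simpa [c, Test.eval, hNs, h1] using hc
    omega

open Classical in
-- A round divides the length `M` by 4 and doubles the block length `g`, so its cost, of order `M *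
-- g`, halves and the total is a geometric series. With `M = 8 ^ (k - j) * (2 * 2 ^ j)` and `g = 16
-- * 2 ^ j` the condition `g ≤ M` says `j < k`, so the loop performs exactly `k` rounds.
theorem Does.thin : ∃ C : ℝ, 0 ≤ C ∧
    ∀ (O : Plane → DgmData) (q : ℕ) (st : State) (N k : ℕ),
    st.F .lo 0 = 0 → st.F .o 0 = N → st.F .g 0 = 16 → st.F .M 0 = 2 * 8 ^ k → 2 * 8 ^ k ≤ N →
    (∀ i < N, ∀ j < N, st.skey i = st.skey j → i = j) →
    Does O q (.loop (.not (.natLt (gv .M) (gv .g))) RealRAM.thinRound) st (C * N)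
      (fun s => Pres True pivotVars st s ∧ (∀ i < N, s.F .S i = st.F .S i) ∧
        s.F .M 0 = 2 * 2 ^ k ∧
        IsThinned st.skey (fun i => s.skey (s.F .lo 0 + i)) k k ∧
        (∀ i < 2 * 2 ^ k, ∀ j < 2 * 2 ^ k,
          s.skey (s.F .lo 0 + i) = s.skey (s.F .lo 0 + j) → i = j) ∧
        ∀ i < 2 * 2 ^ k, ∃ i' < N, s.F .S (s.F .lo 0 + i) = st.F .S i') := by
  obtain ⟨C, hC, H⟩ := Does.thinRound
  set c : Test := .not (.natLt (gv .M) (gv .g))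
  have t2 : (0 : ℝ) ≤ c.cost := Nat.cast_nonneg _
  refine ⟨16 * (2 * (3 * C + c.cost)) + c.cost, by positivity, ?_⟩
  intro O q st N k hlo ho hg hM hkN hinj
  let Inv : State → Prop := fun s => Pres True pivotVars st s ∧ (∀ i < N, s.F .S i = st.F .S i) ∧
    N ≤ s.F .o 0 ∧ s.F .lo 0 + s.F .M 0 ≤ s.F .o 0 ∧
    ∃ j ≤ k, s.F .g 0 = 16 * 2 ^ j ∧ s.F .M 0 = 8 ^ (k - j) * (2 * 2 ^ j) ∧
      IsThinned st.skey (fun i => s.skey (s.F .lo 0 + i)) k j ∧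
      (∀ i < s.F .M 0, ∀ j < s.F .M 0,
          s.skey (s.F .lo 0 + i) = s.skey (s.F .lo 0 + j) → i = j) ∧
      ∀ i < s.F .M 0, ∃ i' < N, s.F .S (s.F .lo 0 + i) = st.F .S i'
  let Φ : State → ℝ := fun s => 2 * (3 * C + c.cost) * ((s.F .M 0 : ℝ) * s.F .g 0)
  have hinit : Inv st := by
    refine ⟨Pres.refl _, fun _ _ => rfl, ho.ge, by rw [hlo, hM, ho, zero_add]; exact hkN, 0,
      Nat.zero_le _, by simpa using hg, by simp [hM, mul_comm], ?_, ?_, ?_⟩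
    · simp only [hlo, zero_add]; exact isThinned_zero _ _
    · simp only [hlo, zero_add, hM]
      exact fun i hi j hj => hinj i (hi.trans_le hkN) j (hj.trans_le hkN)
    · simp only [hlo, zero_add, hM]
      exact fun i hi => ⟨i, hi.trans_le hkN, rfl⟩
  refine (Does.while Inv Φ (fun s _ => by positivity) ?_ st hinit).mono ?_ ?_
  · rintro s ⟨hs, hS, hNo, hlM, j, hj, hgj, hMj, hthin, hsinj, hsrc⟩ hc
    have hc' : 16 * 2 ^ j ≤ 8 ^ (k - j) * (2 * 2 ^ j) := by
      simpa [c, Test.eval, hgj, hMj] using hc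
    have hjk : j < k := by
      by_contra hh
      rw [show k - j = 0 by omega, pow_zero, one_mul] at hc'
      have : 0 < 2 ^ j := by positivity
      omega
    set M := s.F .M 0
    set lo := s.F .lo 0
    set g := 16 * 2 ^ j with hgdef
    have hg0 : 0 < g := by positivity
    have hkj : k - j = (k - (j + 1)) + 1 := by omega
    have hMg : M = 8 ^ (k - (j + 1)) * g := by rw [hMj, hkj, hgdef]; ring
    have hg4 : 4 ∣ g := ⟨4 * 2 ^ j, by rw [hgdef]; ring⟩
    set a : ℕ → ℝ := fun i => s.skey (lo + i) with ha
    have hcount : Nat.count (Keep a g) M = 8 ^ (k - (j + 1)) * (2 * 2 ^ (j + 1)) := by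
      have := count_keep_mul (a := a) hg0 hg4 hsinj (β := 8 ^ (k - (j + 1))) hMg.ge
      rw [← hMg] at this
      rw [this, show g / 4 = 2 * 2 ^ (j + 1) by rw [hgdef, pow_succ]; omega]
    refine ⟨C * (M * (g + 1) + 1), (H O q s lo g M (s.F .o 0) rfl hgj rfl rfl hg0
      (hMg ▸ Dvd.intro_left _ rfl) hlM).mono le_rfl ?_⟩
    rintro s' ⟨h1, h2, h3, h4, h5, h6, h7⟩
    change _ = Nat.count (Keep a g) M at h4
    change _ = _ + Nat.count (Keep a g) M at h5
    change ∀ i < M, Keep a g i → s'.F .S (_ + Nat.count (Keep a g) i) = _ at h7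
    have hv : s'.F .v = s.F .v := h1.F _ (by simp [pivotVars])
    have hb : ∀ i < M, Keep a g i → s'.skey (s'.F .lo 0 + Nat.count (Keep a g) i) = a i := by
      intro i hi hk
      change s'.key (s'.F .v 0) (s'.F .S _) = s.key (s.F .v 0) (s.F .S (lo + i))
      rw [h1.key, hv, h2, h7 i hi hk]
    refine ⟨⟨hs.trans h1, fun i hi => (h6 i (hi.trans_le hNo)).trans (hS i hi), ?_, ?_, j + 1, hjk,
      ?_, ?_, ?_, ?_, ?_⟩, ?_⟩
    · rw [h5]; omega
    · rw [h2, h4, h5]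
    · rw [h3, hgdef, pow_succ]; ring
    · rw [h4, hcount]
    · exact hthin.succ hjk hMj hsinj hb
    · rw [h4]
      exact thin_inj (b := fun i => s'.skey (s'.F .lo 0 + i)) hsinj hb
    · rw [h4]
      intro i hi
      obtain ⟨l, hl, hkl, rfl⟩ := exists_of_lt_count hi
      rw [h2, h7 l hl hkl]
      exact hsrc l hl
    · simp only [Φ, h3, h4, hgj]
      have e1 : 4 * Nat.count (Keep a g) M = M := by rw [hcount, hMg, hgdef, pow_succ]; ring
      have e2 : 4 * (Nat.count (Keep a g) M : ℝ) = M := by exact_mod_cast e1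
      have e3 : (1 : ℝ) ≤ g := by exact_mod_cast hg0
      have e4 : (1 : ℝ) ≤ M := by
        have : 0 < M := by rw [hMg]; positivity
        exact_mod_cast this
      have e5 : (1 : ℝ) ≤ (M : ℝ) * g := one_le_mul_of_one_le_of_one_le e4 e3
      have e6 : (M : ℝ) ≤ (M : ℝ) * g := le_mul_of_one_le_right (by positivity) e3
      have e7 : (Nat.count (Keep a g) M : ℝ) = M / 4 := by linarith
      have e8 := mul_le_mul_of_nonneg_left e5 hC
      have e9 := mul_le_mul_of_nonneg_left e6 hC
      have e10 := mul_le_mul_of_nonneg_left e5 t2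
      rw [e7]
      push_cast
      nlinarith
  · have h16 : ((16 * (2 * 8 ^ k) : ℕ) : ℝ) ≤ ((16 * N : ℕ) : ℝ) := by exact_mod_cast Nat.mul_le_mul_left 16 hkN
    have hN1 : (1 : ℝ) ≤ N := by
      have : 0 < 8 ^ k := by positivity
      have : 1 ≤ N := by omega
      exact_mod_cast this
    simp only [Φ, hM, hg]
    push_cast at h16 ⊢
    have h9 : 0 ≤ 2 * (3 * C + c.cost) := by positivity
    nlinarith [mul_le_mul_of_nonneg_left h16 h9, mul_le_mul_of_nonneg_left hN1 t2]
  · rintro s ⟨⟨hs, hS, hNo, hlM, j, hj, hgj, hMj, hthin, hsinj, hsrc⟩, hc⟩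
    have hc' : 8 ^ (k - j) * (2 * 2 ^ j) < 16 * 2 ^ j := by
      simpa [c, Test.eval, hgj, hMj] using hc
    obtain rfl : j = k := by
      by_contra hh
      have h1 : k - j = (k - j - 1) + 1 := by omega
      have h2 : 8 ≤ 8 ^ (k - j) := by
        rw [h1, pow_succ]
        have : 0 < 8 ^ (k - j - 1) := by positivity
        omega
      have := Nat.mul_le_mul_right (2 * 2 ^ j) h2
      omega
    have hMk : s.F .M 0 = 2 * 2 ^ j := by rw [hMj]; simp
    rw [hMk] at hsinj hsrc
    exact ⟨hs, hS, hMk, hthin, hsinj, hsrc⟩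

theorem Does.pivot : ∃ C : ℝ, 0 ≤ C ∧
    ∀ (O : Plane → DgmData) (q : ℕ) (st : State) (N : ℕ),
    st.F .N 0 = N → 2 ≤ N → (∀ i < N, ∀ j < N, st.skey i = st.skey j → i = j) →
    Does O q pivotProg st (C * N) (fun s => Pres True pivotVars st s ∧
      (∀ i < N, s.F .S i = st.F .S i) ∧ ∃ i < N, s.F .p 0 = st.F .S i ∧
        N ≤ 64 * cnt st.skey 0 N (st.skey i) ∧ N ≤ 64 * (N - cnt st.skey 0 N (st.skey i))) := by
  obtain ⟨C₁, hC₁, H₁⟩ := Does.grow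
  obtain ⟨C₂, hC₂, H₂⟩ := Does.thin
  obtain ⟨C₃, hC₃, H₃⟩ := Does.select
  set P : Prog := .seq (sv .lo (.const 0)) (.seq (sv .o (gv .N)) (.seq (sv .g (.const 16)) (sv .M (.const 2))))
    with hP
  have t1 : (0 : ℝ) ≤ P.time := Nat.cast_nonneg _
  refine ⟨P.time + C₁ + C₂ + 9 * C₃, by positivity, ?_⟩
  intro O q st N hN hN2 hinj
  set s1 := (((st.set .lo 0 0).set .o 0 N).set .g 0 16).set .M 0 2 with hs1
  have hP1 : Pres True pivotVars st s1 :=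
    ((((Pres.refl st).set (by simp [pivotVars]) _ _).set (by simp [pivotVars]) _ _).set
      (by simp [pivotVars]) _ _).set (by simp [pivotVars]) _ _
  have hk1 : s1.skey = st.skey := by
    funext j; simp [State.skey, hs1]
  refine Does.step (Does.simple (by simp [Prog.Simple]) (R := fun s => s = s1)
    (by simp [Prog.run, NExpr.eval, hs1, hN])) ?_
  rintro _ rfl
  refine Does.step (H₁ O q s1 N (by simp [hs1, hN]) (by simp [hs1]) hN2) ?_
  rintro s2 ⟨hp2, k, hM2, hk, hk'⟩
  have hF2 : ∀ x, x ≠ .M → s2.F x = s1.F x := fun x hx => hp2.F x (by simpa using hx)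
  have hk2 : s2.skey = st.skey := by rw [hp2.skey (by simp) (by simp), hk1]
  refine Does.step (H₂ O q s2 N k (by simp [hF2, hs1]) (by simp [hF2, hs1]) (by simp [hF2, hs1]) hM2
    hk (by rw [hk2]; exact hinj)) ?_
  rintro s3 ⟨hp3, hS3, hM3, hthin, hinj3, hsrc3⟩
  rw [hk2] at hthin
  have hhalf : 2 * 2 ^ k / 2 = 2 ^ k := by omega
  have hpow : 0 < 2 ^ k := by positivity
  have hcnt : ∀ x, cnt s3.skey (s3.F .lo 0) (2 * 2 ^ k) x =
      cnt (fun i => s3.skey (s3.F .lo 0 + i)) 0 (2 * 2 ^ k) x := fun x =>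
    cnt_congr (fun i _ => by simp) x
  refine (H₃ O q s3 (s3.F .lo 0) (2 * 2 ^ k) rfl hM3 ?_).mono ?_ ?_
  · obtain ⟨i, hi, hr⟩ := exists_rank_eq (fun i => s3.skey (s3.F .lo 0 + i)) 0 (2 * 2 ^ k)
      (by simpa using hinj3) (r := 2 ^ k) hpow (by omega)
    exact ⟨i, hi, by rw [hcnt, hhalf]; simpa using hr⟩
  -- The final quadratic selection is linear in `N` because `4 ^ k ≤ 8 ^ k` and `2 * 8 ^ k ≤ N`.
  · have h4 : ((2 * 2 ^ k + 1 : ℕ) : ℝ) * ((2 * 2 ^ k + 1 : ℕ) : ℝ) ≤ 9 * N := by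
      have h5 : (2 * 2 ^ k + 1) * (2 * 2 ^ k + 1) ≤ 9 * N := by
        have h6 : 2 ^ k * 2 ^ k ≤ 8 ^ k := by
          rw [← mul_pow]; exact Nat.pow_le_pow_left (by norm_num) k
        have h7 : 2 ^ k ≤ 2 ^ k * 2 ^ k := Nat.le_mul_of_pos_left _ hpow
        have h8 : 0 < 8 ^ k := by positivity
        nlinarith
      exact_mod_cast h5
    have h9 : (1 : ℝ) ≤ N := by exact_mod_cast (by omega : 1 ≤ N)
    push_cast at h4 ⊢
    nlinarith [mul_le_mul_of_nonneg_left h4 hC₃, mul_le_mul_of_nonneg_left h9 t1]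
  · rintro s4 ⟨hp4, i, hi, hr, hp⟩
    have hpres : Pres True pivotVars s1 s4 :=
      ((hp2.mono (by simp [pivotVars]) id).trans hp3).trans (hp4.mono (by simp [pivotVars]) id)
    have hS : ∀ i < N, s3.F .S i = st.F .S i := fun i hi => by
      rw [hS3 i hi, hF2 _ (by simp)]; simp [hs1]
    refine ⟨hP1.trans hpres, fun i hi => by rw [hp4.F _ (by simp), hS i hi], ?_⟩
    obtain ⟨i', hi', he⟩ := hsrc3 i hi
    have hv3 : s3.F .v = st.F .v := by
      rw [hp3.F _ (by simp [pivotVars]), hF2 _ (by simp)]; simp [hs1]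
    have hkey3 : s3.key = st.key := by rw [hp3.key, hp2.key]; rfl
    have he' : s3.F .S (s3.F .lo 0 + i) = st.F .S i' := by
      rw [he, hF2 _ (by simp)]; simp [hs1]
    refine ⟨i', hi', by rw [hp, he'], ?_⟩
    have hx : s3.skey (s3.F .lo 0 + i) = st.skey i' := by
      simp only [State.skey, hkey3, hv3, he']
    rw [hcnt, hhalf, hx] at hr
    exact hthin.split hk hk' hr

end RealRAM

namespace RealRAM

variable {O : Plane → DgmData} {q : ℕ} {quiet : Prop} {X : List Var} {s s' : State}

/-! ### Scanning and filtering the candidates -/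

/-- Find the candidate `p'` that follows the candidate `p` in the order of inverse slopes, and count
the flagged candidates up to `p`. -/
def scanStep : Prog :=
  .ite (.realLt (keye (gv .v) (gv .p)) (keyS (gv .a)))
    (.ite (.natLt (.const 0) (gv .r))
      (.ite (.realLt (keyS (gv .a)) (keye (gv .v) (gv .p'))) (sv .p' (ld .S (gv .a))) .skip)
      (.seq (sv .p' (ld .S (gv .a))) (sv .r (.const 1))))
    (sv .l (.add (gv .l) (ld .nb (ld .S (gv .a)))))

/-- Find the candidate `p'` that follows the candidate `p` in the order of inverse slopes, and count
the flagged candidates up to `p`. -/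
def scanProg : Prog :=
  .seq (.seq (sv .l (.const 0)) (sv .r (.const 0))) (forLoop .a (gv .N) scanStep)

open Classical in
-- A minimum search combined with a sum. The variable `r` records whether a candidate above the
-- pivot has been met; until then `p'` has no meaning, which is why the second half of the invariant
-- depends on `r`.
theorem Does.scan : ∃ C : ℝ, 0 ≤ C ∧
    ∀ (O : Plane → DgmData) (q : ℕ) (st : State) (N : ℕ) (x : ℝ),
    st.F .N 0 = N → st.key (st.F .v 0) (st.F .p 0) = x →
    Does O q scanProg st (C * (N + 1)) (fun s => Pres True [.a, .l, .r, .p'] st s ∧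
      s.F .l 0 = ∑ i ∈ Finset.range N, (if x < st.skey i then 0 else st.F .nb (st.F .S i)) ∧
      ((∃ i < N, x < st.skey i) → ∃ i < N, s.F .p' 0 = st.F .S i ∧ x < st.skey i ∧
        ∀ j < N, x < st.skey j → st.skey i ≤ st.skey j)) := by
  set P : Prog := .seq (sv .l (.const 0)) (sv .r (.const 0)) with hP
  have t0 := forCost_nonneg .a (gv .N)
  have t1 : (0 : ℝ) ≤ P.time := Nat.cast_nonneg _
  have t2 : (0 : ℝ) ≤ scanStep.time := Nat.cast_nonneg _
  refine ⟨P.time + (scanStep.time + forCost .a (gv .N)), by positivity, ?_⟩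
  intro O q st N x hN hx
  set s1 := (st.set .l 0 0).set .r 0 0 with hs1
  refine Does.step (Does.simple (by simp [Prog.Simple]) (R := fun s => s = s1)
    (by simp [Prog.run, NExpr.eval, hs1])) ?_
  rintro _ rfl
  have hP1 : Pres True [.a, .l, .r, .p'] st s1 :=
    ((Pres.refl st).set (by simp) _ _).set (by simp) _ _
  let Inv : ℕ → State → Prop := fun k s =>
    s.F .l 0 = ∑ i ∈ Finset.range k, (if x < st.skey i then 0 else st.F .nb (st.F .S i)) ∧
    (s.F .r 0 = 0 → ∀ i < k, ¬ x < st.skey i) ∧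
    (0 < s.F .r 0 → ∃ i < k, s.F .p' 0 = st.F .S i ∧ x < st.skey i ∧
        ∀ j < k, x < st.skey j → st.skey i ≤ st.skey j)
  refine (Does.forSimple (X := [.l, .r, .p']) N Inv (by simp) (by simp [scanStep, Prog.Simple])
    ?_ ?_ ?_).mono ?_ ?_
  · refine ⟨by simp [hs1], by simp, by simp [hs1]⟩
  · intro s hs
    rw [gv_eval, hs.F _ (by simp)]
    simp [hs1, hN]
  · rintro k s hk hs hka ⟨h1, h2, h3⟩
    have hpres : Pres True [.a, .l, .r, .p'] st s := hP1.trans hs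
    have hF : ∀ y, y ∉ [Var.a, .l, .r, .p'] → s.F y = st.F y := fun y hy => hpres.F y hy
    have hsk : s.skey = st.skey := hpres.skey (by simp) (by simp)
    have hkx : s.key (s.F .v 0) (s.F .p 0) = x := by
      rw [hpres.key, hF .v (by simp), hF .p (by simp), hx]
    simp only [scanStep, Prog.run, Test.eval, NExpr.eval, gv_eval, keye_eval, keyS_eval, ld_eval,
      sv_run, hsk, hkx, hka]
    by_cases hc : x < st.skey k
    · rw [if_pos hc]
      have hsum : s.F .l 0 = ∑ i ∈ Finset.range (k + 1),
          (if x < st.skey i then 0 else st.F .nb (st.F .S i)) := by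
        rw [Finset.sum_range_succ, if_pos hc, h1, add_zero]
      by_cases hr : 0 < s.F .r 0
      · rw [if_pos hr]
        obtain ⟨i, hi, hi1, hi2, hi3⟩ := h3 hr
        have hp' : s.key (s.F .v 0) (s.F .p' 0) = st.skey i := by
          rw [hpres.key, hF .v (by simp), hi1]; rfl
        rw [hp']
        split_ifs with hlt
        · refine ⟨(Pres.refl s).set (by simp) _ _, by simpa using hsum, ?_, ?_⟩
          · intro h; simp at h; omega
          · intro _
            refine ⟨k, k.lt_succ_self, by simp [hF .S (by simp)], hc, ?_⟩
            intro j hj hj'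
            rcases Nat.lt_succ_iff_lt_or_eq.1 hj with h | rfl
            · exact hlt.le.trans (hi3 j h hj')
            · exact le_rfl
        · refine ⟨Pres.refl s, by simpa using hsum, ?_, ?_⟩
          · intro h; simp at h; omega
          · intro _
            refine ⟨i, hi.trans k.lt_succ_self, by simpa using hi1, hi2, ?_⟩
            intro j hj hj'
            rcases Nat.lt_succ_iff_lt_or_eq.1 hj with h | rfl
            · exact hi3 j h hj'
            · exact not_lt.1 hlt
      · rw [if_neg hr]
        have h2' := h2 (by omega)
        refine ⟨((Pres.refl s).set (by simp) _ _).set (by simp) _ _, by simpa using hsum, ?_, ?_⟩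
        · intro h; simp at h
        · intro _
          refine ⟨k, k.lt_succ_self, by simp [hF .S (by simp)], hc, ?_⟩
          intro j hj hj'
          rcases Nat.lt_succ_iff_lt_or_eq.1 hj with h | rfl
          · exact absurd hj' (h2' j h)
          · exact le_rfl
    · rw [if_neg hc]
      refine ⟨(Pres.refl s).set (by simp) _ _, ?_, ?_, ?_⟩
      · rw [Finset.sum_range_succ, if_neg hc, ← h1]
        simp [hF .nb (by simp), hF .S (by simp)]
      · intro h i hi
        simp at h
        rcases Nat.lt_succ_iff_lt_or_eq.1 hi with hh | rfl
        · exact h2 h i hh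
        · exact hc
      · intro h
        simp at h
        obtain ⟨i, hi, hi1, hi2, hi3⟩ := h3 h
        refine ⟨i, hi.trans k.lt_succ_self, by simpa using hi1, hi2, ?_⟩
        intro j hj hj'
        rcases Nat.lt_succ_iff_lt_or_eq.1 hj with hh | rfl
        · exact hi3 j hh hj'
        · exact absurd hj' hc
  · have : (0 : ℝ) ≤ N := Nat.cast_nonneg _
    nlinarith
  · rintro s ⟨h1, h2, h3, h4⟩
    refine ⟨hP1.trans h1, h2, ?_⟩
    rintro ⟨i, hi, hi'⟩
    refine h4 (Nat.pos_of_ne_zero fun h => ?_)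
    exact h3 h i hi hi'

/-- Keep the candidates satisfying a test. -/
def filterStep (t : Test) : Prog :=
  .ite t (.seq (sto .S (gv .o) (ld .S (gv .a))) (sv .o (.add (gv .o) (.const 1)))) .skip

/-- Keep the candidates satisfying a test. -/
def filterProg (t : Test) : Prog :=
  .seq (sv .o (.const 0)) (.seq (forLoop .a (gv .N) (filterStep t)) (sv .N (gv .o)))

open Classical in
-- Compaction in place: the writing position never overtakes the reading position, so unread entries
-- are still the original ones.
theorem Does.filter (t : Test) : ∃ C : ℝ, 0 ≤ C ∧
    ∀ (O : Plane → DgmData) (q : ℕ) (st : State) (N : ℕ) (pr : ℕ → Prop), st.F .N 0 = N →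
    (∀ s, Pres True [.a, .o, .S] st s → (t.eval s ↔ pr (s.F .S (s.F .a 0)))) →
    Does O q (filterProg t) st (C * (N + 1)) (fun s => Pres True [.a, .o, .S, .N] st s ∧
      s.F .N 0 = Nat.count (fun i => pr (st.F .S i)) N ∧
      ∀ i < N, pr (st.F .S i) → s.F .S (Nat.count (fun i => pr (st.F .S i)) i) = st.F .S i) := by
  have t0 := forCost_nonneg .a (gv .N)
  have t1 : (0 : ℝ) ≤ (sv .o (.const 0)).time := Nat.cast_nonneg _
  have t2 : (0 : ℝ) ≤ (filterStep t).time := Nat.cast_nonneg _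
  have t3 : (0 : ℝ) ≤ (sv .N (gv .o)).time := Nat.cast_nonneg _
  refine ⟨(sv .o (.const 0)).time + ((filterStep t).time + forCost .a (gv .N)) +
    (sv .N (gv .o)).time, by positivity, ?_⟩
  intro O q st N pr hN ht
  set s1 := st.set .o 0 0 with hs1
  refine Does.step (Does.simple (sv_simple _ _) (R := fun s => s = s1)
    (by simp [NExpr.eval, hs1])) ?_
  rintro _ rfl
  have hP1 : Pres True [.a, .o, .S] st s1 := (Pres.refl st).set (by simp) _ _
  set P : ℕ → Prop := fun i => pr (st.F .S i) with hPdef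
  let Inv : ℕ → State → Prop := fun k s =>
    s.F .o 0 = Nat.count P k ∧ (∀ i, k ≤ i → s.F .S i = st.F .S i) ∧
      ∀ i < k, P i → s.F .S (Nat.count P i) = st.F .S i
  refine Does.step (Does.forSimple (X := [.o, .S]) N Inv (by simp) (by simp [filterStep, Prog.Simple])
    ?_ ?_ ?_) ?_
  · refine ⟨by simp [hs1], by simp [hs1], by simp⟩
  · intro s hs
    rw [gv_eval, hs.F _ (by simp)]
    simp [hs1, hN]
  · rintro k s hk hs hka ⟨h1, h2, h3⟩
    have hpres : Pres True [.a, .o, .S] st s := hP1.trans hs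
    have hcle : Nat.count P k ≤ k := Nat.count_le _
    simp only [filterStep, Prog.run, NExpr.eval, gv_eval, ld_eval, sto_run,
      sv_run, hka, ht s hpres, h2 k le_rfl, h1]
    by_cases hc : P k
    · rw [if_pos hc]
      refine ⟨((Pres.refl s).set (by simp) _ _).set (by simp) _ _, ?_, ?_, ?_⟩
      · simp [Nat.count_succ, hc, h1]
      · intro i hi
        simp only [ne_eq, reduceCtorEq, not_false_eq_true, State.set_F_of_ne, State.set_F_same]
        rw [if_neg (by omega), h2 i (by omega)]
      · intro i hi hPi
        simp only [ne_eq, reduceCtorEq, not_false_eq_true, State.set_F_of_ne, State.set_F_same]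
        rcases Nat.lt_succ_iff_lt_or_eq.1 hi with h | rfl
        · rw [if_neg (Nat.count_strict_mono hPi h).ne, h3 i h hPi]
        · rw [if_pos rfl]
    · rw [if_neg hc]
      refine ⟨Pres.refl s, ?_, ?_, ?_⟩
      · simp [Nat.count_succ, hc, h1]
      · intro i hi
        rw [State.set_F_of_ne _ (by simp), h2 i (by omega)]
      · intro i hi hPi
        rw [State.set_F_of_ne _ (by simp)]
        rcases Nat.lt_succ_iff_lt_or_eq.1 hi with h | rfl
        · exact h3 i h hPi
        · exact absurd hPi hc
  · rintro s ⟨h1, h2, h3, h4⟩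
    refine (Does.simple (sv_simple _ _) (R := fun s' => s' = s.set .N 0 (Nat.count P N))
      (by simp [h2])).mono ?_ ?_
    · have : (0 : ℝ) ≤ N := Nat.cast_nonneg _
      nlinarith
    · rintro _ rfl
      refine ⟨((hP1.trans h1).mono (by simp) id).set (by simp) _ _, by rw [State.set_F_self], ?_⟩
      intro i hi hPi
      rw [State.set_F_of_ne _ (by simp)]
      exact h4 i hi hPi

end RealRAM

/-! ### Narrowing the candidates -/

/-- The number of elements of `A` with key at most `α`. -/
def cum (key : ℕ → ℝ) (A : Set ℕ) (α : EReal) : ℕ := {u | u ∈ A ∧ (key u : EReal) ≤ α}.ncard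

theorem cum_eq_add (key : ℕ → ℝ) {A : Set ℕ} (hA : A.Finite) {α β : EReal} (h : α ≤ β) :
    cum key A β = cum key A α + {u | u ∈ A ∧ α < key u ∧ (key u : EReal) ≤ β}.ncard := by
  unfold cum
  rw [← Set.ncard_union_eq ?_ (hA.subset fun _ h => h.1) (hA.subset fun _ h => h.1)]
  · congr 1
    ext u
    simp only [Set.mem_ofPred_eq, Set.mem_union]
    constructor
    · rintro ⟨h1, h2⟩
      rcases le_or_gt (key u : EReal) α with h3 | h3
      · exact Or.inl ⟨h1, h3⟩
      · exact Or.inr ⟨h1, h3, h2⟩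
    · rintro (⟨h1, h2⟩ | ⟨h1, -, h2⟩)
      · exact ⟨h1, h2.trans h⟩
      · exact ⟨h1, h2⟩
  · rw [Set.disjoint_left]
    rintro u ⟨-, h1⟩ ⟨-, h2, -⟩
    exact h1.not_gt h2

theorem cum_top (key : ℕ → ℝ) (A : Set ℕ) : cum key A ⊤ = A.ncard := by
  simp [cum]

theorem cum_bot (key : ℕ → ℝ) (A : Set ℕ) : cum key A ⊥ = 0 := by
  simp [cum]

/-- The candidates `S 0, …, S (N - 1)` are the elements of `V` with keys in an interval that contains
the element of `U` of rank `k`; the offset `τ` is `k` plus the number of elements of `D` above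
the lower end of this interval. -/
def Narrowed (key : ℕ → ℝ) (V U D : Set ℕ) (k : ℕ) (S : ℕ → ℕ) (N τ : ℕ) : Prop :=
  Set.InjOn S (Set.Iio N) ∧ ∃ α β : EReal, α ≤ β ∧
    (∀ u, (∃ i < N, S i = u) ↔ u ∈ V ∧ α < key u ∧ (key u : EReal) ≤ β) ∧
    τ + cum key D α = k + D.ncard ∧ cum key U α ≤ k ∧ k < cum key U β

/-- The entries of `S'` are the entries `S i`, `i < N`, with `pr (S i)`. -/
def IsFiltered (S S' : ℕ → ℕ) (N N' : ℕ) (pr : ℕ → Prop) : Prop :=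
  Set.InjOn S' (Set.Iio N') ∧ ∀ u, (∃ i < N', S' i = u) ↔ (∃ i < N, S i = u) ∧ pr u

open Classical in
theorem exists_count_eq (P : ℕ → Prop) {N j : ℕ} (h : j < Nat.count P N) :
    ∃ i < N, P i ∧ Nat.count P i = j := by
  induction N with
  | zero => simp at h
  | succ N ih =>
    by_cases hj : j < Nat.count P N
    · obtain ⟨i, h1, h2⟩ := ih hj
      exact ⟨i, h1.trans N.lt_succ_self, h2⟩
    · rw [Nat.count_succ] at h
      split_ifs at h with hP
      · exact ⟨N, N.lt_succ_self, hP, by omega⟩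
      · omega

open Classical in
theorem count_congr_of_lt {P Q : ℕ → Prop} {N : ℕ} (h : ∀ i < N, P i ↔ Q i) :
    Nat.count P N = Nat.count Q N := by
  rw [Nat.count_eq_card_filter_range, Nat.count_eq_card_filter_range]
  congr 1
  exact Finset.filter_congr fun i hi => h i (Finset.mem_range.1 hi)

open Classical in
theorem count_add_count_not (P : ℕ → Prop) (N : ℕ) :
    Nat.count P N + Nat.count (fun i => ¬ P i) N = N := by
  induction N with
  | zero => simp
  | succ N ih =>
    rw [Nat.count_succ, Nat.count_succ]
    by_cases h : P N <;> simp [h] <;> omega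

open Classical in
theorem isFiltered_of_count {S S₀ S' : ℕ → ℕ} {N : ℕ} {pr : ℕ → Prop}
    (hS : Set.InjOn S (Set.Iio N)) (h₀ : ∀ i < N, S₀ i = S i)
    (h : ∀ i < N, pr (S₀ i) → S' (Nat.count (fun i => pr (S₀ i)) i) = S₀ i) :
    IsFiltered S S' N (Nat.count (fun i => pr (S₀ i)) N) pr := by
  set P : ℕ → Prop := fun i => pr (S₀ i) with hP
  constructor
  · intro a ha b hb hab
    obtain ⟨i, hi, hi1, rfl⟩ := exists_count_eq P ha
    obtain ⟨j, hj, hj1, rfl⟩ := exists_count_eq P hb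
    rw [h i hi hi1, h j hj hj1, h₀ i hi, h₀ j hj] at hab
    rw [hS hi hj hab]
  · intro u
    constructor
    · rintro ⟨a, ha, rfl⟩
      obtain ⟨i, hi, hi1, rfl⟩ := exists_count_eq P ha
      rw [h i hi hi1]
      exact ⟨⟨i, hi, (h₀ i hi).symm⟩, hi1⟩
    · rintro ⟨⟨i, hi, rfl⟩, hi1⟩
      have hi2 : P i := by rw [hP]; simpa only [h₀ i hi] using hi1
      exact ⟨_, Nat.count_strict_mono hi2 hi, by rw [h i hi hi2, h₀ i hi]⟩

section

variable {key : ℕ → ℝ} {V U D : Set ℕ} {k : ℕ} {S S' : ℕ → ℕ} {N N' τ : ℕ}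

/-- The cumulative count of `U` passes `k` within the interval, so the interval contains an element
of `U`. -/
theorem Narrowed.pos (hU : U.Finite) (hUV : U ⊆ V) (h : Narrowed key V U D k S N τ) : 0 < N := by
  obtain ⟨-, α, β, hαβ, hmem, -, h1, h2⟩ := h
  rw [cum_eq_add key hU hαβ] at h2
  have h3 : {u | u ∈ U ∧ α < key u ∧ (key u : EReal) ≤ β}.ncard ≠ 0 := by omega
  obtain ⟨u, hu, hu'⟩ := Set.nonempty_of_ncard_ne_zero h3
  obtain ⟨i, hi, -⟩ := (hmem u).2 ⟨hUV hu, hu'⟩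
  omega

/-- The search ends with the element of rank `k`. -/
theorem Narrowed.last (hU : U.Finite) (hUV : U ⊆ V) (h : Narrowed key V U D k S 1 τ) :
    S 0 ∈ U ∧ {u | u ∈ U ∧ key u < key (S 0)}.ncard = k := by
  obtain ⟨-, α, β, hαβ, hmem, -, h1, h2⟩ := h
  rw [cum_eq_add key hU hαβ] at h2
  set W := {u | u ∈ U ∧ α < key u ∧ (key u : EReal) ≤ β} with hW
  have hsub : W ⊆ {S 0} := by
    rintro u ⟨hu, hu'⟩
    obtain ⟨i, hi, rfl⟩ := (hmem u).2 ⟨hUV hu, hu'⟩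
    obtain rfl : i = 0 := by omega
    rfl
  have h3 : W.ncard ≠ 0 := by omega
  obtain ⟨u, hu⟩ := Set.nonempty_of_ncard_ne_zero h3
  have hu0 : u = S 0 := hsub hu
  subst hu0
  refine ⟨hu.1, ?_⟩
  -- The cumulative count rises from at most `k` to above `k` through a single element, so it equals
  -- `k` at the lower end, and this is the rank of that element.
  have h4 : W.ncard ≤ 1 := by
    simpa using Set.ncard_le_ncard hsub
  have h5 : cum key U α = k := by omega
  rw [← h5, cum]
  congr 1
  ext w
  refine and_congr_right fun hw => ?_
  constructor
  · intro hlt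
    by_contra hc
    push Not at hc
    have : w ∈ W := ⟨hw, hc, (EReal.coe_le_coe_iff.2 hlt.le).trans hu.2.2⟩
    have := hsub this
    rw [Set.mem_singleton_iff] at this
    rw [this] at hlt
    exact lt_irrefl _ hlt
  · intro hle
    exact EReal.coe_lt_coe_iff.1 (hle.trans_lt hu.2.1)

/-- The initial candidates. -/
theorem narrowed_init (hS : Set.InjOn S (Set.Iio N)) (hV : ∀ u, (∃ i < N, S i = u) ↔ u ∈ V)
    (hk : k < U.ncard) : Narrowed key V U D k S N (k + D.ncard) :=
  ⟨hS, ⊥, ⊤, bot_le, fun u => by simp [hV u], by simp [cum_bot], by simp [cum_bot],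
    by rwa [cum_top]⟩

open Classical in
/-- One step of the search: the element of rank `k` lies at or below the candidate with key `x` if and
only if `τ < c + l`, where `c` is the number of elements of `U` below and of `D` above a threshold
between `x` and the next key `y`. -/
theorem Narrowed.step (hD : D.Finite) (hUV : U ⊆ V) (hDV : D ⊆ V)
    (h : Narrowed key V U D k S N τ) {x y κ : ℝ} {c l : ℕ}
    (hx : ∃ i < N, x = key (S i)) (hy : ∃ i < N, y = key (S i)) (hxκ : x < κ) (hκy : κ < y)
    (hnext : ∀ i < N, x < key (S i) → y ≤ key (S i))
    (hc : c = {u | u ∈ U ∧ key u < κ}.ncard + {u | u ∈ D ∧ κ < key u}.ncard)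
    (hl : l = ∑ i ∈ Finset.range N, if x < key (S i) then 0 else if S i ∈ D then 1 else 0) :
    (τ < c + l → IsFiltered S S' N N' (fun u => ¬ x < key u) → Narrowed key V U D k S' N' τ) ∧
    (¬ τ < c + l → IsFiltered S S' N N' (fun u => x < key u) →
      Narrowed key V U D k S' N' (τ - l)) := by
  obtain ⟨hinj, α, β, hαβ, hmem, hτ, h1, h2⟩ := h
  obtain ⟨i₀, hi₀, hx⟩ := hx
  obtain ⟨i₁, hi₁, hy⟩ := hy
  have hαx : α < (x : EReal) := by rw [hx]; exact ((hmem _).1 ⟨i₀, hi₀, rfl⟩).2.1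
  have hxβ : (x : EReal) ≤ β := by rw [hx]; exact ((hmem _).1 ⟨i₀, hi₀, rfl⟩).2.2
  have hyβ : (y : EReal) ≤ β := by rw [hy]; exact ((hmem _).1 ⟨i₁, hi₁, rfl⟩).2.2
  -- Not only the candidates but all vertices avoid keys strictly between `x` and `y`: a vertex that
  -- is no longer a candidate and lies above `x` has a key above the upper end `β`, hence above `y`.
  have hgap : ∀ u ∈ V, x < key u → y ≤ key u := by
    intro u hu hxu
    by_cases hb : (key u : EReal) ≤ β
    · obtain ⟨i, hi, rfl⟩ := (hmem u).2 ⟨hu, hαx.trans (EReal.coe_lt_coe_iff.2 hxu), hb⟩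
      exact hnext i hi hxu
    · exact EReal.coe_le_coe_iff.1 (hyβ.trans (not_le.1 hb).le)
  have hcU : {u | u ∈ U ∧ key u < κ}.ncard = cum key U x := by
    unfold cum
    congr 1
    ext u
    refine and_congr_right fun hu => ?_
    rw [EReal.coe_le_coe_iff]
    constructor
    · intro hlt
      by_contra hc
      have := hgap u (hUV hu) (not_le.1 hc)
      linarith
    · intro hle; linarith
  have hcD : {u | u ∈ D ∧ κ < key u}.ncard + cum key D x = D.ncard := by
    rw [← cum_top key D, cum_eq_add key hD (le_top : (x : EReal) ≤ ⊤), add_comm]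
    congr 2
    ext u
    refine and_congr_right fun hu => ?_
    rw [EReal.coe_lt_coe_iff]
    simp only [le_top, and_true]
    constructor
    · intro hlt; linarith
    · intro hlt
      have := hgap u (hDV hu) hlt
      linarith
  have hlD : cum key D x = cum key D α + l := by
    rw [cum_eq_add key hD hαx.le, hl]
    congr 1
    have e1 : ∀ i ∈ Finset.range N, (if x < key (S i) then 0 else if S i ∈ D then 1 else 0) =
        if ¬ x < key (S i) ∧ S i ∈ D then 1 else 0 := by
      intro i _
      by_cases h1 : x < key (S i) <;> simp [h1]
    rw [Finset.sum_congr rfl e1, Finset.sum_boole, Nat.cast_id, ← Finset.card_image_of_injOn (f := S),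
      ← Set.ncard_coe_finset]
    · congr 1
      ext u
      simp only [Set.mem_ofPred_eq, Finset.coe_image, Set.mem_image, Finset.coe_filter,
        Finset.mem_range]
      constructor
      · rintro ⟨hu, hu1, hu2⟩
        obtain ⟨i, hi, rfl⟩ := (hmem u).2 ⟨hDV hu, hu1, hu2.trans hxβ⟩
        exact ⟨i, ⟨hi, (EReal.coe_le_coe_iff.1 hu2).not_gt, hu⟩, rfl⟩
      · rintro ⟨i, ⟨hi, h3, h4⟩, rfl⟩
        exact ⟨h4, ((hmem _).1 ⟨i, hi, rfl⟩).2.1, EReal.coe_le_coe_iff.2 (not_lt.1 h3)⟩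
    · intro a ha b hb hab
      simp only [Finset.coe_filter, Finset.mem_range, Set.mem_ofPred_eq] at ha hb
      exact hinj ha.1 hb.1 hab
  -- Here `c = cum U x + |D| - cum D x`, `l = cum D x - cum D α` and `τ = k + |D| - cum D α`. The
  -- contributions of the known set `D` cancel.
  have htest : τ < c + l ↔ k < cum key U x := by omega
  rw [htest]
  constructor
  · rintro hk ⟨hinj', hmem'⟩
    refine ⟨hinj', α, x, hαx.le, ?_, hτ, h1, hk⟩
    intro u
    simp only [hmem' u, hmem u, not_lt, EReal.coe_le_coe_iff]
    constructor
    · rintro ⟨⟨h3, h4, -⟩, h5⟩; exact ⟨h3, h4, h5⟩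
    · rintro ⟨h3, h4, h5⟩; exact ⟨⟨h3, h4, (EReal.coe_le_coe_iff.2 h5).trans hxβ⟩, h5⟩
  · rintro hk ⟨hinj', hmem'⟩
    refine ⟨hinj', x, β, hxβ, ?_, by omega, not_lt.1 hk, h2⟩
    intro u
    simp only [hmem' u, hmem u, EReal.coe_lt_coe_iff]
    constructor
    · rintro ⟨⟨h3, -, h4⟩, h5⟩; exact ⟨h3, h5, h4⟩
    · rintro ⟨h3, h4, h5⟩; exact ⟨⟨h3, hαx.trans (EReal.coe_lt_coe_iff.2 h4), h5⟩, h4⟩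

end

namespace RealRAM

open IsNumbering

variable {O : Plane → DgmData} {q : ℕ} {s s' : State}

/-! ### Queries -/

/-- The threshold between the inverse slopes towards `p` and towards `p'`. -/
def kappae : RExpr := .div (.add (keye (gv .v) (gv .p)) (keye (gv .v) (gv .p'))) (.const 2)

/-- The length of the vector `(1, -κ)` for the threshold `κ`. -/
def kappaNorm : RExpr := .sqrt (.add (.const 1) (.mul kappae kappae))

/-- Query orthogonally to the threshold and count the edges whose height is that of `v`. -/
def slopeProg : Prog := countProg (.div (.const 1) kappaNorm) (.div (.sub (.const 0) kappae) kappaNorm)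

/-- Query downwards and count the edges whose height is that of `v`. -/
def downProg : Prog := countProg (.const 0) (.const (-1))

theorem StoresDiagram.size_bounds {K : PlaneComplex} {n : ℕ} {X Y : ℕ → ℝ} (h : IsNumbering K n X Y)
    {s : Plane} {D : DgmData} (hD : StoresDiagram K s D) :
    ((D.byDeath 0).length.size : ℝ) ≤ ((3 * n).size : ℕ) ∧
      ((D.byBirth 1).length.size : ℝ) ≤ ((3 * n).size : ℕ) := by
  obtain ⟨-, h1, h2⟩ := hD.length_bounds
  rw [h.ncard_verts] at h1
  exact ⟨by exact_mod_cast Nat.size_le_size (by omega),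
    by exact_mod_cast Nat.size_le_size (h2.trans h.ncard_edges_le)⟩

/-- Avoiding the keys of all other vertices makes the height of `v` unique in the queried direction,
as needed to interpret the count. -/
theorem Does.slope : ∃ C : ℝ, 0 ≤ C ∧
    ∀ (O : Plane → DgmData) (q : ℕ) (K : PlaneComplex) (n : ℕ) (st : State) (v : ℕ) (κ : ℝ),
    IsOracleFor K O → IsNumbering K n st.px st.py → st.F .v 0 = v → v < n →
    κ = (st.key v (st.F .p 0) + st.key v (st.F .p' 0)) / 2 →
    (∀ u < n, u ≠ v → st.key v u ≠ κ) →
    Does O q slopeProg st (C * ((3 * n).size + 1) + q) (fun s =>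
      Pres False [.c, .lo, .hi, .j] st s ∧ s.queries = st.queries + 1 ∧
      s.F .c 0 = {u | u ∈ ups K n st.px st.py v ∧ st.key v u < κ}.ncard +
        {u | u ∈ downs K n st.px st.py v ∧ κ < st.key v u}.ncard) := by
  obtain ⟨C, hC, H⟩ := Does.countProg (.div (.const 1) kappaNorm)
    (.div (.sub (.const 0) kappae) kappaNorm)
  refine ⟨2 * C, by positivity, ?_⟩
  intro O q K n st v κ hO h hv hvn hκ hne
  have hD : StoresDiagram K (slopeDir κ) (O (slopeDir κ)) := hO _ (norm_slopeDir κ)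
  obtain ⟨L, hL, hs⟩ := id hD
  obtain ⟨b0, b1⟩ := StoresDiagram.size_bounds h hD
  refine (H O q st (O (slopeDir κ)) (1 / Real.sqrt (1 + κ * κ)) ((0 - κ) / Real.sqrt (1 + κ * κ))
    (inner ℝ (slopeDir κ) (coordPoint st.px st.py v)) ?_ rfl (norm_slopeDir κ) ?_
    hD.length_bounds.1 (hs 0).2.2.2 (hs 1).2.1).mono ?_ ?_
  · intro s hs
    have : kappae.eval s = κ := by
      simp [kappae, RExpr.eval, hs.key, hs.F .v (by simp), hs.F .p (by simp), hs.F .p' (by simp), hv,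
        hκ]
    simp [RExpr.eval, kappaNorm, this]
  · rw [inner_coordPoint, hv]
    simp [slopeDir]
  · nlinarith
  · rintro s ⟨h1, h2, h3⟩
    refine ⟨h1, h2, ?_⟩
    rw [h3]
    exact h.countP_slopeDir hD hvn hne

theorem Does.down : ∃ C : ℝ, 0 ≤ C ∧
    ∀ (O : Plane → DgmData) (q : ℕ) (K : PlaneComplex) (n : ℕ) (st : State) (v : ℕ),
    IsOracleFor K O → IsNumbering K n st.px st.py → st.F .v 0 = v → v < n →
    Does O q downProg st (C * ((3 * n).size + 1) + q) (fun s =>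
      Pres False [.c, .lo, .hi, .j] st s ∧ s.queries = st.queries + 1 ∧
      s.F .c 0 = (ups K n st.px st.py v).ncard) := by
  obtain ⟨C, hC, H⟩ := Does.countProg (.const 0) (.const (-1))
  refine ⟨2 * C, by positivity, ?_⟩
  intro O q K n st v hO h hv hvn
  have hunit : ‖(!₂[0, -1] : Plane)‖ = 1 := by
    simp [EuclideanSpace.norm_eq, Fin.sum_univ_two]
  have hD : StoresDiagram K !₂[0, -1] (O !₂[0, -1]) := hO _ hunit
  obtain ⟨L, hL, hs⟩ := id hD
  obtain ⟨b0, b1⟩ := StoresDiagram.size_bounds h hD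
  refine (H O q st (O !₂[0, -1]) 0 (-1) (inner ℝ (!₂[0, -1] : Plane) (coordPoint st.px st.py v))
    ?_ rfl hunit ?_ hD.length_bounds.1 (hs 0).2.2.2 (hs 1).2.1).mono ?_ ?_
  · intro s hs
    simp [RExpr.eval]
  · rw [inner_coordPoint, hv]
    simp
  · nlinarith
  · rintro s ⟨h1, h2, h3⟩
    refine ⟨h1, h2, ?_⟩
    rw [h3]
    exact h.countP_down hD hvn

/-! ### The search for an edge -/

/-- The candidate `a` has an inverse slope above that of `p`. -/
def aboveTest : Test := .realLt (keye (gv .v) (gv .p)) (keyS (gv .a))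

/-- One step of the search. -/
def searchStep : Prog :=
  .seq pivotProg (.seq scanProg (.seq slopeProg
    (.ite (.natLt (gv .τ) (.add (gv .c) (gv .l))) (filterProg (.not aboveTest))
      (.seq (sv .τ (.sub (gv .τ) (gv .l))) (filterProg aboveTest)))))

/-- The arrays changed by the search. -/
def searchVars : List Var := [.S, .N, .τ, .a, .r, .b, .bs, .hi, .lo, .M, .g, .o, .p, .p', .l, .c, .j]

/-- The setting of the search at the vertex `v`: the neighbours below `v` are flagged. -/
structure AtVertex (K : PlaneComplex) (n : ℕ) (st : State) (v : ℕ) : Prop where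
  num : IsNumbering K n st.px st.py
  lt : v < n
  v_eq : st.F .v 0 = v
  flag : ∀ u < n, u ∈ downs K n st.px st.py v → st.F .nb u = 1
  not_flag : ∀ u < n, u ∉ downs K n st.px st.py v → st.F .nb u = 0

/-- The candidates in memory, in the search for the edge number `k` going up from `v`. -/
def SearchInv (K : PlaneComplex) (n : ℕ) (st : State) (v k : ℕ) (s : State) : Prop :=
  Narrowed (st.key v) {u | u < n ∧ u ≠ v} (ups K n st.px st.py v) (downs K n st.px st.py v) k
    (s.F .S) (s.F .N 0) (s.F .τ 0)

theorem ups_subset (K : PlaneComplex) (n : ℕ) (X Y : ℕ → ℝ) (v : ℕ) :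
    ups K n X Y v ⊆ {u | u < n ∧ u ≠ v} :=
  fun _ h => ⟨h.2.1, by rintro rfl; exact lt_irrefl _ h.2.2.1⟩

theorem downs_subset (K : PlaneComplex) (n : ℕ) (X Y : ℕ → ℝ) (v : ℕ) :
    downs K n X Y v ⊆ {u | u < n ∧ u ≠ v} :=
  fun _ h => ⟨h.1, by rintro rfl; exact lt_irrefl _ h.2.2.1⟩

/-- One query and linear time suffice: the pivot leaves at least 1/64 of the candidates on either
side, so whichever side is kept has at most 63/64 of them. -/
theorem Does.searchStep : ∃ C : ℝ, 0 ≤ C ∧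
    ∀ (O : Plane → DgmData) (q : ℕ) (K : PlaneComplex) (n : ℕ) (st s : State) (v k : ℕ),
    IsOracleFor K O → AtVertex K n st v → Pres False searchVars st s → SearchInv K n st v k s →
    2 ≤ s.F .N 0 →
    Does O q searchStep s (C * (s.F .N 0 + ((3 * n).size + 1)) + q) (fun s' =>
      Pres False searchVars st s' ∧ s'.queries = s.queries + 1 ∧ SearchInv K n st v k s' ∧
      64 * s'.F .N 0 ≤ 63 * s.F .N 0) := by
  classical
  obtain ⟨C₁, hC₁, H₁⟩ := Does.pivot
  obtain ⟨C₂, hC₂, H₂⟩ := Does.scan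
  obtain ⟨C₃, hC₃, H₃⟩ := Does.slope
  obtain ⟨C₄, hC₄, H₄⟩ := Does.filter (.not aboveTest)
  obtain ⟨C₅, hC₅, H₅⟩ := Does.filter aboveTest
  set t : ℝ := (((sv .τ (.sub (gv .τ) (gv .l))).time : ℕ) : ℝ) with ht
  set cc : ℝ := (((Test.natLt (gv .τ) (.add (gv .c) (gv .l))).cost : ℕ) : ℝ) with hcc
  have ht0 : 0 ≤ t := Nat.cast_nonneg _
  have hcc0 : 0 ≤ cc := Nat.cast_nonneg _
  refine ⟨C₁ + 2 * C₂ + C₃ + 2 * C₄ + 2 * C₅ + t + cc, by positivity, ?_⟩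
  intro O q K n st s v k hO hat hst hinv hN2
  set N := s.F .N 0 with hN
  set Sz : ℝ := (((3 * n).size : ℕ) : ℝ) with hSz
  have hSz0 : 0 ≤ Sz := Nat.cast_nonneg _
  have hN1 : (2 : ℝ) ≤ N := by exact_mod_cast hN2
  set U := ups K n st.px st.py v with hU
  set D := downs K n st.px st.py v with hD
  set key := st.key v with hkey
  have hv : s.F .v 0 = v := by rw [hst.F .v (by simp [searchVars]), hat.v_eq]
  have hsk : ∀ i, s.skey i = key (s.F .S i) := by
    intro i; simp [State.skey, hv, hst.key, hkey]
  obtain ⟨hinjS, α, β, hαβ, hmem, -⟩ := id hinv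
  have hSV : ∀ i < N, s.F .S i < n ∧ s.F .S i ≠ v := fun i hi => ((hmem _).1 ⟨i, hi, rfl⟩).1
  have hkinj : ∀ a b, a < n → a ≠ v → b < n → b ≠ v → key a = key b → a = b :=
    fun a b ha hav hb hbv he => hat.num.key_inj hat.lt ha hb hav hbv he
  have hinj : ∀ i < N, ∀ j < N, s.skey i = s.skey j → i = j := by
    intro i hi j hj he
    rw [hsk, hsk] at he
    exact hinjS hi hj (hkinj _ _ (hSV i hi).1 (hSV i hi).2 (hSV j hj).1 (hSV j hj).2 he)
  -- the pivot
  refine Does.step (H₁ O q s N rfl hN2 hinj) ?_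
  rintro s1 ⟨p1, hS1, i₀, hi₀, hp1, hcnt1, hcnt2⟩
  have hst1 : Pres False searchVars st s1 :=
    hst.trans (p1.mono (by simp [searchVars, pivotVars]) (by simp))
  have hv1 : s1.F .v 0 = v := by rw [p1.F .v (by simp [pivotVars]), hv]
  have hN1' : s1.F .N 0 = N := by rw [p1.F .N (by simp [pivotVars])]
  have hτ1 : s1.F .τ 0 = s.F .τ 0 := by rw [p1.F .τ (by simp [pivotVars])]
  have hsk1 : ∀ i < N, s1.skey i = key (s.F .S i) := by
    intro i hi; simp [State.skey, hv1, hst1.key, hkey, hS1 i hi]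
  set x := key (s.F .S i₀) with hx
  have hx1 : s1.key (s1.F .v 0) (s1.F .p 0) = x := by rw [hv1, hp1, hst1.key]
  -- the scan
  refine Does.step (H₂ O q s1 N x hN1' hx1) ?_
  rintro s2 ⟨p2, hl2, hp2⟩
  have hst2 : Pres False searchVars st s2 :=
    hst1.trans (p2.mono (by simp [searchVars]) (by simp))
  have hF2 : ∀ y ∉ [Var.a, .l, .r, .p'], s2.F y = s1.F y := fun y hy => p2.F y hy
  have hcntx : cnt s.skey 0 N (s.skey i₀) = Nat.count (fun i => ¬ x < key (s.F .S i)) N := by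
    unfold cnt
    congr 1
    funext i
    rw [Nat.zero_add, hsk, hsk, not_lt]
  set cl := Nat.count (fun i => ¬ x < key (s.F .S i)) N with hcl
  have hcadd : cl + Nat.count (fun i => x < key (s.F .S i)) N = N := by
    rw [hcl, add_comm]
    exact count_add_count_not (fun i => x < key (s.F .S i)) N
  rw [hcntx] at hcnt1 hcnt2
  -- The pivot also leaves candidates strictly above itself, so a next larger key exists and the
  -- scan finds it.
  have hex : ∃ i < N, x < s1.skey i := by
    have h1 : 0 < Nat.count (fun i => x < key (s.F .S i)) N := by omega
    obtain ⟨i, hi, hi1, -⟩ := exists_count_eq _ h1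
    exact ⟨i, hi, by rw [hsk1 i hi]; exact hi1⟩
  obtain ⟨i₁, hi₁, hp', hlt, hnext⟩ := hp2 hex
  rw [hsk1 i₁ hi₁] at hlt
  set y := key (s.F .S i₁) with hy
  have hnext' : ∀ i < N, x < key (s.F .S i) → y ≤ key (s.F .S i) := by
    intro i hi hh
    have := hnext i hi (by rwa [hsk1 i hi])
    rwa [hsk1 i hi, hsk1 i₁ hi₁] at this
  set κ := (x + y) / 2 with hκ
  have hxκ : x < κ := by rw [hκ]; linarith
  have hκy : κ < y := by rw [hκ]; linarith
  have hv2 : s2.F .v 0 = v := by rw [hF2 .v (by simp), hv1]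
  -- the query
  have hgap : ∀ u < n, u ≠ v → s2.key v u ≠ κ := by
    intro u hu huv he
    rw [hst2.key] at he
    have hαx := ((hmem _).1 ⟨i₀, hi₀, rfl⟩).2.1
    have hyβ := ((hmem _).1 ⟨i₁, hi₁, rfl⟩).2.2
    have hxk : x < key u := by rw [hkey, he]; exact hxκ
    have hky : key u < y := by rw [hkey, he]; exact hκy
    obtain ⟨i, hi, rfl⟩ := (hmem u).2 ⟨⟨hu, huv⟩, hαx.trans (EReal.coe_lt_coe_iff.2 hxk),
      (EReal.coe_le_coe_iff.2 hky.le).trans hyβ⟩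
    exact hky.not_ge (hnext' i hi hxk)
  refine Does.step (H₃ O q K n s2 v κ hO (by rw [hst2.px, hst2.py]; exact hat.num) hv2 hat.lt
    (by rw [hst2.key, hp', hS1 i₁ hi₁, hF2 .p (by simp), hp1]) hgap) ?_
  rintro s3 ⟨p3, hq3, hc3⟩
  rw [hst2.key, hst2.px, hst2.py] at hc3
  have hst3 : Pres False searchVars st s3 :=
    hst2.trans (p3.mono (by simp [searchVars]) (by simp))
  have hF3 : ∀ y ∉ [Var.c, .lo, .hi, .j], s3.F y = s2.F y := fun y hy => p3.F y hy
  have hS3 : ∀ i < N, s3.F .S i = s.F .S i := fun i hi => by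
    rw [hF3 .S (by simp), hF2 .S (by simp), hS1 i hi]
  have hN3 : s3.F .N 0 = N := by rw [hF3 .N (by simp), hF2 .N (by simp), hN1']
  have hτ3 : s3.F .τ 0 = s.F .τ 0 := by rw [hF3 .τ (by simp), hF2 .τ (by simp), hτ1]
  have hp3 : s3.F .p 0 = s.F .S i₀ := by rw [hF3 .p (by simp), hF2 .p (by simp), hp1]
  have hv3 : s3.F .v 0 = v := by rw [hF3 .v (by simp), hv2]
  have hl3 : s3.F .l 0 = ∑ i ∈ Finset.range N,
      (if x < key (s.F .S i) then 0 else if s.F .S i ∈ D then 1 else 0) := by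
    rw [hF3 .l (by simp), hl2]
    refine Finset.sum_congr rfl fun i hi => ?_
    have hi' := Finset.mem_range.1 hi
    rw [hsk1 i hi', hS1 i hi', hst1.F .nb (by simp [searchVars])]
    by_cases hd : s.F .S i ∈ D
    · rw [hat.flag _ (hSV i hi').1 hd]; simp [hd]
    · rw [hat.not_flag _ (hSV i hi').1 hd]; simp [hd]
  have hq : s3.queries = s.queries + 1 := by
    rw [hq3, p2.queries trivial, p1.queries trivial]
  have hstep : ∀ S' N', (_ : _) := fun S' N' =>
    hinv.step (S' := S') (N' := N') (downs_finite K n st.px st.py v)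
      (ups_subset K n st.px st.py v) (downs_subset K n st.px st.py v) ⟨i₀, hi₀, hx⟩ ⟨i₁, hi₁, hy⟩
      hxκ hκy hnext' hc3 hl3
  have habove : ∀ s4 s5 : State, s4.F .p 0 = s.F .S i₀ → s4.F .v 0 = v → s4.key = st.key →
      Pres True [.a, .o, .S] s4 s5 → (aboveTest.eval s5 ↔ x < key (s5.F .S (s5.F .a 0))) := by
    intro s4 s5 h1 h2 h3 h4
    simp [aboveTest, Test.eval, State.skey, h4.key, h4.F .p (by simp), h4.F .v (by simp), h1, h2, h3,
      hx, hkey]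
  have g4 : 0 ≤ C₄ * (N + 1) := by positivity
  have g5 : 0 ≤ C₅ * (N + 1) := by positivity
  refine (Does.ite (T := C₄ * (N + 1) + (t + C₅ * (N + 1))) (fun hc => ?_) (fun hc => ?_)).mono ?_
    (fun _ h => h)
  · replace hc : s.F .τ 0 < s3.F .c 0 + s3.F .l 0 := by
      simpa [Test.eval, NExpr.eval, hτ3] using hc
    refine (H₄ O q s3 N (fun u => ¬ x < key u) hN3 fun s5 h5 => ?_).mono (by linarith) ?_
    · exact not_congr (habove s3 s5 hp3 hv3 hst3.key h5)
    rintro s4 ⟨p4, hN4, hS4⟩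
    have hfil := isFiltered_of_count (pr := fun u => ¬ x < key u) hinjS hS3 hS4
    rw [← hN4] at hfil
    have hcount := count_congr_of_lt (P := fun i => ¬ x < key (s3.F .S i))
      (Q := fun i => ¬ x < key (s.F .S i)) (N := N) fun i hi => by rw [hS3 i hi]
    refine ⟨hst3.trans (p4.mono (by simp [searchVars]) (by simp)), by rw [p4.queries trivial, hq], ?_, ?_⟩
    · unfold SearchInv
      rw [p4.F .τ (by simp), hτ3]
      exact (hstep _ _).1 hc hfil
    · have hN4' : s4.F .N 0 = cl := by rw [hN4, hcl]; convert hcount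
      omega
  · replace hc : ¬ s.F .τ 0 < s3.F .c 0 + s3.F .l 0 := by
      simpa [Test.eval, NExpr.eval, hτ3] using hc
    refine Does.step (R' := fun s4 => s4 = s3.set .τ 0 (s.F .τ 0 - s3.F .l 0))
      (Does.simple (sv_simple _ _) (by simp [NExpr.eval, hτ3])) ?_
    rintro _ rfl
    set s4 := s3.set .τ 0 (s.F .τ 0 - s3.F .l 0) with hs4
    refine (H₅ O q s4 N (fun u => x < key u) (by simp [hs4, hN3]) fun s5 h5 =>
      habove s4 s5 (by simp [hs4, hp3]) (by simp [hs4, hv3]) hst3.key h5).mono (by linarith) ?_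
    rintro s5 ⟨p5, hN5, hS5⟩
    have hS4 : s4.F .S = s3.F .S := by simp [hs4]
    rw [hS4] at hS5 hN5
    have hfil := isFiltered_of_count (pr := fun u => x < key u) hinjS hS3 hS5
    rw [← hN5] at hfil
    have hcount := count_congr_of_lt (P := fun i => x < key (s3.F .S i))
      (Q := fun i => x < key (s.F .S i)) (N := N) fun i hi => by rw [hS3 i hi]
    have hst4 : Pres False searchVars st s4 := hst3.set (by simp [searchVars]) _ _
    refine ⟨hst4.trans (p5.mono (by simp [searchVars]) (by simp)), by rw [p5.queries trivial, ← hq]; rfl,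
      ?_, ?_⟩
    · unfold SearchInv
      rw [p5.F .τ (by simp), hs4, State.set_F_self]
      exact (hstep _ _).2 hc hfil
    · rw [hN5, hcount]; omega
  · rw [← hcc]
    have e1 := mul_nonneg hC₁ hSz0
    have e2 := mul_nonneg hC₂ hSz0
    have e4 := mul_nonneg hC₄ hSz0
    have e5 := mul_nonneg hC₅ hSz0
    have e6 := mul_nonneg ht0 hSz0
    have e7 := mul_nonneg hcc0 hSz0
    have f2 := mul_nonneg hC₂ (sub_nonneg.2 hN1)
    have f3 := mul_nonneg hC₃ (sub_nonneg.2 hN1)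
    have f4 := mul_nonneg hC₄ (sub_nonneg.2 hN1)
    have f5 := mul_nonneg hC₅ (sub_nonneg.2 hN1)
    have f6 := mul_nonneg ht0 (sub_nonneg.2 hN1)
    have f7 := mul_nonneg hcc0 (sub_nonneg.2 hN1)
    linarith

end RealRAM

/-! ### The complete search for one edge -/

namespace RealRAM

open IsNumbering

variable {O : Plane → DgmData} {q : ℕ} {s s' : State}

/-- The search among the candidates for an edge going up from `v`. -/
def searchLoop : Prog := .loop (.natLt (.const 1) (gv .N)) searchStep

/-- From `log (64 / 63) ≥ 1 - 63 / 64 = 1 / 64`. The quantity `64 * log N` thus pays for one query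
per step. -/
theorem log_drop {N N' : ℕ} (hN' : 0 < N') (h : 64 * N' ≤ 63 * N) :
    1 + 64 * Real.log N' ≤ 64 * Real.log N := by
  have h1 : (0 : ℝ) < N' := by exact_mod_cast hN'
  have h2 : (64 * N' : ℝ) ≤ 63 * N := by exact_mod_cast h
  have h3 : (0 : ℝ) < N := by linarith
  have h4 := Real.one_sub_inv_le_log_of_pos (x := (64 / 63 : ℝ)) (by norm_num)
  have h5 : Real.log ((64 / 63) * N') ≤ Real.log N := Real.log_le_log (by positivity) (by linarith)
  rw [Real.log_mul (by norm_num) h1.ne'] at h5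
  norm_num at h4
  linarith

theorem Does.searchLoop : ∃ C : ℝ, 0 ≤ C ∧
    ∀ (O : Plane → DgmData) (q : ℕ) (K : PlaneComplex) (n : ℕ) (st : State) (v k : ℕ),
    IsOracleFor K O → AtVertex K n st v → SearchInv K n st v k st →
    Does O q searchLoop st
      (C * (st.F .N 0 + 1 + ((3 * n).size + 1 + q) * Real.log (st.F .N 0))) (fun s =>
      Pres False searchVars st s ∧ (s.queries : ℝ) ≤ st.queries + 64 * Real.log (st.F .N 0) ∧
      s.F .S 0 ∈ ups K n st.px st.py v ∧
      {u | u ∈ ups K n st.px st.py v ∧ st.key v u < st.key v (s.F .S 0)}.ncard = k) := by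
  obtain ⟨A, hA, H⟩ := Does.searchStep
  set t : Test := .natLt (.const 1) (gv .N) with ht
  set cc : ℝ := ((t.cost : ℕ) : ℝ) with hcc
  have hcc0 : 0 ≤ cc := Nat.cast_nonneg _
  refine ⟨64 * (A + cc + 1), by positivity, ?_⟩
  intro O q K n st v k hO hat hinv
  set B : ℝ := A * (((3 * n).size : ℕ) + 1) + q + cc with hB
  have hB0 : 0 ≤ B := by positivity
  -- The linear term of the potential loses at least `A * N`, as `N` drops by `N / 64`, and pays for
  -- handling the candidates. The logarithmic term loses at least `B` and pays for the query, the
  -- binary searches and the test.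
  refine (Does.while (fun s => Pres False searchVars st s ∧
    (s.queries : ℝ) + 64 * Real.log (s.F .N 0) ≤ st.queries + 64 * Real.log (st.F .N 0) ∧
    SearchInv K n st v k s) (fun s => 64 * A * s.F .N 0 + 64 * B * Real.log (s.F .N 0)) ?_ ?_ st
    ⟨Pres.refl st, le_rfl, hinv⟩).mono ?_ ?_
  · intro s _
    have := Real.log_natCast_nonneg (s.F .N 0)
    positivity
  · rintro s ⟨h1, h2, h3⟩ hc
    have hN : 1 < s.F .N 0 := by simpa [ht, Test.eval, NExpr.eval] using hc
    refine ⟨_, (H O q K n st s v k hO hat h1 h3 hN).mono le_rfl ?_⟩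
    rintro s' ⟨h4, h5, h6, h7⟩
    have hpos := h6.pos (ups_finite K n st.px st.py v) (ups_subset K n st.px st.py v)
    have hlog := log_drop hpos h7
    refine ⟨⟨h4, ?_, h6⟩, ?_⟩
    · rw [h5]; push_cast; linarith
    · have h8 : (64 * s'.F .N 0 : ℝ) ≤ 63 * s.F .N 0 := by exact_mod_cast h7
      have h9 := mul_le_mul_of_nonneg_left hlog hB0
      have h10 := mul_le_mul_of_nonneg_left h8 hA
      rw [hB] at h9 ⊢
      linarith
  · have hl := Real.log_natCast_nonneg (st.F .N 0)
    set l := Real.log (st.F .N 0)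
    have e1 : 0 ≤ (((3 * n).size : ℕ) : ℝ) * l := by positivity
    have e2 : 0 ≤ (q : ℝ) * l := by positivity
    have e3 : (0 : ℝ) ≤ st.F .N 0 := Nat.cast_nonneg _
    rw [hB]
    have := mul_nonneg hA e1
    have := mul_nonneg hcc0 e1
    have := mul_nonneg hA e2
    have := mul_nonneg hcc0 e2
    have := mul_nonneg hcc0 e3
    have := mul_nonneg hcc0 hl
    have := mul_nonneg hA hl
    linarith
  · rintro s ⟨⟨h1, h2, h3⟩, hc⟩
    have hpos := h3.pos (ups_finite K n st.px st.py v) (ups_subset K n st.px st.py v)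
    have hN : s.F .N 0 = 1 := by
      have : ¬ 1 < s.F .N 0 := by simpa [ht, Test.eval, NExpr.eval] using hc
      omega
    unfold SearchInv at h3
    rw [hN] at h2 h3
    have := h3.last (ups_finite K n st.px st.py v) (ups_subset K n st.px st.py v)
    refine ⟨h1, ?_, this⟩
    simpa using h2

end RealRAM

/-! ### Ranks -/

/-- The number of elements of `U` with smaller keys. -/
def rankIn (key : ℕ → ℝ) (U : Set ℕ) (u : ℕ) : ℕ := {w | w ∈ U ∧ key w < key u}.ncard

theorem rankIn_lt_rankIn {key : ℕ → ℝ} {U : Set ℕ} (hU : U.Finite) {u w : ℕ} (hu : u ∈ U)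
    (h : key u < key w) : rankIn key U u < rankIn key U w := by
  refine Set.ncard_lt_ncard ⟨fun x hx => ⟨hx.1, hx.2.trans h⟩, fun hsub => ?_⟩
    (hU.subset fun _ h => h.1)
  exact lt_irrefl _ (hsub ⟨hu, h⟩ : u ∈ U ∧ key u < key u).2

theorem rankIn_lt_ncard {key : ℕ → ℝ} {U : Set ℕ} (hU : U.Finite) {u : ℕ} (hu : u ∈ U) :
    rankIn key U u < U.ncard := by
  refine Set.ncard_lt_ncard ⟨fun x hx => hx.1, fun hsub => ?_⟩ hU
  exact lt_irrefl _ (hsub hu : u ∈ U ∧ key u < key u).2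

theorem rankIn_inj {key : ℕ → ℝ} {U : Set ℕ} (hU : U.Finite) (hkey : Set.InjOn key U) {u w : ℕ}
    (hu : u ∈ U) (hw : w ∈ U) (h : rankIn key U u = rankIn key U w) : u = w := by
  rcases lt_trichotomy (key u) (key w) with h1 | h1 | h1
  · exact absurd h (rankIn_lt_rankIn hU hu h1).ne
  · exact hkey hu hw h1
  · exact absurd h (rankIn_lt_rankIn hU hw h1).ne'

theorem bijOn_Iio_succ {α : Type*} {f f' : ℕ → α} {m : ℕ} {E : Set α} {e : α}
    (h : Set.BijOn f (Set.Iio m) E) (he : e ∉ E) (hf : ∀ i < m, f' i = f i) (hm : f' m = e) :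
    Set.BijOn f' (Set.Iio (m + 1)) (insert e E) := by
  have h1 : Set.Iio (m + 1) = insert m (Set.Iio m) := by ext i; simp [Nat.le_iff_lt_or_eq, or_comm]
  rw [h1, ← hm]
  refine Set.BijOn.insert (h.congr fun i hi => (hf i hi).symm) (by rwa [hm])

namespace RealRAM

open IsNumbering

variable {O : Plane → DgmData} {q : ℕ} {s s' : State}

/-! ### The edges going up from a vertex -/

/-- All vertices except `v` become candidates. -/
def fillProg : Prog :=
  .seq (.seq (sv .N (.sub (.mem (.const 0)) (.const 1))) (sv .τ (.add (gv .k) (gv .Lt))))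
    (forLoop .i (gv .N) (.ite (.natLt (gv .i) (gv .v)) (sto .S (gv .i) (gv .i))
      (sto .S (gv .i) (.add (gv .i) (.const 1)))))

theorem Does.fill : ∃ C : ℝ, 0 ≤ C ∧
    ∀ (O : Plane → DgmData) (q : ℕ) (K : PlaneComplex) (n : ℕ) (st : State) (v k : ℕ),
    AtVertex K n st v → st.nats 0 = n → st.F .k 0 = k → k < (ups K n st.px st.py v).ncard →
    st.F .Lt 0 = (downs K n st.px st.py v).ncard →
    Does O q fillProg st (C * (n + 1)) (fun s => Pres True [.i, .N, .τ, .S] st s ∧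
      s.F .N 0 = n - 1 ∧ SearchInv K n st v k s) := by
  set P : Prog := .seq (sv .N (.sub (.mem (.const 0)) (.const 1))) (sv .τ (.add (gv .k) (gv .Lt)))
    with hP
  set Q : Prog := .ite (.natLt (gv .i) (gv .v)) (sto .S (gv .i) (gv .i))
      (sto .S (gv .i) (.add (gv .i) (.const 1))) with hQ
  have t0 := forCost_nonneg .i (gv .N)
  have t1 : (0 : ℝ) ≤ P.time := Nat.cast_nonneg _
  have t2 : (0 : ℝ) ≤ Q.time := Nat.cast_nonneg _
  refine ⟨P.time + (Q.time + forCost .i (gv .N)), by positivity, ?_⟩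
  intro O q K n st v k hat hn hk hkU hLt
  have hvn := hat.lt
  set s1 := (st.set .N 0 (n - 1)).set .τ 0 (k + (downs K n st.px st.py v).ncard) with hs1
  refine Does.step (Does.simple (by simp [Prog.Simple]) (R := fun s => s = s1)
    (by simp [Prog.run, NExpr.eval, hs1, hn, hk, hLt])) ?_
  rintro _ rfl
  have hP1 : Pres True [.i, .N, .τ, .S] st s1 :=
    ((Pres.refl st).set (by simp) _ _).set (by simp) _ _
  refine (Does.forSimple (X := [.S]) (n - 1)
    (fun t s => ∀ i < t, s.F .S i = if i < v then i else i + 1) (by simp) (by simp [Prog.Simple])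
    (by simp) ?_ ?_).mono ?_ ?_
  · intro s hs
    rw [gv_eval, hs.F _ (by simp)]
    simp [hs1]
  · rintro t s ht hs hst h1
    have hv : s.F .v 0 = v := by
      rw [hs.F .v (by simp)]; simp [hs1, hat.v_eq]
    have hrun : Q.run s = s.set .S t (if t < v then t else t + 1) := by
      simp only [hQ, Prog.run, Test.eval, sto_run, NExpr.eval, gv_eval, hst, hv]
      split_ifs <;> rfl
    rw [hrun]
    refine ⟨(Pres.refl s).set (by simp) _ _, ?_⟩
    intro i hi
    rw [State.set_F_of_ne _ (by simp), State.set_F_same]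
    by_cases hit : i = t
    · rw [if_pos hit, hit]
    · rw [if_neg hit, h1 i (by omega)]
  · have hcast : ((n - 1 : ℕ) : ℝ) + 1 = n := by
      rw [Nat.cast_sub (by omega)]; simp
    rw [hcast]
    have : (0 : ℝ) ≤ n := Nat.cast_nonneg _
    nlinarith [mul_nonneg t1 this]
  · rintro s ⟨h1, h2⟩
    have hN : s.F .N 0 = n - 1 := by rw [h1.F _ (by simp)]; simp [hs1]
    have hτ : s.F .τ 0 = k + (downs K n st.px st.py v).ncard := by
      rw [h1.F _ (by simp)]; simp [hs1]
    refine ⟨hP1.trans (h1.mono (by simp) id), hN, ?_⟩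
    unfold SearchInv
    rw [hτ, hN]
    refine narrowed_init ?_ ?_ hkU
    · intro i hi j hj hij
      rw [h2 i hi, h2 j hj] at hij
      split_ifs at hij <;> omega
    · intro u
      simp only [Set.mem_ofPred_eq]
      constructor
      · rintro ⟨i, hi, rfl⟩
        rw [h2 i hi]
        split_ifs <;> omega
      · rintro ⟨h3, h4⟩
        rcases lt_or_gt_of_ne h4 with h5 | h5
        · exact ⟨u, by omega, by rw [h2 u (by omega), if_pos h5]⟩
        · exact ⟨u - 1, by omega, by rw [h2 (u - 1) (by omega), if_neg (by omega)]; omega⟩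

/-- The edge number `i` in scratch memory. -/
def State.arc (s : State) (i : ℕ) : ℕ × ℕ := (s.F .e₀ i, s.F .e₁ i)

/-- Record the edge found by the search. -/
def recordProg : Prog :=
  .seq (sto .e₀ (gv .m) (gv .v)) (.seq (sto .e₁ (gv .m) (gv .S)) (sv .m (.add (gv .m) (.const 1))))

/-- Find and record the edge number `k` going up from `v`. -/
def edgeStep : Prog := .seq fillProg (.seq searchLoop recordProg)

/-- The arrays changed by the search for an edge. -/
def edgeVars : List Var := [.i, .e₀, .e₁, .m] ++ searchVars

theorem Does.edgeStep : ∃ C : ℝ, 0 ≤ C ∧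
    ∀ (O : Plane → DgmData) (q : ℕ) (K : PlaneComplex) (n : ℕ) (st : State) (v k m : ℕ),
    IsOracleFor K O → AtVertex K n st v → st.nats 0 = n → st.F .k 0 = k →
    k < (ups K n st.px st.py v).ncard → st.F .Lt 0 = (downs K n st.px st.py v).ncard →
    st.F .m 0 = m →
    Does O q edgeStep st (C * (n + 1 + ((3 * n).size + 1 + q) * Real.log n)) (fun s =>
      Pres False edgeVars st s ∧ (s.queries : ℝ) ≤ st.queries + 64 * Real.log n ∧
      s.F .m 0 = m + 1 ∧ (∀ i < m, s.arc i = st.arc i) ∧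
      ∃ u ∈ ups K n st.px st.py v, s.arc m = (v, u) ∧
        rankIn (st.key v) (ups K n st.px st.py v) u = k) := by
  obtain ⟨C₁, hC₁, H₁⟩ := Does.fill
  obtain ⟨C₂, hC₂, H₂⟩ := Does.searchLoop
  have t1 : (0 : ℝ) ≤ recordProg.time := Nat.cast_nonneg _
  refine ⟨C₁ + C₂ + recordProg.time, by positivity, ?_⟩
  intro O q K n st v k m hO hat hn hk hkU hLt hm
  have hvn := hat.lt
  refine Does.step (H₁ O q K n st v k hat hn hk hkU hLt) ?_
  rintro s1 ⟨p1, hN1, hinv⟩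
  have hat1 : AtVertex K n s1 v := ⟨by rw [p1.px, p1.py]; exact hat.num, hat.lt,
    by rw [p1.F .v (by simp), hat.v_eq],
    by rw [p1.px, p1.py, p1.F .nb (by simp)]; exact hat.flag,
    by rw [p1.px, p1.py, p1.F .nb (by simp)]; exact hat.not_flag⟩
  refine Does.step (H₂ O q K n s1 v k hO hat1 (by
    unfold SearchInv at hinv ⊢; rw [p1.px, p1.py, p1.key]; exact hinv)) ?_
  rintro s2 ⟨p2, hq2, hu, hrank⟩
  rw [p1.px, p1.py] at hu hrank
  rw [p1.key] at hrank
  have hlog : Real.log (s1.F .N 0) ≤ Real.log n := by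
    rw [hN1]
    rcases Nat.eq_zero_or_pos (n - 1) with h0 | h0
    · rw [h0]; simpa using Real.log_natCast_nonneg n
    · exact Real.log_le_log (by exact_mod_cast h0) (by exact_mod_cast Nat.sub_le n 1)
  have hm2 : s2.F .m 0 = m := by
    rw [p2.F .m (by simp [searchVars]), p1.F .m (by simp), hm]
  have hv2 : s2.F .v 0 = v := by
    rw [p2.F .v (by simp [searchVars]), p1.F .v (by simp), hat.v_eq]
  have he₀ : s2.F .e₀ = st.F .e₀ := by
    rw [p2.F .e₀ (by simp [searchVars]), p1.F .e₀ (by simp)]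
  have he₁ : s2.F .e₁ = st.F .e₁ := by
    rw [p2.F .e₁ (by simp [searchVars]), p1.F .e₁ (by simp)]
  refine (Does.simple (by simp [recordProg, Prog.Simple]) (R := fun s => s =
    ((s2.set .e₀ m v).set .e₁ m (s2.F .S 0)).set .m 0 (m + 1))
    (by simp [recordProg, Prog.run, NExpr.eval, hm2, hv2])).mono ?_ ?_
  · have hN : (s1.F .N 0 : ℝ) ≤ n := by
      rw [hN1]; exact_mod_cast Nat.sub_le n 1
    have hl := Real.log_natCast_nonneg n
    set L : ℝ := (((3 * n).size : ℕ) : ℝ) + 1 + q with hL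
    have hL0 : 0 ≤ L := by positivity
    have e1 := mul_le_mul_of_nonneg_left hlog hL0
    have e2 : C₂ * (s1.F .N 0 + 1 + L * Real.log (s1.F .N 0)) ≤ C₂ * (n + 1 + L * Real.log n) :=
      mul_le_mul_of_nonneg_left (by linarith) hC₂
    have e3 : 0 ≤ L * Real.log n := mul_nonneg hL0 hl
    have e4 := mul_nonneg hC₁ e3
    have e5 := mul_nonneg t1 e3
    have e6 : (0 : ℝ) ≤ n := Nat.cast_nonneg _
    have e7 := mul_nonneg t1 e6
    linarith
  · rintro _ rfl
    refine ⟨?_, ?_, by simp, ?_, s2.F .S 0, hu, by simp [State.arc], hrank⟩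
    · refine ((Pres.set ?_ ?_ _ _).set ?_ _ _).set ?_ _ _
      · exact (p1.mono (by simp [edgeVars, searchVars]) (by simp)).trans
          (p2.mono (List.subset_append_right _ _) id)
      all_goals simp [edgeVars]
    · simp only [State.set_queries]
      rw [p1.queries trivial] at hq2
      linarith
    · intro i hi
      simp [State.arc, State.set_F_same, he₀, he₁, hi.ne]

/-- Find and record all edges going up from `v`. -/
def edgeLoop : Prog := forLoop .k (gv .U) edgeStep

/-- The search number `k` finds the neighbour of rank `k`. Ranks are injective, so no edge is
recorded twice, and all ranks lie below the number of up-edges, so none is missed. -/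
theorem Does.edgeLoop : ∃ C : ℝ, 0 ≤ C ∧
    ∀ (O : Plane → DgmData) (q : ℕ) (K : PlaneComplex) (n : ℕ) (st : State) (v m : ℕ)
      (E : Set (ℕ × ℕ)),
    IsOracleFor K O → AtVertex K n st v → st.nats 0 = n →
    st.F .U 0 = (ups K n st.px st.py v).ncard → st.F .Lt 0 = (downs K n st.px st.py v).ncard →
    st.F .m 0 = m → Set.BijOn st.arc (Set.Iio m) E → (∀ u, (v, u) ∉ E) →
    Does O q edgeLoop st
      (C * ((ups K n st.px st.py v).ncard * (n + 1 + ((3 * n).size + 1 + q) * Real.log n) + 1))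
      (fun s => Pres False (.k :: edgeVars) st s ∧
        (s.queries : ℝ) ≤ st.queries + 64 * (ups K n st.px st.py v).ncard * Real.log n ∧
        s.F .m 0 = m + (ups K n st.px st.py v).ncard ∧
        Set.BijOn s.arc (Set.Iio (m + (ups K n st.px st.py v).ncard))
          (E ∪ {p | p.1 = v ∧ p.2 ∈ ups K n st.px st.py v})) := by
  obtain ⟨C, hC, H⟩ := Does.edgeStep
  have t0 := forCost_nonneg .k (gv .U)
  refine ⟨C + forCost .k (gv .U), by positivity, ?_⟩
  intro O q K n st v m E hO hat hn hU hLt hm hE hvE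
  set Us := ups K n st.px st.py v with hUs
  have hfin : Us.Finite := ups_finite K n st.px st.py v
  have hkey : Set.InjOn (st.key v) Us := fun a ha b hb he =>
    hat.num.key_inj hat.lt (ups_subset _ _ _ _ _ ha).1 (ups_subset _ _ _ _ _ hb).1
      (ups_subset _ _ _ _ _ ha).2 (ups_subset _ _ _ _ _ hb).2 he
  let Inv : ℕ → State → Prop := fun k s =>
    (s.queries : ℝ) ≤ st.queries + 64 * k * Real.log n ∧ s.F .m 0 = m + k ∧
    Set.BijOn s.arc (Set.Iio (m + k))
      (E ∪ {p | p.1 = v ∧ p.2 ∈ Us ∧ rankIn (st.key v) Us p.2 < k})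
  have harc : ∀ (s : State) (w : ℕ), (s.set .k 0 w).arc = s.arc := by
    intro s w; funext i; simp [State.arc]
  refine (Does.for (quiet := False) (X := edgeVars) Us.ncard
    (fun _ => C * (n + 1 + ((3 * n).size + 1 + q) * Real.log n)) Inv (by simp [edgeVars, searchVars])
    (fun _ => ?_) ?_ ?_ ?_).mono ?_ ?_
  · have := Real.log_natCast_nonneg n
    positivity
  · refine ⟨by simp, by simp [hm], ?_⟩
    rw [harc]
    simpa using hE
  · intro s hs
    rw [gv_eval, hs.F _ (by simp [edgeVars, searchVars]), hU]
  · rintro k s hk hs hsk ⟨h1, h2, h3⟩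
    have hats : AtVertex K n s v := ⟨by rw [hs.px, hs.py]; exact hat.num, hat.lt,
      by rw [hs.F .v (by simp [edgeVars, searchVars]), hat.v_eq],
      by rw [hs.px, hs.py, hs.F .nb (by simp [edgeVars, searchVars])]; exact hat.flag,
      by rw [hs.px, hs.py, hs.F .nb (by simp [edgeVars, searchVars])]; exact hat.not_flag⟩
    refine (H O q K n s v k (m + k) hO hats (by rw [hs.nats_zero, hn]) hsk
      (by rw [hs.px, hs.py]; exact hk)
      (by rw [hs.px, hs.py, hs.F .Lt (by simp [edgeVars, searchVars]), hLt]) h2).mono le_rfl ?_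
    rintro s' ⟨p', hq', hm', harc', u, hu, hmu, hrank⟩
    rw [hs.px, hs.py, ← hUs] at hu hrank
    rw [hs.key] at hrank
    refine ⟨p', ?_, ?_, ?_⟩
    · simp only [State.set_queries]
      push_cast
      linarith
    · simp [hm']; ring
    · rw [harc]
      have hset : E ∪ {p : ℕ × ℕ | p.1 = v ∧ p.2 ∈ Us ∧ rankIn (st.key v) Us p.2 < k + 1} =
          insert (v, u) (E ∪ {p | p.1 = v ∧ p.2 ∈ Us ∧ rankIn (st.key v) Us p.2 < k}) := by
        ext ⟨a, b⟩
        simp only [Set.mem_union, Set.mem_ofPred_eq, Set.mem_insert_iff, Prod.mk.injEq]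
        constructor
        · rintro (h | ⟨h4, h5, h6⟩)
          · exact Or.inr (Or.inl h)
          · rcases Nat.lt_succ_iff_lt_or_eq.1 h6 with h7 | h7
            · exact Or.inr (Or.inr ⟨h4, h5, h7⟩)
            · exact Or.inl ⟨h4, rankIn_inj hfin hkey h5 hu (h7.trans hrank.symm)⟩
        · rintro (⟨rfl, rfl⟩ | h | ⟨h4, h5, h6⟩)
          · exact Or.inr ⟨rfl, hu, by omega⟩
          · exact Or.inl h
          · exact Or.inr ⟨h4, h5, by omega⟩
      rw [hset]
      refine bijOn_Iio_succ h3 ?_ harc' hmu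
      rintro (h | ⟨-, -, h⟩)
      · exact hvE u h
      · simp only at h
        omega
  · simp only [Finset.sum_const, Finset.card_range, nsmul_eq_mul]
    have hl := Real.log_natCast_nonneg n
    set T : ℝ := n + 1 + ((((3 * n).size : ℕ) : ℝ) + 1 + q) * Real.log n with hT
    have hT1 : 1 ≤ T := by
      have : (0 : ℝ) ≤ n + ((((3 * n).size : ℕ) : ℝ) + 1 + q) * Real.log n := by positivity
      linarith
    have e1 : (0 : ℝ) ≤ Us.ncard := Nat.cast_nonneg _
    have e2 := mul_nonneg (mul_nonneg e1 t0) (sub_nonneg.2 hT1)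
    linarith
  · rintro s ⟨h1, h2, h3, h4⟩
    refine ⟨h1, h2, h3, ?_⟩
    convert h4 using 3
    ext ⟨a, b⟩
    constructor
    · rintro ⟨h5, h6⟩; exact ⟨h5, h6, rankIn_lt_ncard hfin h6⟩
    · rintro ⟨h5, h6, -⟩; exact ⟨h5, h6⟩

end RealRAM

namespace RealRAM

open IsNumbering

variable {O : Plane → DgmData} {q : ℕ} {s s' : State}

/-! ### The known neighbours of a vertex -/

/-- Flag the lower endpoint of the recorded edge `i` if its upper endpoint is `v`. -/
def flagStep : Prog :=
  .ite (.natLt (ld .e₁ (gv .i)) (gv .v)) .skip (.ite (.natLt (gv .v) (ld .e₁ (gv .i))) .skip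
    (.seq (sto .nb (ld .e₀ (gv .i)) (.const 1)) (sv .Lt (.add (gv .Lt) (.const 1)))))

/-- Flag and count the lower endpoints of the recorded edges with upper endpoint `v`. -/
def flagProg : Prog :=
  .seq (forLoop .i (.mem (.const 0)) (sto .nb (gv .i) (.const 0)))
    (.seq (sv .Lt (.const 0)) (forLoop .i (gv .m) flagStep))

/-- Recorded edges with the same upper endpoint differ in the lower one, so counting records counts
neighbours. -/
theorem ncard_preimage_arc {st : State} {m v : ℕ} {E : Set (ℕ × ℕ)}
    (hE : Set.BijOn st.arc (Set.Iio m) E) [DecidablePred fun j => st.F .e₁ j = v] :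
    Nat.count (fun j => st.F .e₁ j = v) m = {a | (a, v) ∈ E}.ncard := by
  rw [Nat.count_eq_card_filter_range, ← Finset.card_image_of_injOn (f := st.F .e₀),
    ← Set.ncard_coe_finset]
  · congr 1
    ext a
    simp only [Finset.coe_image, Finset.coe_filter, Finset.mem_range, Set.mem_image, Set.mem_ofPred_eq]
    constructor
    · rintro ⟨j, ⟨hj, hv⟩, rfl⟩
      have := hE.mapsTo hj
      rwa [State.arc, hv] at this
    · intro ha
      obtain ⟨j, hj, he⟩ := hE.surjOn ha
      rw [State.arc, Prod.mk.injEq] at he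
      exact ⟨j, ⟨hj, he.2⟩, he.1⟩
  · intro i hi j hj hij
    simp only [Finset.coe_filter, Finset.mem_range, Set.mem_ofPred_eq] at hi hj
    exact hE.injOn hi.1 hj.1 (by rw [State.arc, State.arc, hij, hi.2, hj.2])

theorem Does.flag : ∃ C : ℝ, 0 ≤ C ∧
    ∀ (O : Plane → DgmData) (q : ℕ) (n : ℕ) (st : State) (v m : ℕ) (E : Set (ℕ × ℕ)),
    st.nats 0 = n → st.F .v 0 = v → st.F .m 0 = m → Set.BijOn st.arc (Set.Iio m) E →
    Does O q flagProg st (C * (n + m + 1)) (fun s => Pres True [.i, .nb, .Lt] st s ∧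
      (∀ u < n, (u, v) ∈ E → s.F .nb u = 1) ∧ (∀ u < n, (u, v) ∉ E → s.F .nb u = 0) ∧
      s.F .Lt 0 = {a | (a, v) ∈ E}.ncard) := by
  classical
  set P : Prog := sto .nb (gv .i) (.const 0) with hP
  have t0 := forCost_nonneg .i (.mem (.const 0))
  have t1 := forCost_nonneg .i (gv .m)
  have t2 : (0 : ℝ) ≤ P.time := Nat.cast_nonneg _
  have t3 : (0 : ℝ) ≤ flagStep.time := Nat.cast_nonneg _
  have t4 : (0 : ℝ) ≤ (sv .Lt (.const 0)).time := Nat.cast_nonneg _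
  refine ⟨P.time + forCost .i (.mem (.const 0)) + (sv .Lt (.const 0)).time +
    (flagStep.time + forCost .i (gv .m)), by positivity, ?_⟩
  intro O q n st v m E hn hv hm hE
  refine Does.step (Does.forSimple (X := [.nb]) n (fun t s => ∀ u < t, s.F .nb u = 0) (by simp)
    (by simp) (by simp) ?_ ?_) ?_
  · intro s hs
    simp [NExpr.eval, hs.nats_zero, hn]
  · rintro t s ht hs hst h1
    have hrun : P.run s = s.set .nb t 0 := by simp [hP, NExpr.eval, hst]
    rw [hrun]
    refine ⟨(Pres.refl s).set (by simp) _ _, ?_⟩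
    intro u hu
    rw [State.set_F_of_ne _ (by simp), State.set_F_same]
    split_ifs with h
    · rfl
    · exact h1 u (by omega)
  rintro s1 ⟨p1, h1⟩
  refine Does.step (Does.simple (sv_simple _ _) (R := fun s => s = s1.set .Lt 0 0)
    (by simp [NExpr.eval])) ?_
  rintro _ rfl
  set s2 := s1.set .Lt 0 0 with hs2
  have p2 : Pres True [.i, .nb, .Lt] st s2 := (p1.mono (by simp) id).set (by simp) _ _
  refine (Does.forSimple (X := [.nb, .Lt]) m (fun t s =>
    (∀ u < n, s.F .nb u = if ∃ j < t, st.arc j = (u, v) then 1 else 0) ∧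
    s.F .Lt 0 = Nat.count (fun j => st.F .e₁ j = v) t) (by simp) (by simp [flagStep, Prog.Simple])
    ?_ ?_ ?_).mono ?_ ?_
  · refine ⟨fun u hu => ?_, by simp [hs2]⟩
    simp [hs2, h1 u hu]
  · intro s hs
    rw [gv_eval, hs.F _ (by simp), p2.F _ (by simp), hm]
  · rintro t s ht hs hst ⟨h2, h3⟩
    have hp := p2.trans (hs.mono (by simp) id : Pres True [.i, .nb, .Lt] s2 s)
    have he₀ : s.F .e₀ = st.F .e₀ := hp.F _ (by simp)
    have he₁ : s.F .e₁ = st.F .e₁ := hp.F _ (by simp)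
    have hvs : s.F .v 0 = v := by rw [hp.F .v (by simp), hv]
    have hrun : flagStep.run s = if st.F .e₁ t = v then
        (s.set .nb (st.F .e₀ t) 1).set .Lt 0 (s.F .Lt 0 + 1) else s := by
      simp only [flagStep, Prog.run, Test.eval, NExpr.eval, ld_eval, gv_eval, sto_run, sv_run, hst,
        he₀, he₁, hvs, ne_eq, reduceCtorEq, not_false_eq_true, State.set_F_of_ne]
      split_ifs <;> first | rfl | omega
    rw [hrun, Nat.count_succ]
    by_cases h : st.F .e₁ t = v
    · rw [if_pos h, if_pos h]
      refine ⟨((Pres.refl s).set (by simp) _ _).set (by simp) _ _, ?_, by simp [h3]⟩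
      intro u hu
      simp only [ne_eq, reduceCtorEq, not_false_eq_true, State.set_F_of_ne, State.set_F_same]
      rw [h2 u hu]
      by_cases hut : u = st.F .e₀ t
      · rw [if_pos hut, if_pos ⟨t, t.lt_succ_self, by rw [State.arc, h, hut]⟩]
      · rw [if_neg hut]
        congr 1
        apply propext
        constructor
        · rintro ⟨j, hj, hj'⟩; exact ⟨j, by omega, hj'⟩
        · rintro ⟨j, hj, hj'⟩
          rcases Nat.lt_succ_iff_lt_or_eq.1 hj with h4 | rfl
          · exact ⟨j, h4, hj'⟩
          · rw [State.arc, Prod.mk.injEq] at hj'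
            exact absurd hj'.1.symm hut
    · rw [if_neg h, if_neg h]
      refine ⟨Pres.refl s, ?_, by simp [h3]⟩
      intro u hu
      rw [State.set_F_of_ne _ (by simp), h2 u hu]
      congr 1
      apply propext
      constructor
      · rintro ⟨j, hj, hj'⟩; exact ⟨j, by omega, hj'⟩
      · rintro ⟨j, hj, hj'⟩
        rcases Nat.lt_succ_iff_lt_or_eq.1 hj with h4 | rfl
        · exact ⟨j, h4, hj'⟩
        · rw [State.arc, Prod.mk.injEq] at hj'
          exact absurd hj'.2 h
  · have e1 : (0 : ℝ) ≤ n := Nat.cast_nonneg _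
    have e2 : (0 : ℝ) ≤ m := Nat.cast_nonneg _
    have f0 := mul_nonneg t0 e2
    have f1 := mul_nonneg t1 e1
    have f2 := mul_nonneg t2 e2
    have f3 := mul_nonneg t3 e1
    have f4 := mul_nonneg t4 e1
    have f5 := mul_nonneg t4 e2
    linarith
  · rintro s ⟨h2, h3, h4⟩
    have hiff : ∀ u, (∃ j < m, st.arc j = (u, v)) ↔ (u, v) ∈ E := fun u =>
      ⟨fun ⟨j, hj, he⟩ => he ▸ hE.mapsTo hj, fun h => hE.surjOn h⟩
    refine ⟨p2.trans (h2.mono (by simp) id), fun u hu h => ?_, fun u hu h => ?_, ?_⟩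
    · rw [h3 u hu, if_pos ((hiff u).2 h)]
    · rw [h3 u hu, if_neg (mt (hiff u).1 h)]
    · rw [h4, ncard_preimage_arc hE]

/-! ### The treatment of a vertex -/

/-- Find all edges going up from the vertex number `h` in the order of heights. -/
def vertexStep : Prog :=
  .seq (sv .v (ld .ord (gv .h))) (.seq flagProg (.seq downProg (.seq (sv .U (gv .c)) edgeLoop)))

/-- The arrays changed by the treatment of a vertex. -/
def vertexVars : List Var := [.v, .nb, .Lt, .U, .k] ++ edgeVars

/-- The recorded set `E` must contain precisely the down-edges among the edges ending at `v`, and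
nothing starting at `v`. The treatment by increasing heights ensures both. -/
theorem Does.vertexStep : ∃ C : ℝ, 0 ≤ C ∧
    ∀ (O : Plane → DgmData) (q : ℕ) (K : PlaneComplex) (n : ℕ) (st : State) (v m : ℕ)
      (E : Set (ℕ × ℕ)),
    IsOracleFor K O → IsNumbering K n st.px st.py → st.nats 0 = n → v < n →
    st.F .ord (st.F .h 0) = v → st.F .m 0 = m → Set.BijOn st.arc (Set.Iio m) E →
    (∀ u, (v, u) ∉ E) → (∀ u, (u, v) ∈ E ↔ u ∈ downs K n st.px st.py v) →
    Does O q vertexStep st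
      (C * ((ups K n st.px st.py v).ncard * (n + 1 + ((3 * n).size + 1 + q) * Real.log n) +
        (n + m + (3 * n).size + 1)) + q)
      (fun s => Pres False vertexVars st s ∧
        (s.queries : ℝ) ≤ st.queries + 1 + 64 * (ups K n st.px st.py v).ncard * Real.log n ∧
        s.F .m 0 = m + (ups K n st.px st.py v).ncard ∧
        Set.BijOn s.arc (Set.Iio (m + (ups K n st.px st.py v).ncard))
          (E ∪ {p | p.1 = v ∧ p.2 ∈ ups K n st.px st.py v})) := by
  obtain ⟨C₁, hC₁, H₁⟩ := Does.flag
  obtain ⟨C₂, hC₂, H₂⟩ := Does.down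
  obtain ⟨C₃, hC₃, H₃⟩ := Does.edgeLoop
  have t1 : (0 : ℝ) ≤ (sv .v (ld .ord (gv .h))).time := Nat.cast_nonneg _
  have t2 : (0 : ℝ) ≤ (sv .U (gv .c)).time := Nat.cast_nonneg _
  refine ⟨(sv .v (ld .ord (gv .h))).time + C₁ + C₂ + (sv .U (gv .c)).time + C₃, by positivity, ?_⟩
  intro O q K n st v m E hO hnum hn hvn hord hm hE hvE hdowns
  set s1 := st.set .v 0 v with hs1
  refine Does.step (Does.simple (sv_simple _ _) (R := fun s => s = s1)
    (by simp [hs1, hord])) ?_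
  rintro _ rfl
  have harc1 : s1.arc = st.arc := by funext i; simp [hs1, State.arc]
  refine Does.step (H₁ O q n s1 v m E (by simp [hs1, hn]) (by simp [hs1]) (by simp [hs1, hm])
    (by rwa [harc1])) ?_
  rintro s2 ⟨p2, hf, hnf, hLt⟩
  have hv2 : s2.F .v 0 = v := by rw [p2.F _ (by simp)]; simp [hs1]
  refine Does.step (H₂ O q K n s2 v hO (by rw [p2.px, p2.py]; exact hnum) hv2 hvn) ?_
  rintro s3 ⟨p3, hq3, hc3⟩
  have q2 : Pres False vertexVars st s2 :=
    ((Pres.refl st).set (x := .v) (by simp [vertexVars]) 0 v).trans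
      (p2.mono (by simp [vertexVars, edgeVars]) (by simp))
  have q3 : Pres False vertexVars st s3 :=
    q2.trans (p3.mono (by simp [vertexVars, edgeVars, searchVars]) id)
  rw [q2.px, q2.py] at hc3
  set Us := ups K n st.px st.py v with hUs
  set s4 := s3.set .U 0 Us.ncard with hs4
  refine Does.step (Does.simple (sv_simple _ _) (R := fun s => s = s4)
    (by simp [hs4, hc3])) ?_
  rintro _ rfl
  have q4 : Pres False vertexVars st s4 := q3.set (by simp [vertexVars]) _ _
  have hds : {a | (a, v) ∈ E} = downs K n st.px st.py v := Set.ext hdowns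
  have hnb : s4.F .nb = s2.F .nb := by rw [hs4, State.set_F_of_ne _ (by simp), p3.F _ (by simp)]
  have harc4 : s4.arc = st.arc := by
    funext i
    simp only [State.arc, hs4, ne_eq, reduceCtorEq, not_false_eq_true, State.set_F_of_ne]
    rw [p3.F .e₀ (by simp), p3.F .e₁ (by simp), p2.F .e₀ (by simp), p2.F .e₁ (by simp)]
    simp [hs1]
  have hat : AtVertex K n s4 v := ⟨by rw [q4.px, q4.py]; exact hnum, hvn,
    by rw [hs4, State.set_F_of_ne _ (by simp), p3.F _ (by simp), hv2],
    by rw [q4.px, q4.py, hnb]; exact fun u hu hd => hf u hu ((hdowns u).2 hd),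
    by rw [q4.px, q4.py, hnb]; exact fun u hu hd => hnf u hu fun h => hd ((hdowns u).1 h)⟩
  refine (H₃ O q K n s4 v m E hO hat (by rw [q4.nats_zero, hn])
    (by rw [q4.px, q4.py, hs4, State.set_F_self])
    (by rw [q4.px, q4.py, ← hds, hs4, State.set_F_of_ne _ (by simp), p3.F _ (by simp), hLt])
    (by rw [hs4, State.set_F_of_ne _ (by simp), p3.F _ (by simp), p2.F _ (by simp)]; simp [hs1, hm])
    (by rwa [harc4]) hvE).mono ?_ ?_
  · rw [q4.px, q4.py, ← hUs]
    have e1 : (0 : ℝ) ≤ n := Nat.cast_nonneg _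
    have e2 : (0 : ℝ) ≤ m := Nat.cast_nonneg _
    have e3 : (0 : ℝ) ≤ ((3 * n).size : ℕ) := Nat.cast_nonneg _
    have hl := Real.log_natCast_nonneg n
    set Sz : ℝ := (((3 * n).size : ℕ) : ℝ) with hSz
    have e4 : (0 : ℝ) ≤ Us.ncard * (n + 1 + (Sz + 1 + q) * Real.log n) := by positivity
    set W := Us.ncard * (n + 1 + (Sz + 1 + q) * Real.log n)
    have f1 : 0 ≤ (sv .v (ld .ord (gv .h))).time * (W + (n + m + Sz)) := by positivity
    have f2 : 0 ≤ (sv .U (gv .c)).time * (W + (n + m + Sz)) := by positivity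
    have f3 : 0 ≤ C₁ * (W + Sz) := by positivity
    have f4 : 0 ≤ C₂ * (W + (n + m)) := by positivity
    have f5 : 0 ≤ C₃ * (n + m + Sz) := by positivity
    linarith
  · rw [q4.px, q4.py, ← hUs]
    rintro s ⟨h1, h2, h3, h4⟩
    refine ⟨q4.trans (h1.mono (by intro y hy; simp [vertexVars] at hy ⊢; tauto) id), ?_, h3, h4⟩
    have : s4.queries = st.queries + 1 := by
      rw [hs4, State.set_queries, hq3, p2.queries trivial]; rfl
    rw [this] at h2
    push_cast at h2
    exact h2

end RealRAM

namespace RealRAM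

open IsNumbering

variable {O : Plane → DgmData} {q : ℕ} {s s' : State}

/-! ### The order of the heights -/

/-- Count the points below the point number `h`. -/
def heightStep : Prog :=
  .ite (.realLt (ye (gv .i)) (ye (gv .h))) (sv .r (.add (gv .r) (.const 1))) .skip

/-- Sort the vertices by height. -/
def orderProg : Prog :=
  forLoop .h (.mem (.const 0)) (.seq (sv .r (.const 0))
    (.seq (forLoop .i (.mem (.const 0)) heightStep) (sto .ord (gv .r) (gv .h))))

theorem rankIn_Iio (Y : ℕ → ℝ) (n u : ℕ) [DecidablePred fun i => Y i < Y u] :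
    rankIn Y (Set.Iio n) u = Nat.count (fun i => Y i < Y u) n := by
  rw [Nat.count_eq_card_filter_range, ← Set.ncard_coe_finset, rankIn]
  congr 1
  ext i
  simp

/-- Each vertex is written to the position given by its rank. Distinct heights give distinct ranks,
so no entry is overwritten. -/
theorem Does.order : ∃ C : ℝ, 0 ≤ C ∧
    ∀ (O : Plane → DgmData) (q : ℕ) (n : ℕ) (st : State), st.nats 0 = n →
    Set.InjOn st.py (Set.Iio n) →
    Does O q orderProg st (C * ((n + 1) * (n + 1))) (fun s => Pres True [.h, .r, .i, .ord] st s ∧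
      ∀ u < n, s.F .ord (rankIn st.py (Set.Iio n) u) = u) := by
  classical
  have t0 := forCost_nonneg .h (.mem (.const 0))
  have t1 := forCost_nonneg .i (.mem (.const 0))
  have t2 : (0 : ℝ) ≤ (sv .r (.const 0)).time := Nat.cast_nonneg _
  have t3 : (0 : ℝ) ≤ heightStep.time := Nat.cast_nonneg _
  have t4 : (0 : ℝ) ≤ (sto .ord (gv .r) (gv .h)).time := Nat.cast_nonneg _
  refine ⟨(sv .r (.const 0)).time + (heightStep.time + forCost .i (.mem (.const 0))) +
    (sto .ord (gv .r) (gv .h)).time + forCost .h (.mem (.const 0)), by positivity, ?_⟩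
  intro O q n st hn hY
  set R := rankIn st.py (Set.Iio n) with hR
  have hRinj : ∀ u < n, ∀ w < n, R u = R w → u = w := fun u hu w hw h =>
    rankIn_inj (Set.finite_Iio n) hY hu hw h
  refine (Does.for (quiet := True) (X := [.r, .i, .ord]) n
    (fun _ => (sv .r (.const 0)).time + (((n : ℝ) + 1) * (heightStep.time +
      forCost .i (.mem (.const 0))) + (sto .ord (gv .r) (gv .h)).time))
    (fun t s => ∀ u < t, s.F .ord (R u) = u) (by simp) (fun _ => by positivity) (by simp) ?_ ?_).mono
    ?_ ?_
  · intro s hs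
    simp [NExpr.eval, hs.nats_zero, hn]
  · rintro t s ht hs hst h1
    refine Does.seq (R' := fun s1 => s1 = s.set .r 0 0) (Does.simple (sv_simple _ _)
      (by simp [NExpr.eval])) ?_
    rintro _ rfl
    refine Does.seq (Does.forSimple (X := [.r]) n (fun i s' =>
      s'.F .r 0 = Nat.count (fun j => st.py j < st.py t) i) (by simp)
      (by simp [heightStep, Prog.Simple]) (by simp) ?_ ?_) ?_
    · intro s' hs'
      simp [NExpr.eval, hs'.nats_zero, hs.nats_zero, hn]
    · rintro i s' hi hs' hsi h2
      have hh : s'.F .h 0 = t := by rw [hs'.F .h (by simp)]; simp [hst]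
      have hpy : s'.py = st.py := by rw [hs'.py, State.set_py, hs.py]
      simp only [heightStep, Prog.run, Test.eval, ye_eval, gv_eval, hsi, hh, hpy, sv_run, NExpr.eval,
        h2]
      rw [Nat.count_succ]
      split_ifs with h
      · exact ⟨(Pres.refl s').set (by simp) _ _, by simp⟩
      · exact ⟨Pres.refl s', by simp [h2]⟩
    · rintro s1 ⟨p1, h2⟩
      have hR1 : s1.F .r 0 = R t := by rw [h2, hR, rankIn_Iio]
      have hh1 : s1.F .h 0 = t := by rw [p1.F .h (by simp)]; simp [hst]
      refine Does.simple (sto_simple _ _ _) ?_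
      rw [sto_run, gv_eval, gv_eval, hR1, hh1]
      refine ⟨?_, ?_⟩
      · exact (((Pres.refl s).set (by simp) _ _).trans (p1.mono (by simp) id)).set (by simp) _ _
      · intro u hu
        rw [State.set_F_of_ne _ (by simp), State.set_F_same]
        by_cases h : R u = R t
        · rw [if_pos h, hRinj t ht u (by omega) h.symm]
        · rw [if_neg h, p1.F .ord (by simp), State.set_F_of_ne _ (by simp), h1 u]
          rcases Nat.lt_succ_iff_lt_or_eq.1 hu with h3 | rfl
          · exact h3
          · exact absurd rfl h
  · simp only [Finset.sum_const, Finset.card_range, nsmul_eq_mul]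
    have e1 : (0 : ℝ) ≤ n := Nat.cast_nonneg _
    have f1 : (0 : ℝ) ≤ (sv .r (.const 0)).time * ((n : ℝ) * n + n + 1) := by positivity
    have f2 : (0 : ℝ) ≤ (heightStep.time + forCost .i (.mem (.const 0))) * ((n : ℝ) + 1) := by
      positivity
    have f3 : (0 : ℝ) ≤ (sto .ord (gv .r) (gv .h)).time * ((n : ℝ) * n + n + 1) := by positivity
    have f4 : (0 : ℝ) ≤ forCost .h (.mem (.const 0)) * ((n : ℝ) * (n + 1)) := by positivity
    linarith
  · rintro s ⟨h1, h2⟩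
    exact ⟨h1, h2⟩

/-! ### All edges -/

/-- The edges going up from the lowest `t` vertices. -/
def lowEdges (K : PlaneComplex) (n : ℕ) (X Y : ℕ → ℝ) (t : ℕ) : Set (ℕ × ℕ) :=
  {p | UpEdge K n X Y p.1 p.2 ∧ rankIn Y (Set.Iio n) p.1 < t}

section

variable {K : PlaneComplex} {n : ℕ} {X Y : ℕ → ℝ}

theorem lowEdges_finite (K : PlaneComplex) (n : ℕ) (X Y : ℕ → ℝ) (t : ℕ) :
    (lowEdges K n X Y t).Finite :=
  ((Set.finite_Iio n).prod (Set.finite_Iio n)).subset fun _ h => ⟨h.1.1, h.1.2.1⟩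

theorem lowEdges_all (K : PlaneComplex) (n : ℕ) (X Y : ℕ → ℝ) :
    lowEdges K n X Y n = {p | UpEdge K n X Y p.1 p.2} := by
  ext p
  refine ⟨fun h => h.1, fun h => ⟨h, ?_⟩⟩
  have := rankIn_lt_ncard (key := Y) (Set.finite_Iio n) (show p.1 ∈ Set.Iio n from h.1)
  simpa [Set.ncard_eq_toFinset_card'] using this

theorem lowEdges_succ (h : IsNumbering K n X Y) {v : ℕ} (hv : v < n) :
    lowEdges K n X Y (rankIn Y (Set.Iio n) v + 1) =
      lowEdges K n X Y (rankIn Y (Set.Iio n) v) ∪ {p | p.1 = v ∧ p.2 ∈ ups K n X Y v} := by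
  ext ⟨a, b⟩
  constructor
  · rintro ⟨h1, h2⟩
    rcases Nat.lt_succ_iff_lt_or_eq.1 h2 with h3 | h3
    · exact Or.inl ⟨h1, h3⟩
    · have : a = v := rankIn_inj (Set.finite_Iio n) (fun i hi j hj he => h.height_inj hi hj he)
        h1.1 hv h3
      subst this
      exact Or.inr ⟨rfl, h1⟩
  · rintro (⟨h1, h2⟩ | ⟨h1, h2⟩)
    · exact ⟨h1, by simp only at h2 ⊢; omega⟩
    · simp only at h1 h2
      subst h1
      exact ⟨h2, Nat.lt_succ_self _⟩

theorem ncard_lowEdges_succ (h : IsNumbering K n X Y) {v : ℕ} (hv : v < n) :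
    (lowEdges K n X Y (rankIn Y (Set.Iio n) v + 1)).ncard =
      (lowEdges K n X Y (rankIn Y (Set.Iio n) v)).ncard + (ups K n X Y v).ncard := by
  have himg : {p : ℕ × ℕ | p.1 = v ∧ p.2 ∈ ups K n X Y v} = Prod.mk v '' ups K n X Y v := by
    ext ⟨a, b⟩
    simp [eq_comm, and_comm]
  rw [lowEdges_succ h hv, Set.ncard_union_eq ?_ (lowEdges_finite K n X Y _)
    (himg ▸ (ups_finite K n X Y v).image _), himg, Set.InjOn.ncard_image]
  · exact fun a _ b _ he => (Prod.mk.inj he).2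
  · rw [Set.disjoint_left]
    rintro ⟨a, b⟩ ⟨h1, h2⟩ ⟨h3, -⟩
    simp only at h2 h3
    rw [h3] at h2
    exact lt_irrefl _ h2

theorem ncard_lowEdges_le (h : IsNumbering K n X Y) (t : ℕ) :
    (lowEdges K n X Y t).ncard ≤ 3 * n := by
  refine (Set.ncard_le_ncard (t := {p | UpEdge K n X Y p.1 p.2}) (fun p hp => hp.1) ?_).trans ?_
  · rw [← lowEdges_all]; exact lowEdges_finite K n X Y n
  · rw [← h.ncard_edges]; exact h.ncard_edges_le

/-- An injective map of a finite set to itself is onto. -/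
theorem exists_rankIn_eq (h : IsNumbering K n X Y) {t : ℕ} (ht : t < n) :
    ∃ v < n, rankIn Y (Set.Iio n) v = t := by
  have hinj : Set.InjOn (rankIn Y (Set.Iio n)) (Set.Iio n) := fun u hu w hw he =>
    rankIn_inj (Set.finite_Iio n) (fun i hi j hj he => h.height_inj hi hj he) hu hw he
  have hsub : rankIn Y (Set.Iio n) '' Set.Iio n ⊆ Set.Iio n := by
    rintro _ ⟨u, hu, rfl⟩
    have := rankIn_lt_ncard (key := Y) (Set.finite_Iio n) hu
    simpa [Set.ncard_eq_toFinset_card'] using this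
  have heq := Set.eq_of_subset_of_ncard_le hsub (by rw [hinj.ncard_image]) (Set.finite_Iio n)
  have : t ∈ rankIn Y (Set.Iio n) '' Set.Iio n := by rw [heq]; exact ht
  obtain ⟨v, hv, hvt⟩ := this
  exact ⟨v, hv, hvt⟩

end

/-- Find all edges. -/
def allEdges : Prog := forLoop .h (.mem (.const 0)) vertexStep

/-- The up-degrees sum to the number of edges, which is at most `3 n`. With one downward query per
vertex and at most `64 * log n` queries per edge this gives the bound `n + 192 * (n * log n)`. -/
theorem Does.allEdges : ∃ C : ℝ, 0 ≤ C ∧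
    ∀ (O : Plane → DgmData) (q : ℕ) (K : PlaneComplex) (n : ℕ) (st : State),
    IsOracleFor K O → IsNumbering K n st.px st.py → st.nats 0 = n → 0 < n →
    (∀ u < n, st.F .ord (rankIn st.py (Set.Iio n) u) = u) → st.F .m 0 = 0 →
    Does O q allEdges st
      (C * (n * (n + (3 * n).size + 1) + n * (((3 * n).size + 1 + q) * Real.log n)) + n * q)
      (fun s => Pres False (.h :: vertexVars) st s ∧
        (s.queries : ℝ) ≤ st.queries + n + 192 * (n * Real.log n) ∧
        s.F .m 0 ≤ 3 * n ∧
        Set.BijOn s.arc (Set.Iio (s.F .m 0)) {p | UpEdge K n st.px st.py p.1 p.2}) := by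
  obtain ⟨C, hC, H⟩ := Does.vertexStep
  have t0 := forCost_nonneg .h (.mem (.const 0))
  refine ⟨7 * C + 2 * forCost .h (.mem (.const 0)), by positivity, ?_⟩
  intro O q K n st hO hnum hn hn0 hord hm
  set E : ℕ → Set (ℕ × ℕ) := lowEdges K n st.px st.py with hE
  have hl := Real.log_natCast_nonneg n
  set Sz : ℝ := (((3 * n).size : ℕ) : ℝ) with hSz
  have hSz0 : 0 ≤ Sz := Nat.cast_nonneg _
  set W : ℝ := n + 1 + (Sz + 1 + q) * Real.log n with hW
  have hW0 : 0 ≤ W := by positivity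
  have hn1 : (1 : ℝ) ≤ n := by exact_mod_cast hn0
  refine (Does.for (quiet := False) (X := vertexVars) n
    (fun t => C * ((ups K n st.px st.py (st.F .ord t)).ncard * W + (4 * n + Sz + 1)) + q)
    (fun t s => (s.queries : ℝ) ≤ st.queries + t + 64 * (E t).ncard * Real.log n ∧
      s.F .m 0 = (E t).ncard ∧ Set.BijOn s.arc (Set.Iio (E t).ncard) (E t))
    (by simp [vertexVars, edgeVars, searchVars]) (fun _ => by positivity) ?_ ?_ ?_).mono ?_ ?_
  · have h0 : E 0 = ∅ := by simp [hE, lowEdges]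
    rw [h0]
    simp [hm]
  · intro s hs
    simp [NExpr.eval, hs.nats_zero, hn]
  · rintro t s ht hs hst ⟨h1, h2, h3⟩
    obtain ⟨v, hv, hvt⟩ := exists_rankIn_eq hnum ht
    have hov : st.F .ord t = v := by rw [← hvt, hord v hv]
    have hEt : ∀ p, p ∈ E t ↔ UpEdge K n st.px st.py p.1 p.2 ∧ rankIn st.py (Set.Iio n) p.1 < t :=
      fun p => Iff.rfl
    have hcard : (E (t + 1)).ncard = (E t).ncard + (ups K n st.px st.py v).ncard := by
      have := ncard_lowEdges_succ hnum hv
      rwa [hvt] at this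
    have hsucc : E (t + 1) = E t ∪ {p | p.1 = v ∧ p.2 ∈ ups K n st.px st.py v} := by
      have := lowEdges_succ hnum hv
      rwa [hvt] at this
    rw [hov]
    refine (H O q K n s v (E t).ncard (E t) hO (by rw [hs.px, hs.py]; exact hnum)
      (by rw [hs.nats_zero, hn]) hv
      (by rw [hst, hs.F .ord (by simp [vertexVars, edgeVars, searchVars]), hov]) h2 h3 ?_ ?_).mono ?_ ?_
    · rintro u ⟨-, h4⟩
      simp only at h4
      omega
    · intro u
      rw [hs.px, hs.py, hEt]
      refine ⟨fun h => h.1, fun h => ⟨h, ?_⟩⟩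
      rw [← hvt]
      exact rankIn_lt_rankIn (Set.finite_Iio n) h.1 h.2.2.1
    · rw [hs.px, hs.py]
      have h4 : ((E t).ncard : ℝ) ≤ 3 * n := by exact_mod_cast ncard_lowEdges_le hnum t
      have h5 := mul_le_mul_of_nonneg_left h4 hC
      linarith
    · rw [hs.px, hs.py]
      rintro s' ⟨p', h4, h5, h6⟩
      have harc : (s'.set .h 0 (t + 1)).arc = s'.arc := by funext i; simp [State.arc]
      refine ⟨p', ?_, ?_, ?_⟩
      · simp only [State.set_queries]
        rw [hcard]
        push_cast
        linarith
      · rw [State.set_F_of_ne _ (by simp), h5, hcard]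
      · rw [harc, hcard, hsucc]
        exact h6
  · have hsum : ∀ t ≤ n, ∑ j ∈ Finset.range t, (ups K n st.px st.py (st.F .ord j)).ncard =
        (E t).ncard := by
      intro t
      induction t with
      | zero => intro _; simp [hE, lowEdges]
      | succ t ih =>
        intro ht
        obtain ⟨v, hv, hvt⟩ := exists_rankIn_eq hnum (t := t) (by omega)
        have := ncard_lowEdges_succ hnum hv
        rw [hvt] at this
        rw [Finset.sum_range_succ, ih (by omega), hE, this, ← hvt, hord v hv]
    have h4 : (((E n).ncard : ℕ) : ℝ) ≤ 3 * n := by exact_mod_cast ncard_lowEdges_le hnum n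
    have h5 : ∑ t ∈ Finset.range n, (C * ((ups K n st.px st.py (st.F .ord t)).ncard * W +
        (4 * n + Sz + 1)) + q) = C * ((E n).ncard * W + n * (4 * n + Sz + 1)) + n * q := by
      rw [← hsum n le_rfl]
      push_cast
      rw [Finset.sum_add_distrib, ← Finset.mul_sum, Finset.sum_add_distrib, ← Finset.sum_mul]
      simp only [Finset.sum_const, Finset.card_range, nsmul_eq_mul]
    rw [h5]
    have h6 : ((E n).ncard : ℝ) * W ≤ 3 * n * W := mul_le_mul_of_nonneg_right h4 hW0
    have h7 := mul_le_mul_of_nonneg_left h6 hC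
    have h8 : (0 : ℝ) ≤ C * (n * (6 * Sz + 3)) := by positivity
    have h9 : (0 : ℝ) ≤ C * (4 * (n * ((Sz + 1 + q) * Real.log n))) := by positivity
    have g1 : (0 : ℝ) ≤ forCost .h (.mem (.const 0)) *
      (2 * (n * (n + Sz)) + 2 * (n * ((Sz + 1 + q) * Real.log n)) + (n - 1)) := by
      have : (0 : ℝ) ≤ n - 1 := by linarith
      positivity
    rw [hW] at h7 ⊢
    linarith
  · rintro s ⟨h1, h2, h3, h4⟩
    have h5 := ncard_lowEdges_le hnum n
    have h6 : (((E n).ncard : ℕ) : ℝ) ≤ 3 * n := by exact_mod_cast h5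
    refine ⟨h1, ?_, by rw [h3]; exact h5, ?_⟩
    · have := mul_le_mul_of_nonneg_right h6 hl
      linarith
    · rw [h3, ← lowEdges_all]
      exact h4

end RealRAM

namespace RealRAM

open IsNumbering

variable {O : Plane → DgmData} {q : ℕ} {quiet : Prop} {X : List Var} {s s' : State}

/-! ### Output -/

/-- Assignment to an output cell. -/
def State.poke (st : State) (a w : ℕ) : State := { st with nats := Function.update st.nats a w }

theorem Pres.poke (h : Pres quiet X s s') {a : ℕ} (h0 : a ≠ 0) (ha : a < 8 * s'.nats 0 + 16) (w : ℕ) :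
    Pres quiet X s (s'.poke a w) := by
  have hz : (s'.poke a w).nats 0 = s'.nats 0 := Function.update_of_ne h0.symm _ _
  refine ⟨h.reals, hz.trans h.nats_zero, fun y hy => ?_, h.dgms, h.queries⟩
  rw [← h.F y hy]
  funext i
  unfold State.F State.addr
  rw [hz]
  exact Function.update_of_ne (by omega) _ _

/-- Write the edge number `i` to its output cells. -/
def copyStep : Prog :=
  .seq (.setNat (.add (gv .i).dbl (.const 2)) (ld .e₀ (gv .i)))
    (.setNat (.add (gv .i).dbl (.const 3)) (ld .e₁ (gv .i)))

/-- Write all edges to the output cells. -/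
def copyProg : Prog := .seq (forLoop .i (gv .m) copyStep) (.setNat (.const 1) (gv .m))

/-- The bound `m ≤ 3 * n` keeps the output cells below `8 * n + 16`, where the scratch arrays start,
so copying does not destroy the edges still to be copied. -/
theorem Does.copy : ∃ C : ℝ, 0 ≤ C ∧
    ∀ (O : Plane → DgmData) (q : ℕ) (n : ℕ) (st : State) (m : ℕ), st.nats 0 = n → st.F .m 0 = m →
    m ≤ 3 * n →
    Does O q copyProg st (C * (n + 1)) (fun s => Pres True [.i] st s ∧ s.nats 1 = m ∧
      ∀ k < m, s.nats (2 * k + 2) = (st.arc k).1 ∧ s.nats (2 * k + 3) = (st.arc k).2) := by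
  set P : Prog := .setNat (.const 1) (gv .m) with hP
  have t0 := forCost_nonneg .i (gv .m)
  have t1 : (0 : ℝ) ≤ copyStep.time := Nat.cast_nonneg _
  have t2 : (0 : ℝ) ≤ P.time := Nat.cast_nonneg _
  refine ⟨3 * (copyStep.time + forCost .i (gv .m)) + P.time, by positivity, ?_⟩
  intro O q n st m hn hm hmn
  refine Does.step (Does.forSimple (X := []) m (fun t s =>
    ∀ k < t, s.nats (2 * k + 2) = (st.arc k).1 ∧ s.nats (2 * k + 3) = (st.arc k).2) (by simp)
    (by simp [copyStep, Prog.Simple]) (by simp) ?_ ?_) ?_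
  · intro s hs
    rw [gv_eval, hs.F _ (by simp), hm]
  · rintro t s ht hs hst h1
    have hz : s.nats 0 = n := by rw [hs.nats_zero, hn]
    have p1 : Pres True [] s (s.poke (2 * t + 2) (st.arc t).1) :=
      (Pres.refl s).poke (by omega) (by omega) _
    have hz1 : (s.poke (2 * t + 2) (st.arc t).1).nats 0 = n := by rw [p1.nats_zero, hz]
    have hrun : copyStep.run s =
        (s.poke (2 * t + 2) (st.arc t).1).poke (2 * t + 3) (st.arc t).2 := by
      have e1 : (Prog.setNat (.add (gv .i).dbl (.const 2)) (ld .e₀ (gv .i))).run s =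
          s.poke (2 * t + 2) (st.arc t).1 := by
        simp [Prog.run, NExpr.eval, State.poke, hst, hs.F .e₀ (by simp), State.arc]
      rw [copyStep, Prog.run, e1]
      simp only [Prog.run, NExpr.eval, NExpr.eval_dbl, gv_eval, ld_eval, p1.F .i (by simp),
        p1.F .e₁ (by simp), hst, hs.F .e₁ (by simp)]
      rfl
    rw [hrun]
    set s2 := (s.poke (2 * t + 2) (st.arc t).1).poke (2 * t + 3) (st.arc t).2 with hs2
    have p2 : Pres True [] s s2 := p1.poke (by omega) (by omega) _
    refine ⟨p2, fun k hk => ?_⟩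
    have hz2 : s2.nats 0 = n := by rw [p2.nats_zero, hz]
    rw [State.set_nats_of_lt _ _ _ _ _ (by omega), State.set_nats_of_lt _ _ _ _ _ (by omega)]
    simp only [hs2, State.poke, Function.update_apply]
    rcases Nat.lt_succ_iff_lt_or_eq.1 hk with h2 | rfl
    · rw [if_neg (by omega), if_neg (by omega), if_neg (by omega), if_neg (by omega)]
      exact h1 k h2
    · simp
  · rintro s ⟨h1, h2⟩
    have hz : s.nats 0 = n := by rw [h1.nats_zero, hn]
    refine (Does.simple (P := P) trivial (R := fun s' => s' = s.poke 1 m) ?_).mono ?_ ?_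
    · simp [hP, Prog.run, State.poke, NExpr.eval, h1.F .m (by simp), hm]
    · have e1 : (0 : ℝ) ≤ n := Nat.cast_nonneg _
      have e2 : (m : ℝ) ≤ 3 * n := by exact_mod_cast hmn
      have e3 := mul_le_mul_of_nonneg_right e2 (add_nonneg t1 t0)
      have e4 := mul_nonneg t2 e1
      linarith
    · rintro _ rfl
      refine ⟨h1.poke (by omega) (by omega) _, by simp [State.poke], fun k hk => ?_⟩
      simp only [State.poke, Function.update_apply]
      rw [if_neg (by omega), if_neg (by omega)]
      exact h2 k hk

theorem storesVertices_iff {K : PlaneComplex} {st : State} :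
    StoresVertices K st ↔ IsNumbering K (st.nats 0) st.px st.py := Iff.rfl

theorem storesOneSkeleton_of_arcs {K : PlaneComplex} {st : State} {arc : ℕ → ℕ × ℕ}
    (h : IsNumbering K (st.nats 0) st.px st.py)
    (harc : Set.BijOn arc (Set.Iio (st.nats 1)) {p | UpEdge K (st.nats 0) st.px st.py p.1 p.2})
    (hst : ∀ k < st.nats 1, st.nats (2 * k + 2) = (arc k).1 ∧ st.nats (2 * k + 3) = (arc k).2) :
    StoresOneSkeleton K st := by
  classical
  refine ⟨storesVertices_iff.2 h, fun k hk => ?_, (h.bijOn_edges.comp harc).congr fun k hk => ?_⟩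
  · have := harc.mapsTo hk
    rw [(hst k hk).1, (hst k hk).2]
    exact ⟨this.1, this.2.1⟩
  · unfold State.edge
    rw [(hst k hk).1, (hst k hk).2]
    simp only [Function.comp_apply]
    congr

/-- Every program takes at least one step. The time of the vertex reconstruction can therefore
absorb an additive constant, which matters for very small `n`. -/
theorem Exec.one_le {P : Prog} {st st' : State} {t : ℕ} (h : Exec O q P st st' t) : 1 ≤ t := by
  induction h <;> first
    | omega
    | (rename_i c _ _ _; have := c.one_le_cost; omega)

/-- With `k + 1` binary digits one has `2 ^ k ≤ 3 * n`, and `(k + 1) ^ 2 ≤ 4 * 2 ^ k`. -/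
theorem size_sq_le (n : ℕ) (hn : 0 < n) : (3 * n).size ^ 2 ≤ 12 * n := by
  have h1 : ∀ k, (k + 1) ^ 2 ≤ 4 * 2 ^ k := by
    intro k
    rcases Nat.lt_or_ge k 2 with h | h
    · interval_cases k <;> norm_num
    · induction k, h using Nat.le_induction with
      | base => norm_num
      | succ k hk ih => rw [pow_succ 2]; nlinarith
  obtain ⟨k, hk⟩ : ∃ k, (3 * n).size = k + 1 :=
    Nat.exists_eq_succ_of_ne_zero (by rw [Ne, Nat.size_eq_zero]; omega)
  have h2 : 2 ^ k ≤ 3 * n := Nat.lt_size.1 (by omega)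
  have := h1 k
  rw [hk]
  omega

/-- Both factors are at most the number of digits. The estimate absorbs the `n * log ^ 2 n` spent in
binary searches into `n ^ 2`. -/
theorem size_mul_log_le (n : ℕ) (hn : 0 < n) : ((3 * n).size : ℝ) * Real.log n ≤ 12 * n := by
  have h1 : (((3 * n).size ^ 2 : ℕ) : ℝ) ≤ ((12 * n : ℕ) : ℝ) := by exact_mod_cast size_sq_le n hn
  have h2 : Real.log n ≤ (3 * n).size := by
    have h3 : n < 2 ^ (3 * n).size := lt_of_le_of_lt (by omega) (Nat.lt_size_self (3 * n))
    have h4 : (n : ℝ) ≤ 2 ^ (3 * n).size := by exact_mod_cast h3.le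
    have h5 := Real.log_le_log (by exact_mod_cast hn) h4
    rw [Real.log_pow] at h5
    have h6 := Real.log_two_lt_d9
    have h7 : (0 : ℝ) ≤ ((3 * n).size : ℕ) := Nat.cast_nonneg _
    nlinarith
  push_cast at h1
  have h7 : (0 : ℝ) ≤ ((3 * n).size : ℕ) := Nat.cast_nonneg _
  nlinarith

/-- Reconstruct the edges from the vertices. -/
def edgeProg : Prog :=
  .ite (.natLt (.mem (.const 0)) (.const 2)) (.setNat (.const 1) (.const 0))
    (.seq orderProg (.seq (sv .m (.const 0)) (.seq allEdges copyProg)))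

theorem Does.edgeProg : ∃ C : ℝ, 0 ≤ C ∧
    ∀ (O : Plane → DgmData) (q : ℕ) (K : PlaneComplex) (n : ℕ) (st : State),
    IsOracleFor K O → IsNumbering K n st.px st.py → st.nats 0 = n →
    Does O q edgeProg st (C * (1 + (n : ℝ) ^ 2 + n * Real.log n * (2 + q)))
      (fun s => StoresOneSkeleton K s ∧ (s.queries : ℝ) ≤ st.queries + C * (n * Real.log n)) := by
  obtain ⟨C₁, hC₁, H₁⟩ := Does.order
  obtain ⟨C₂, hC₂, H₂⟩ := Does.allEdges
  obtain ⟨C₃, hC₃, H₃⟩ := Does.copy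
  set P : Prog := .setNat (.const 1) (.const 0) with hP
  have t1 : (0 : ℝ) ≤ P.time := Nat.cast_nonneg _
  have t2 : (0 : ℝ) ≤ (sv .m (.const 0)).time := Nat.cast_nonneg _
  set cc : ℝ := (((Test.natLt (.mem (.const 0)) (.const 2)).cost : ℕ) : ℝ) with hcc
  have hcc0 : 0 ≤ cc := Nat.cast_nonneg _
  refine ⟨cc + P.time + 4 * C₁ + (sv .m (.const 0)).time + 20 * C₂ + 2 * C₃ + 200, by positivity, ?_⟩
  intro O q K n st hO hnum hn
  have hl := Real.log_natCast_nonneg n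
  set Λ : ℝ := n * Real.log n with hΛ
  have hΛ0 : 0 ≤ Λ := by positivity
  have hΛq : 0 ≤ Λ * q := by positivity
  have hnn : (0 : ℝ) ≤ (n : ℝ) ^ 2 := by positivity
  refine (Does.ite (T := P.time + 4 * C₁ * (n : ℝ) ^ 2 + (sv .m (.const 0)).time +
    C₂ * (20 * (n : ℝ) ^ 2 + Λ * (1 + q)) + 2 * Λ * q + C₃ * (1 + n)) ?_ ?_).mono ?_ fun _ h => h
  -- With at most one vertex there is no edge, and `n * log n = 0` allows no query at all, so the
  -- program writes the empty list directly.
  · intro hc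
    have hn2 : n < 2 := by simpa [Test.eval, NExpr.eval, hn] using hc
    refine (Does.simple (P := P) trivial (R := fun s => s = st.poke 1 0)
      (by simp [Prog.run, NExpr.eval, State.poke, hP])).mono ?_ ?_
    · have : 0 ≤ C₂ * (20 * (n : ℝ) ^ 2 + Λ * (1 + q)) := by positivity
      have : 0 ≤ C₃ * (1 + (n : ℝ)) := by positivity
      have : 0 ≤ C₁ * (n : ℝ) ^ 2 := by positivity
      linarith
    · rintro _ rfl
      have hz : (st.poke 1 0).nats 0 = n := hn
      have h1 : (st.poke 1 0).nats 1 = 0 := by simp [State.poke]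
      refine ⟨storesOneSkeleton_of_arcs (arc := fun _ => (0, 0)) (by rw [hz]; exact hnum) ?_ ?_, ?_⟩
      · rw [hz, h1]
        have : {p : ℕ × ℕ | UpEdge K n (st.poke 1 0).px (st.poke 1 0).py p.1 p.2} = ∅ := by
          refine Set.eq_empty_of_forall_notMem ?_
          rintro ⟨a, b⟩ ⟨h2, h3, h4, -⟩
          simp only at h2 h3 h4
          obtain rfl : a = b := by omega
          exact lt_irrefl _ h4
        rw [this]
        simp
      · rw [h1]; intro k hk; omega
      · have : 0 ≤ (cc + P.time + 4 * C₁ + (sv .m (.const 0)).time + 20 * C₂ + 2 * C₃ + 200) * Λ := by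
          positivity
        have h2 : ((st.poke 1 0).queries : ℝ) = st.queries := rfl
        linarith
  · intro hc
    have hn2 : 1 < n := by simpa [Test.eval, NExpr.eval, hn] using hc
    have hnr : (2 : ℝ) ≤ n := by exact_mod_cast hn2
    -- For `n ≥ 2` this yields `n ≤ 2 * (n * log n)`, so the `n` downward queries fit into the
    -- bound.
    have hlog : 1 / 2 ≤ Real.log n := by
      have := Real.log_le_log (by norm_num) hnr
      have := Real.log_two_gt_d9
      linarith
    have hnΛ : (n : ℝ) ≤ 2 * Λ := by rw [hΛ]; nlinarith
    refine Does.step (H₁ O q n st hn fun i hi j hj he => hnum.height_inj hi hj he) ?_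
    rintro s1 ⟨p1, hord⟩
    refine Does.step (Does.simple (sv_simple _ _) (R := fun s => s = s1.set .m 0 0)
      (by simp [NExpr.eval])) ?_
    rintro _ rfl
    set s2 := s1.set .m 0 0 with hs2
    have hz2 : s2.nats 0 = n := by rw [hs2, State.set_nats_zero, p1.nats_zero, hn]
    have hpx2 : s2.px = st.px := by rw [hs2, State.set_px, p1.px]
    have hpy2 : s2.py = st.py := by rw [hs2, State.set_py, p1.py]
    refine Does.step (H₂ O q K n s2 hO (by rw [hpx2, hpy2]; exact hnum) hz2 (by omega)
      (by rw [hpy2, hs2, State.set_F_of_ne _ (by simp)]; exact hord) (by simp [hs2])) ?_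
    rintro s3 ⟨p3, hq3, hm3, hbij⟩
    have hz3 : s3.nats 0 = n := by rw [p3.nats_zero, hz2]
    refine (H₃ O q n s3 (s3.F .m 0) hz3 rfl hm3).mono ?_ ?_
    · have e1 := size_mul_log_le n (by omega)
      have e2 : (((3 * n).size : ℕ) : ℝ) ≤ 3 * n := by
        exact_mod_cast Nat.size_le.2 (Nat.lt_two_pow_self (n := 3 * n))
      set Sz : ℝ := (((3 * n).size : ℕ) : ℝ)
      have f1 : ((n : ℝ) + 1) * (n + 1) ≤ 4 * (n : ℝ) ^ 2 := by nlinarith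
      have f2 : (n : ℝ) * (n + Sz + 1) ≤ 5 * (n : ℝ) ^ 2 := by nlinarith
      have f3 : (n : ℝ) * ((Sz + 1 + q) * Real.log n) ≤ 12 * (n : ℝ) ^ 2 + Λ * (1 + q) := by
        rw [hΛ]; nlinarith
      have f4 : (n : ℝ) * q ≤ 2 * Λ * q := mul_le_mul_of_nonneg_right hnΛ (Nat.cast_nonneg q)
      have g1 := mul_le_mul_of_nonneg_left f1 hC₁
      have g2 := mul_le_mul_of_nonneg_left (add_le_add f2 f3) hC₂
      have g3 := mul_nonneg hC₂ hnn
      linarith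
    · rintro s ⟨p4, h1, h2⟩
      have hz : s.nats 0 = n := by rw [p4.nats_zero, hz3]
      have hpx : s.px = st.px := by rw [p4.px, p3.px, hpx2]
      have hpy : s.py = st.py := by rw [p4.py, p3.py, hpy2]
      refine ⟨storesOneSkeleton_of_arcs (arc := s3.arc) ?_ ?_ ?_, ?_⟩
      · rw [hz, hpx, hpy]; exact hnum
      · rw [hz, h1, hpx, hpy, ← hpx2, ← hpy2]; exact hbij
      · rw [h1]; exact h2
      · have h3 : s2.queries = st.queries := by rw [hs2, State.set_queries, p1.queries trivial]
        rw [h3] at hq3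
        rw [p4.queries trivial]
        have : 0 ≤ (cc + P.time + 4 * C₁ + (sv .m (.const 0)).time + 20 * C₂ + 2 * C₃) * Λ := by
          positivity
        linarith
  · rw [← hcc]
    have hn1 : (n : ℝ) ≤ 1 + (n : ℝ) ^ 2 := by nlinarith [sq_nonneg ((n : ℝ) - 1)]
    set Z : ℝ := 1 + (n : ℝ) ^ 2 + Λ * (2 + q) with hZ
    have z1 : 1 ≤ Z := by nlinarith
    have z2 : (n : ℝ) ^ 2 ≤ Z := by nlinarith
    have z3 : 20 * (n : ℝ) ^ 2 + Λ * (1 + q) ≤ 20 * Z := by nlinarith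
    have z4 : Λ * q ≤ Z := by nlinarith
    have z5 : 1 + (n : ℝ) ≤ 2 * Z := by nlinarith
    have g0 := mul_le_mul_of_nonneg_left z1 hcc0
    have g1 := mul_le_mul_of_nonneg_left z1 t1
    have g2 := mul_le_mul_of_nonneg_left z1 t2
    have g3 := mul_le_mul_of_nonneg_left z2 hC₁
    have g4 := mul_le_mul_of_nonneg_left z3 hC₂
    have g5 := mul_le_mul_of_nonneg_left z5 hC₃
    linarith

end RealRAM

/-! ### Vertex reconstruction followed by edge reconstruction -/

theorem mainTheorem5 :
    ∃ (edgeProg : RealRAM.Prog) (C : ℝ), ∀ (𝒦 : Set PlaneComplex) (oracleTime : ℕ → ℕ)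
      (vertProg : RealRAM.Prog) (vertTime vertDgms : ℕ → ℝ),
      RealRAM.Reconstructs RealRAM.StoresVertices 𝒦 oracleTime vertProg vertTime vertDgms →
      RealRAM.Reconstructs RealRAM.StoresOneSkeleton 𝒦 oracleTime
        (RealRAM.Prog.seq vertProg edgeProg)
        (fun n => C * (vertTime n + (n : ℝ) ^ 2 +
          (n : ℝ) * Real.log n * (2 + (oracleTime n : ℝ))))
        (fun n => C * (vertDgms n + (n : ℝ) * Real.log n)) := by
  obtain ⟨C, hC, H⟩ := RealRAM.Does.edgeProg
  -- The additional 1 pays for the vertex reconstruction itself. The term `C * vertTime n`, with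
  -- `vertTime n ≥ 1`, covers the constant overhead of the edge reconstruction.
  refine ⟨RealRAM.edgeProg, C + 1, ?_⟩
  intro 𝒦 oracleTime vertProg vertTime vertDgms hP K hK O hO
  obtain ⟨st, t₁, h₁, hst, hT, hD⟩ := hP K hK O hO
  have hnum := RealRAM.storesVertices_iff.1 hst
  have hn : st.nats 0 = K.numVerts := hnum.ncard_verts.symm
  rw [hn] at hnum
  obtain ⟨st', t₂, h₂, ht₂, hst', hq⟩ := H O (oracleTime K.numVerts) K K.numVerts st hO hnum hn
  refine ⟨st', t₁ + t₂, .seq h₁ h₂, hst', ?_, ?_⟩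
  · have h1 : (1 : ℝ) ≤ t₁ := by exact_mod_cast h₁.one_le
    have hl := Real.log_natCast_nonneg K.numVerts
    set Z : ℝ := (K.numVerts : ℝ) ^ 2 +
      (K.numVerts : ℝ) * Real.log K.numVerts * (2 + (oracleTime K.numVerts : ℝ)) with hZ
    have hZ0 : 0 ≤ Z := by positivity
    have h2 := mul_le_mul_of_nonneg_left (h1.trans hT) hC
    push_cast
    linarith
  · have hl := Real.log_natCast_nonneg K.numVerts
    have h1 : (0 : ℝ) ≤ st.queries := Nat.cast_nonneg _
    have h2 := mul_nonneg hC (h1.trans hD)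
    have h3 : (0 : ℝ) ≤ K.numVerts * Real.log K.numVerts := by positivity
    linarith

end
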